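/- **Gray's theorem.** Let $(M,g,J)$ be a compact Kähler manifold (without boundary), i.e. $(M,g)$ is a compact smooth Riemannian manifold with Levi-Civita connection $\nabla$, and $J$ is a smooth endomorphism field of $TM$ with $J^2=-\mathrm{id}$, $g(JX,JY)=g(X,Y)$ and $\nabla J=0$. Let $R_{X,Y}=\nabla_X\nabla_Y-\nabla_Y\nabla_X-\nabla_{[X,Y]}$ be its curvature, regarded also as the tensor $R(X,Y,U,V)=g(R_{X,Y}U,V)$, and let $\mathrm{Ric}(X,Y)=\sum_i R(e_i,X,Y,e_i)$ and $\kappa=\sum_i\mathrm{Ric}(e_i,e_i)$ (for orthonormal bases $(e_i)$ of the tangent spaces) be its Ricci tensor and scalar curvature. Assume that all sectional curvatures of $(M,g)$ are non-negative. Then: 1. if the scalar curvature $\kappa$ is constant, then the Ricci tensor is parallel, $\nabla\mathrm{Ric}=0$; 2. if the Ricci tensor is parallel, then the Riemannian curvature tensor is parallel, $\nabla R=0$. Hence, if the scalar curvature is constant, then $M$ is locally symmetric, i.e. $\nabla R=0$. -/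

import Mathlib

open Bundle NormedSpace
open scoped Manifold ContDiff

noncomputable section

namespace RiemannianGeometry

variable {E : Type*} [NormedAddCommGroup E] [NormedSpace ℝ E]
  {M : Type*} [TopologicalSpace M] [ChartedSpace E M] [IsManifold 𝓘(ℝ, E) ∞ M]
  [RiemannianBundle (fun x : M ↦ TangentSpace 𝓘(ℝ, E) x)]
  [IsContMDiffRiemannianBundle 𝓘(ℝ, E) ∞ E (fun x : M ↦ TangentSpace 𝓘(ℝ, E) x)]

theorem mdifferentiableAt_inner {X Y : Π x : M, TangentSpace 𝓘(ℝ, E) x} {x : M}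
    (hX : MDiffAt (T% X) x) (hY : MDiffAt (T% Y) x) :
    MDiffAt (fun y ↦ inner ℝ (X y) (Y y)) x :=
  MDifferentiableAt.inner_bundle (IB := 𝓘(ℝ, E)) (F := E)
    (E := fun x : M ↦ TangentSpace 𝓘(ℝ, E) x) (b := fun y ↦ y) hX hY

variable [FiniteDimensional ℝ E]

instance finiteDimensional_tangentSpace (x : M) :
    FiniteDimensional ℝ (TangentSpace 𝓘(ℝ, E) x) :=
  inferInstanceAs (FiniteDimensional ℝ E)

instance completeSpace_tangentSpace (x : M) :
    CompleteSpace (TangentSpace 𝓘(ℝ, E) x) :=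
  FiniteDimensional.complete ℝ _

/-! ### The Levi-Civita connection -/

/-- The right-hand side of the Koszul formula, i.e. the expression which equals
`2 ⟨∇_X Y, Z⟩` for the Levi-Civita connection `∇`. -/
def koszul (X Y Z : Π x : M, TangentSpace 𝓘(ℝ, E) x) (x : M) : ℝ :=
  d% (fun y ↦ inner ℝ (Y y) (Z y)) x (X x) + d% (fun y ↦ inner ℝ (X y) (Z y)) x (Y x)
    - d% (fun y ↦ inner ℝ (X y) (Y y)) x (Z x)
    + inner ℝ (VectorField.mlieBracket 𝓘(ℝ, E) X Y x) (Z x)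
    - inner ℝ (VectorField.mlieBracket 𝓘(ℝ, E) X Z x) (Y x)
    - inner ℝ (VectorField.mlieBracket 𝓘(ℝ, E) Y Z x) (X x)

theorem koszul_tensorial_left {Y Z : Π x : M, TangentSpace 𝓘(ℝ, E) x} {x : M}
    (hY : MDiffAt (T% Y) x) (hZ : MDiffAt (T% Z) x) :
    TensorialAt 𝓘(ℝ, E) E (koszul · Y Z x) x where
  smul {f X} hf hX := by
    have h1 := mvfderiv_fun_mul hf (mdifferentiableAt_inner hX hZ)
    have h2 := mvfderiv_fun_mul hf (mdifferentiableAt_inner hX hY)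
    simp only [koszul, Pi.smul_apply', real_inner_smul_left, map_smul, h1, h2,
      VectorField.mlieBracket_smul_left hf hX, inner_add_left, inner_smul_right, smul_eq_mul,
      add_apply, smul_apply]
    ring
  add {X X'} hX hX' := by
    have h1 := mvfderiv_fun_add (mdifferentiableAt_inner hX hZ) (mdifferentiableAt_inner hX' hZ)
    have h2 := mvfderiv_fun_add (mdifferentiableAt_inner hX hY) (mdifferentiableAt_inner hX' hY)
    simp only [koszul, Pi.add_apply, inner_add_left, inner_add_right, map_add, h1, h2,
      VectorField.mlieBracket_add_left hX hX', add_apply]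
    ring

theorem koszul_tensorial_right {X Y : Π x : M, TangentSpace 𝓘(ℝ, E) x} {x : M}
    (hX : MDiffAt (T% X) x) (hY : MDiffAt (T% Y) x) :
    TensorialAt 𝓘(ℝ, E) E (koszul X Y · x) x where
  smul {f Z} hf hZ := by
    have h1 := mvfderiv_fun_mul hf (mdifferentiableAt_inner hX hZ)
    have h2 := mvfderiv_fun_mul hf (mdifferentiableAt_inner hY hZ)
    simp only [koszul, Pi.smul_apply', inner_smul_right, map_smul, h1, h2,
      VectorField.mlieBracket_smul_right hf hZ, inner_add_left, real_inner_smul_left, smul_eq_mul,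
      add_apply, smul_apply]
    rw [real_inner_comm (Y x) (Z x), real_inner_comm (X x) (Z x)]
    ring
  add {Z Z'} hZ hZ' := by
    have h1 := mvfderiv_fun_add (mdifferentiableAt_inner hX hZ) (mdifferentiableAt_inner hX hZ')
    have h2 := mvfderiv_fun_add (mdifferentiableAt_inner hY hZ) (mdifferentiableAt_inner hY hZ')
    simp only [koszul, Pi.add_apply, inner_add_left, inner_add_right, map_add, h1, h2,
      VectorField.mlieBracket_add_right hZ hZ', add_apply]
    ring

/-- The Koszul expression in the middle argument is a derivation. -/
theorem koszul_smul_middle {X Y Z : Π x : M, TangentSpace 𝓘(ℝ, E) x} {f : M → ℝ} {x : M}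
    (hf : MDiffAt f x) (hX : MDiffAt (T% X) x) (hY : MDiffAt (T% Y) x) (hZ : MDiffAt (T% Z) x) :
    koszul X (f • Y) Z x
      = f x * koszul X Y Z x + 2 * (d% f x (X x) * inner ℝ (Y x) (Z x)) := by
  have h1 := mvfderiv_fun_mul hf (mdifferentiableAt_inner hX hY)
  have h2 := mvfderiv_fun_mul hf (mdifferentiableAt_inner hY hZ)
  simp only [koszul, Pi.smul_apply', inner_smul_right, map_smul, h1, h2,
    VectorField.mlieBracket_smul_right hf hY, VectorField.mlieBracket_smul_left hf hY,
    inner_add_left, real_inner_smul_left, smul_eq_mul,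
    add_apply, smul_apply]
  rw [real_inner_comm (Y x) (X x)]
  ring

theorem koszul_add_middle {X Y Y' Z : Π x : M, TangentSpace 𝓘(ℝ, E) x} {x : M}
    (hX : MDiffAt (T% X) x) (hY : MDiffAt (T% Y) x) (hY' : MDiffAt (T% Y') x)
    (hZ : MDiffAt (T% Z) x) :
    koszul X (Y + Y') Z x = koszul X Y Z x + koszul X Y' Z x := by
  have h1 := mvfderiv_fun_add (mdifferentiableAt_inner hX hY) (mdifferentiableAt_inner hX hY')
  have h2 := mvfderiv_fun_add (mdifferentiableAt_inner hY hZ) (mdifferentiableAt_inner hY' hZ)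
  simp only [koszul, Pi.add_apply, inner_add_left, inner_add_right, map_add, h1, h2,
    VectorField.mlieBracket_add_right hY hY', VectorField.mlieBracket_add_left hY hY',
    add_apply]
  ring

/-- The bilinear form `(v, w) ↦ 2 ⟨∇_v Y, w⟩` on the tangent space at `x`, for a vector field `Y`
which is differentiable at `x`. -/
def koszulForm {Y : Π x : M, TangentSpace 𝓘(ℝ, E) x} {x : M} (hY : MDiffAt (T% Y) x) :
    TangentSpace 𝓘(ℝ, E) x →L[ℝ] TangentSpace 𝓘(ℝ, E) x →L[ℝ] ℝ :=
  TensorialAt.mkHom₂ (I := 𝓘(ℝ, E)) (F := E) (F' := E) (fun X Z ↦ koszul X Y Z x) x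
    (fun _ hZ ↦ koszul_tensorial_left hY hZ) (fun _ hX ↦ koszul_tensorial_right hX hY)

open Classical in
/-- The linear map `v ↦ ∇_v Y` on the tangent space at `x`, determined by the Koszul formula
(with the value zero if `Y` is not differentiable at `x`). -/
def leviCivitaAux (Y : Π x : M, TangentSpace 𝓘(ℝ, E) x) (x : M) :
    TangentSpace 𝓘(ℝ, E) x →L[ℝ] TangentSpace 𝓘(ℝ, E) x :=
  if hY : MDiffAt (T% Y) x then
    LinearMap.toContinuousLinearMap
      { toFun := fun v ↦ (1 / 2 : ℝ) •
          (InnerProductSpace.toDual ℝ (TangentSpace 𝓘(ℝ, E) x)).symm (koszulForm hY v)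
        map_add' := fun v w ↦ by simp
        map_smul' := fun c v ↦ by simp [smul_smul, mul_comm] }
  else 0

theorem inner_leviCivitaAux {X Y Z : Π x : M, TangentSpace 𝓘(ℝ, E) x} {x : M}
    (hX : MDiffAt (T% X) x) (hY : MDiffAt (T% Y) x) (hZ : MDiffAt (T% Z) x) :
    2 * inner ℝ (leviCivitaAux Y x (X x)) (Z x) = koszul X Y Z x := by
  have h : koszulForm hY (X x) (Z x) = koszul X Y Z x :=
    TensorialAt.mkHom₂_apply (I := 𝓘(ℝ, E)) (F := E) (F' := E)
      (Φ := fun X Z ↦ koszul X Y Z x) _ _ hX hZ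
  rw [leviCivitaAux, dif_pos hY, LinearMap.coe_toContinuousLinearMap', LinearMap.coe_mk,
    AddHom.coe_mk, real_inner_smul_left, InnerProductSpace.toDual_symm_apply, h]
  ring

set_option linter.unusedSectionVars false in
theorem ext_inner_tangent {x : M} {A B : TangentSpace 𝓘(ℝ, E) x →L[ℝ] TangentSpace 𝓘(ℝ, E) x}
    (h : ∀ X Z : Π y : M, TangentSpace 𝓘(ℝ, E) y, MDiffAt (T% X) x → MDiffAt (T% Z) x →
      2 * inner ℝ (A (X x)) (Z x) = 2 * inner ℝ (B (X x)) (Z x)) : A = B := by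
  ext v
  refine ext_inner_right ℝ fun w ↦ ?_
  have := h (FiberBundle.extend E v) (FiberBundle.extend E w)
    (FiberBundle.mdifferentiableAt_extend 𝓘(ℝ, E) E v) (FiberBundle.mdifferentiableAt_extend 𝓘(ℝ, E) E w)
  simpa using this

variable (E M) in
/-- The Levi-Civita connection of the Riemannian manifold `M`. As for every covariant derivative
in Mathlib, `leviCivita E M Y x (X x)` stands for `(∇_X Y)(x)`. -/
def leviCivita : CovariantDerivative 𝓘(ℝ, E) E (fun x : M ↦ TangentSpace 𝓘(ℝ, E) x) where
  toFun := leviCivitaAux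
  isCovariantDerivativeOnUniv :=
    { add := fun {Y Y' x} hY hY' _ ↦ ext_inner_tangent fun X Z hX hZ ↦ by
        rw [inner_leviCivitaAux hX (mdifferentiableAt_add_section hY hY') hZ,
          koszul_add_middle hX hY hY' hZ, add_apply, inner_add_left, mul_add,
          inner_leviCivitaAux hX hY hZ, inner_leviCivitaAux hX hY' hZ]
      leibniz := fun {Y f x} hY hf _ ↦ ext_inner_tangent fun X Z hX hZ ↦ by
        rw [inner_leviCivitaAux hX (hf.smul_section hY) hZ,
          koszul_smul_middle hf hX hY hZ, add_apply, inner_add_left, mul_add,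
          smul_apply, real_inner_smul_left, ← inner_leviCivitaAux hX hY hZ,
          ContinuousLinearMap.smulRight_apply, real_inner_smul_left]
        ring }

/-- The Levi-Civita connection is compatible with the metric. -/
theorem leviCivita_metric {X Y Z : Π x : M, TangentSpace 𝓘(ℝ, E) x} {x : M}
    (hX : MDiffAt (T% X) x) (hY : MDiffAt (T% Y) x) (hZ : MDiffAt (T% Z) x) :
    d% (fun y ↦ inner ℝ (Y y) (Z y)) x (X x)
      = inner ℝ (leviCivita E M Y x (X x)) (Z x) + inner ℝ (Y x) (leviCivita E M Z x (X x)) := by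
  have h1 := inner_leviCivitaAux hX hY hZ
  have h2 := inner_leviCivitaAux hX hZ hY
  have h3 : VectorField.mlieBracket 𝓘(ℝ, E) Z Y x = - VectorField.mlieBracket 𝓘(ℝ, E) Y Z x :=
    VectorField.mlieBracket_swap_apply
  have h4 : (fun y ↦ inner ℝ (Z y) (Y y)) = (fun y ↦ inner ℝ (Y y) (Z y)) :=
    funext fun y ↦ real_inner_comm _ _
  simp only [koszul, h3, h4, inner_neg_left] at h1 h2
  change _ = inner ℝ (leviCivitaAux Y x (X x)) (Z x) + inner ℝ (Y x) (leviCivitaAux Z x (X x))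
  rw [real_inner_comm (leviCivitaAux Z x (X x))]
  linarith

/-- The Levi-Civita connection is torsion-free. -/
theorem leviCivita_torsion : (leviCivita E M).torsion = 0 := by
  rw [CovariantDerivative.torsion_eq_zero_iff]
  intro X Y x hX hY
  refine ext_inner_right ℝ fun w ↦ ?_
  have hw := FiberBundle.mdifferentiableAt_extend 𝓘(ℝ, E) E w
  have h1 := inner_leviCivitaAux hX hY hw
  have h2 := inner_leviCivitaAux hY hX hw
  have h3 : VectorField.mlieBracket 𝓘(ℝ, E) Y X x = - VectorField.mlieBracket 𝓘(ℝ, E) X Y x :=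
    VectorField.mlieBracket_swap_apply
  have h4 : (fun y ↦ inner ℝ (Y y) (X y)) = (fun y ↦ inner ℝ (X y) (Y y)) :=
    funext fun y ↦ real_inner_comm _ _
  simp only [koszul, h3, h4, inner_neg_left, FiberBundle.extend_apply_self] at h1 h2
  change inner ℝ (leviCivitaAux Y x (X x) - leviCivitaAux X x (Y x)) w = _
  rw [inner_sub_left]
  linarith

/-! ### Curvature -/

/-- The Riemannian curvature `R_{u,v} w` at `x`, i.e.
`∇_X ∇_Y Z - ∇_Y ∇_X Z - ∇_{[X,Y]} Z` at `x` for (arbitrary) vector fields `X`, `Y`, `Z`, smooth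
near `x`, with values `u`, `v`, `w` at `x`. -/
def curvature (x : M) (u v w : TangentSpace 𝓘(ℝ, E) x) : TangentSpace 𝓘(ℝ, E) x :=
  let X := FiberBundle.extend E u
  let Y := FiberBundle.extend E v
  let Z := FiberBundle.extend E w
  leviCivita E M (fun y ↦ leviCivita E M Z y (Y y)) x u
    - leviCivita E M (fun y ↦ leviCivita E M Z y (X y)) x v
    - leviCivita E M Z x (VectorField.mlieBracket 𝓘(ℝ, E) X Y x)

variable (E M) in
/-- A (not necessarily smooth) field of functions of `k` tangent vectors; covariant `k`-tensors
are the multilinear ones. -/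
abbrev TensorField (k : ℕ) : Type _ := Π x : M, (Fin k → TangentSpace 𝓘(ℝ, E) x) → ℝ

variable (E M) in
/-- The curvature tensor `R(X, Y, U, V) = g(R_{X,Y} U, V)`. -/
def curvatureTensor : TensorField E M 4 :=
  fun x v ↦ inner ℝ (curvature x (v 0) (v 1) (v 2)) (v 3)

variable (E M) in
/-- The Ricci tensor `Ric(u, v) = ∑ i, R(e_i, u, v, e_i)` for an orthonormal basis `e`. -/
def ricciTensor : TensorField E M 2 :=
  fun x v ↦ ∑ i, curvatureTensor E M x
    ![stdOrthonormalBasis ℝ (TangentSpace 𝓘(ℝ, E) x) i, v 0, v 1,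
      stdOrthonormalBasis ℝ (TangentSpace 𝓘(ℝ, E) x) i]

variable (E) in
/-- The scalar curvature, the metric trace of the Ricci tensor. -/
def scalarCurvature (x : M) : ℝ :=
  ∑ i, ricciTensor E M x
    ![stdOrthonormalBasis ℝ (TangentSpace 𝓘(ℝ, E) x) i,
      stdOrthonormalBasis ℝ (TangentSpace 𝓘(ℝ, E) x) i]

/-- The sectional curvature of the plane spanned by `u` and `v`
(relevant for linearly independent `u`, `v`). -/
def sectionalCurvature (x : M) (u v : TangentSpace 𝓘(ℝ, E) x) : ℝ :=
  curvatureTensor E M x ![u, v, v, u] / (‖u‖ ^ 2 * ‖v‖ ^ 2 - inner ℝ u v ^ 2)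

variable (E M) in
/-- All sectional curvatures of `M` are non-negative. -/
def NonnegSectionalCurvature : Prop :=
  ∀ (x : M) (u v : TangentSpace 𝓘(ℝ, E) x), LinearIndependent ℝ ![u, v] →
    0 ≤ sectionalCurvature x u v

/-! ### Parallel tensors, locally symmetric spaces, Kähler manifolds -/

/-- The covariant derivative of a tensor field:
`(∇_X T)(Y₁, …, Yₖ) = X (T(Y₁, …, Yₖ)) - ∑ i, T(Y₁, …, ∇_X Yᵢ, …, Yₖ)`. -/
def covDeriv {k : ℕ} (T : TensorField E M k) (Y : Fin k → Π x : M, TangentSpace 𝓘(ℝ, E) x)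
    (x : M) (v : TangentSpace 𝓘(ℝ, E) x) : ℝ :=
  d% (fun y ↦ T y fun i ↦ Y i y) x v
    - ∑ i, T x (Function.update (fun j ↦ Y j x) i (leviCivita E M (Y i) x v))

/-- A differentiable tensor field is parallel if `∇T = 0`. -/
def IsParallel {k : ℕ} (T : TensorField E M k) : Prop :=
  ∀ (x : M) (Y : Fin k → Π x : M, TangentSpace 𝓘(ℝ, E) x), (∀ i, CMDiffAt ∞ (T% (Y i)) x) →
    MDiffAt (fun y ↦ T y fun i ↦ Y i y) x ∧ ∀ v : TangentSpace 𝓘(ℝ, E) x, covDeriv T Y x v = 0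

variable (E M) in
/-- A Riemannian manifold is locally symmetric if its curvature tensor is parallel. -/
def IsLocallySymmetric : Prop := IsParallel (curvatureTensor E M)

/-- `J` is the complex structure of a Kähler manifold: a smooth orthogonal almost complex structure
which is parallel for the Levi-Civita connection, `∇_v (J Y) = J (∇_v Y)`. -/
structure IsKahler (J : Π x : M, TangentSpace 𝓘(ℝ, E) x →L[ℝ] TangentSpace 𝓘(ℝ, E) x) : Prop where
  smooth : ContMDiff 𝓘(ℝ, E) (𝓘(ℝ, E).prod 𝓘(ℝ, E →L[ℝ] E)) ∞
    fun x ↦ TotalSpace.mk' (E →L[ℝ] E)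
      (E := fun x : M ↦ TangentSpace 𝓘(ℝ, E) x →L[ℝ] TangentSpace 𝓘(ℝ, E) x) x (J x)
  sq_eq_neg : ∀ (x : M) (v : TangentSpace 𝓘(ℝ, E) x), J x (J x v) = -v
  inner_map : ∀ (x : M) (u v : TangentSpace 𝓘(ℝ, E) x), inner ℝ (J x u) (J x v) = inner ℝ u v
  parallel : ∀ (x : M) (Y : Π x : M, TangentSpace 𝓘(ℝ, E) x), CMDiffAt ∞ (T% Y) x →
    ∀ v : TangentSpace 𝓘(ℝ, E) x,
      leviCivita E M (fun y ↦ J y (Y y)) x v = J x (leviCivita E M Y x v)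

end RiemannianGeometry

end

open RiemannianGeometry

/-! The proof is a Bochner argument on the sphere bundle. For a tangent vector V put F(V) = Ric(V,V)
in part 1 and F(V) = R(V,JV,JV,V) in part 2. Constant scalar curvature makes Ric divergence-free,
and parallel Ric makes R divergence-free. Combined with the second Bianchi identity, the Kähler
symmetries and the Ricci identity, this turns the rough Laplacian ΔF(V) into Q(V) + Q(JV) with Q
quadratic in the curvature (`laplacian_ric`, `laplacian_curv`).

On each tangent space, Q is minus the divergence of a field Φ tangent to the spheres. Integration by
parts over a fibre gives ∫ F Q = ∫ dF(Φ), and dF(Φ) at v is a positive multiple of R(w,v,v,w), where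
w = Ric(v) in part 1 and w = R(v,Jv)Jv in part 2. Non-negative sectional curvature therefore gives ∫
F Q ≥ 0 (`integral_ricci_nonneg`, `integral_curvature_nonneg`), and since F(JV) = F(V), also ∫ F ΔF
≥ 0.

Let N(x) be the integral of F² over the fibre at x. Then ½ΔN = ∫ |∇F|² + ∫ F ΔF ≥ 0, so by Hopf's
maximum principle N is locally constant on the compact manifold, and ∇F = 0 (`eq_zero_of_bochner`).
No integration over M is involved. Polarisation turns this into ∇Ric = 0. In part 2 it says that ∇R
has vanishing holomorphic sectional curvature, which forces a tensor with Kähler curvature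
symmetries to vanish (`IsCurvLike.eq_zero`).

Two devices keep the computation global. Orthonormal frames are replaced by a Parseval frame, that
is, finitely many smooth fields s_i with ∑ g(X,s_i) s_i = X; traces are computed with it as with an
orthonormal basis, and tensor calculus becomes algebra over the ring of smooth functions
(`KahlerAlgebra`). Sphere integrals are replaced by integrals over η ∈ ℝⁿ, with V = ∑ η_i s_i,
against a radial cut-off. Covariant differentiation of the frame acts on η as an infinitesimal
rotation, so fibre integration commutes with ∇ (`integral_fderiv_comb_eq_zero`). -/

set_option linter.unusedSectionVars false

noncomputable section

/-! ### Kähler calculus over a ring of functions; traces in Parseval frames -/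

/-- The algebra of vector fields on a Kähler manifold, with a finite Parseval frame. -/
structure KahlerAlgebra (A 𝔛 ι : Type*) [CommRing A] [Algebra ℝ A] [AddCommGroup 𝔛] [Module A 𝔛]
    [Fintype ι] where
  D : 𝔛 →+ A →+ A
  nab : 𝔛 →+ 𝔛 →+ 𝔛
  g : 𝔛 →ₗ[A] 𝔛 →ₗ[A] A
  J : 𝔛 →ₗ[A] 𝔛
  s : ι → 𝔛
  D_mul : ∀ (X : 𝔛) (f h : A), D X (f * h) = D X f * h + f * D X h
  nab_smul_left : ∀ (f : A) (X Y : 𝔛), nab (f • X) Y = f • nab X Y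
  nab_smul : ∀ (X : 𝔛) (f : A) (Y : 𝔛), nab X (f • Y) = D X f • Y + f • nab X Y
  g_comm : ∀ X Y, g X Y = g Y X
  metric : ∀ X Y Z, D X (g Y Z) = g (nab X Y) Z + g Y (nab X Z)
  D_bracket : ∀ (X Y : 𝔛) (f : A), D (nab X Y - nab Y X) f = D X (D Y f) - D Y (D X f)
  jacobi : ∀ X Y Z : 𝔛,
    nab X (nab Y Z - nab Z Y) - nab (nab Y Z - nab Z Y) X =
      (nab (nab X Y - nab Y X) Z - nab Z (nab X Y - nab Y X)) +
      (nab Y (nab X Z - nab Z X) - nab (nab X Z - nab Z X) Y)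
  J_sq : ∀ X, J (J X) = -X
  J_iso : ∀ X Y, g (J X) (J Y) = g X Y
  nab_J : ∀ X Y, nab X (J Y) = J (nab X Y)
  parseval : ∀ X, ∑ i, g X (s i) • s i = X

namespace KahlerAlgebra

variable {A 𝔛 ι : Type*} [CommRing A] [Algebra ℝ A] [AddCommGroup 𝔛] [Module A 𝔛] [Fintype ι]
  (K : KahlerAlgebra A 𝔛 ι)

theorem two_cancel {a b : A} (h : 2 * a = 2 * b) : a = b := by
  have h2 : (algebraMap ℝ A (1 / 2)) * 2 = 1 := by
    have : (2 : A) = algebraMap ℝ A 2 := (map_ofNat _ 2).symm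
    rw [this, ← map_mul]; norm_num
  calc a = (algebraMap ℝ A (1 / 2)) * (2 * a) := by rw [← mul_assoc, h2, one_mul]
    _ = b := by rw [h, ← mul_assoc, h2, one_mul]

/-- The Parseval expansion recovers a field from its inner products, so `g` is non-degenerate. -/
theorem ext_g {X Y : 𝔛} (h : ∀ Z, K.g X Z = K.g Y Z) : X = Y := by
  rw [← K.parseval X, ← K.parseval Y]
  simp [h]

theorem g_parseval (X Y : 𝔛) : ∑ i, K.g X (K.s i) * K.g (K.s i) Y = K.g X Y := by
  conv_rhs => rw [← K.parseval X]
  simp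

/-- Two Parseval frames give the same traces. -/
theorem trace_eq {κ : Type*} [Fintype κ] {P : Type*} [AddCommGroup P] [Module A P] (t : κ → 𝔛)
    (ht : ∀ X Y, ∑ i, K.g X (t i) * K.g (t i) Y = K.g X Y) (T : 𝔛 →ₗ[A] 𝔛 →ₗ[A] P) :
    ∑ i, T (t i) (t i) = ∑ i, T (K.s i) (K.s i) := by
  -- Both arguments are expanded in `s`. The frame then enters only through ∑ g(s_j,t_i) g(s_k,t_i),
  -- which is g(s_j,s_k) for every Parseval frame.
  have h (X : 𝔛) : T X X = ∑ j, ∑ k, (K.g X (K.s j) * K.g X (K.s k)) • T (K.s j) (K.s k) := by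
    conv_lhs => rw [← K.parseval X]
    simp only [map_sum, LinearMap.sum_apply, map_smul, LinearMap.smul_apply,
      Finset.smul_sum, smul_smul]
    rw [Finset.sum_comm]
    refine Finset.sum_congr rfl fun i _ ↦ Finset.sum_congr rfl fun j _ ↦ ?_
    rw [mul_comm]
  simp_rw [h]
  rw [Finset.sum_comm]
  conv_rhs => rw [Finset.sum_comm]
  refine Finset.sum_congr rfl fun j _ ↦ ?_
  rw [Finset.sum_comm]
  conv_rhs => rw [Finset.sum_comm]
  refine Finset.sum_congr rfl fun k _ ↦ ?_
  rw [← Finset.sum_smul, ← Finset.sum_smul]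
  congr 1
  trans K.g (K.s j) (K.s k)
  · rw [← ht]
    exact Finset.sum_congr rfl fun i _ ↦ by rw [K.g_comm (t i) (K.s j)]
  · rw [← K.g_parseval (K.s j)]
    exact Finset.sum_congr rfl fun i _ ↦ by rw [K.g_comm (K.s j) (K.s i)]

/-- Differentiate the Parseval identity for Y and Z: the terms containing ∇Y and ∇Z cancel by metric
compatibility. The single fields s_i are not parallel, but the tensor ∑ s_i ⊗ s_i is, and this is
what makes traces commute with ∇. -/
theorem parseval_nab (X Y Z : 𝔛) :
    ∑ i, (K.g Y (K.nab X (K.s i)) * K.g (K.s i) Z + K.g Y (K.s i) * K.g (K.nab X (K.s i)) Z) = 0 := by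
  have h := congrArg (K.D X) (K.g_parseval Y Z)
  simp only [map_sum, K.D_mul, K.metric] at h
  rw [← K.g_parseval (K.nab X Y), ← K.g_parseval Y] at h
  simp only [add_mul, mul_add, Finset.sum_add_distrib] at h ⊢
  linear_combination h

/-- The metric trace of a bilinear map is parallel. -/
theorem trace_nab {P : Type*} [AddCommGroup P] [Module A P] (X : 𝔛) (T : 𝔛 →ₗ[A] 𝔛 →ₗ[A] P) :
    ∑ i, (T (K.nab X (K.s i)) (K.s i) + T (K.s i) (K.nab X (K.s i))) = 0 := by
  have h (Y Z : 𝔛) : T Y Z = ∑ j, ∑ k, (K.g Y (K.s j) * K.g Z (K.s k)) • T (K.s j) (K.s k) := by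
    conv_lhs => rw [← K.parseval Y, ← K.parseval Z]
    simp only [map_sum, LinearMap.sum_apply, map_smul, LinearMap.smul_apply,
      Finset.smul_sum, smul_smul]
    rw [Finset.sum_comm]
    refine Finset.sum_congr rfl fun i _ ↦ Finset.sum_congr rfl fun j _ ↦ ?_
    rw [mul_comm]
  have h2 (i : ι) : T (K.nab X (K.s i)) (K.s i) + T (K.s i) (K.nab X (K.s i)) =
      ∑ j, ∑ k, (K.g (K.s j) (K.nab X (K.s i)) * K.g (K.s i) (K.s k) +
        K.g (K.s j) (K.s i) * K.g (K.nab X (K.s i)) (K.s k)) • T (K.s j) (K.s k) := by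
    rw [h, h (K.s i), ← Finset.sum_add_distrib]
    refine Finset.sum_congr rfl fun j _ ↦ ?_
    rw [← Finset.sum_add_distrib]
    refine Finset.sum_congr rfl fun k _ ↦ ?_
    rw [K.g_comm (K.s j), K.g_comm (K.s j), add_smul]
  simp_rw [h2]
  rw [Finset.sum_comm]
  refine Finset.sum_eq_zero fun j _ ↦ ?_
  rw [Finset.sum_comm]
  refine Finset.sum_eq_zero fun k _ ↦ ?_
  rw [← Finset.sum_smul, K.parseval_nab, zero_smul]

/-! ### Curvature -/

/-- The curvature operator. -/
def curv : 𝔛 →ₗ[A] 𝔛 →ₗ[A] 𝔛 →ₗ[A] 𝔛 where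
  toFun X := LinearMap.mk₂ A
    (fun Y Z ↦ K.nab X (K.nab Y Z) - K.nab Y (K.nab X Z) - K.nab (K.nab X Y - K.nab Y X) Z)
    (fun Y Y' Z ↦ by
      simp only [map_add, map_sub, AddMonoidHom.add_apply, AddMonoidHom.sub_apply]; abel)
    (fun f Y Z ↦ by
      simp only [map_add, map_sub, AddMonoidHom.add_apply, AddMonoidHom.sub_apply,
        K.nab_smul_left, K.nab_smul]
      module)
    (fun Y Z Z' ↦ by simp only [map_add, map_sub, AddMonoidHom.sub_apply]; abel)
    (fun f Y Z ↦ by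
      -- In the last slot the second derivatives of `f` cancel against the bracket term.
      simp only [map_add, K.nab_smul, K.D_bracket]
      module)
  map_add' X X' := by
    ext Y Z
    simp only [map_add, map_sub, AddMonoidHom.add_apply, AddMonoidHom.sub_apply,
      LinearMap.mk₂_apply, LinearMap.add_apply]; abel
  map_smul' f X := by
    ext Y Z
    simp only [map_add, map_sub, AddMonoidHom.add_apply, AddMonoidHom.sub_apply,
      LinearMap.mk₂_apply, LinearMap.smul_apply, K.nab_smul_left, K.nab_smul, RingHom.id_apply]
    module

theorem curv_apply (X Y Z : 𝔛) : K.curv X Y Z =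
    K.nab X (K.nab Y Z) - K.nab Y (K.nab X Z) - K.nab (K.nab X Y - K.nab Y X) Z := rfl

/-- The covariant derivative of the curvature operator. -/
def dcurv : 𝔛 →ₗ[A] 𝔛 →ₗ[A] 𝔛 →ₗ[A] 𝔛 →ₗ[A] 𝔛 where
  toFun U :=
    { toFun := fun X ↦ LinearMap.mk₂ A
        (fun Y Z ↦ K.nab U (K.curv X Y Z) - K.curv (K.nab U X) Y Z - K.curv X (K.nab U Y) Z
          - K.curv X Y (K.nab U Z))
        (fun Y Y' Z ↦ by simp only [map_add, LinearMap.add_apply]; abel)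
        (fun f Y Z ↦ by
          simp only [map_add, map_smul, LinearMap.add_apply, LinearMap.smul_apply, K.nab_smul]
          module)
        (fun Y Z Z' ↦ by simp only [map_add]; abel)
        (fun f Y Z ↦ by simp only [map_add, map_smul, K.nab_smul]; module)
      map_add' := fun X X' ↦ by
        ext Y Z
        simp only [map_add, LinearMap.mk₂_apply, LinearMap.add_apply]; abel
      map_smul' := fun f X ↦ by
        ext Y Z
        simp only [map_add, map_smul, LinearMap.mk₂_apply, LinearMap.add_apply,
          LinearMap.smul_apply, K.nab_smul, RingHom.id_apply]
        module }
  map_add' U U' := by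
    ext X Y Z
    simp only [map_add, AddMonoidHom.add_apply, LinearMap.mk₂_apply, LinearMap.add_apply,
      LinearMap.coe_mk, AddHom.coe_mk]
    abel
  map_smul' f U := by
    ext X Y Z
    simp only [K.nab_smul_left, map_smul, LinearMap.mk₂_apply, LinearMap.smul_apply,
      LinearMap.coe_mk, AddHom.coe_mk, RingHom.id_apply]
    module

theorem dcurv_apply (U X Y Z : 𝔛) : K.dcurv U X Y Z =
    K.nab U (K.curv X Y Z) - K.curv (K.nab U X) Y Z - K.curv X (K.nab U Y) Z
          - K.curv X Y (K.nab U Z) := rfl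

/-- The second covariant derivative of the curvature operator. -/
def d2curv (W U X Y Z : 𝔛) : 𝔛 :=
  K.nab W (K.dcurv U X Y Z) - K.dcurv (K.nab W U) X Y Z - K.dcurv U (K.nab W X) Y Z
    - K.dcurv U X (K.nab W Y) Z - K.dcurv U X Y (K.nab W Z)

/-- Ricci identity: the antisymmetrised second derivative acts as the derivation R(W,U). With
torsion zero, the bracket in R(W,U) is exactly the difference of the two correction terms ∇_W U and
∇_U W. -/
theorem d2curv_comm (W U X Y Z : 𝔛) : K.d2curv W U X Y Z - K.d2curv U W X Y Z =
    K.curv W U (K.curv X Y Z) - K.curv (K.curv W U X) Y Z - K.curv X (K.curv W U Y) Z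
      - K.curv X Y (K.curv W U Z) := by
  simp only [d2curv, dcurv_apply, map_sub, AddMonoidHom.sub_apply, LinearMap.sub_apply,
    K.curv_apply W U]
  abel

theorem curv_skew (X Y Z : 𝔛) : K.curv X Y Z = -K.curv Y X Z := by
  simp only [curv_apply, map_sub, AddMonoidHom.sub_apply]; abel

/-- Expand the commutator of derivatives of the function g(Z,W) by metric compatibility; R(X,Y) acts
as zero on functions. -/
theorem curv_skew' (X Y Z W : 𝔛) : K.g (K.curv X Y Z) W = -K.g (K.curv X Y W) Z := by
  have h := K.D_bracket X Y (K.g Z W)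
  simp only [K.metric, map_add, map_sub, AddMonoidHom.sub_apply] at h
  simp only [curv_apply, map_sub, LinearMap.sub_apply, AddMonoidHom.sub_apply]
  rw [K.g_comm _ Z, K.g_comm _ Z, K.g_comm _ Z, K.g_comm _ Z]
  linear_combination -h

/-- The bracket is ∇_X Y − ∇_Y X, so the first Bianchi identity is the Jacobi identity rewritten. -/
theorem curv_bianchi (X Y Z : 𝔛) : K.curv X Y Z + K.curv Y Z X + K.curv Z X Y = 0 := by
  have h := K.jacobi X Y Z
  simp only [map_sub, AddMonoidHom.sub_apply] at h
  simp only [curv_apply, map_sub, AddMonoidHom.sub_apply]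
  rw [← sub_eq_zero] at h
  rw [← h]
  abel

theorem curv_J (X Y Z : 𝔛) : K.curv X Y (K.J Z) = K.J (K.curv X Y Z) := by
  simp only [curv_apply, K.nab_J, map_sub, AddMonoidHom.sub_apply]

/-- After expansion the iterated derivatives cancel formally, and what is left is ∇ of Z along the
cyclic sum in the Jacobi identity. -/
theorem dcurv_bianchi (U X Y Z : 𝔛) : K.dcurv U X Y Z + K.dcurv X Y U Z + K.dcurv Y U X Z = 0 := by
  have h := congrArg (fun W ↦ K.nab W Z) (K.jacobi U X Y)
  simp only [map_sub, map_add, AddMonoidHom.sub_apply, AddMonoidHom.add_apply] at h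
  simp only [dcurv_apply, curv_apply, map_sub, AddMonoidHom.sub_apply]
  rw [← sub_eq_zero] at h
  rw [← neg_eq_zero, ← h]
  abel

/-! ### Algebraic Kähler curvature tensors -/

/-- Tensors with the algebraic symmetries of the curvature of a Kähler manifold. -/
structure IsCurvLike (T : 𝔛 → 𝔛 → 𝔛 → 𝔛) : Prop where
  neg : ∀ X Y Z, T (-X) Y Z = -T X Y Z
  skew : ∀ X Y Z, T X Y Z = -T Y X Z
  skew' : ∀ X Y Z W, K.g (T X Y Z) W = -K.g (T X Y W) Z
  bianchi : ∀ X Y Z, T X Y Z + T Y Z X + T Z X Y = 0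
  map_J : ∀ X Y Z, T X Y (K.J Z) = K.J (T X Y Z)

namespace IsCurvLike
variable {K} {T : 𝔛 → 𝔛 → 𝔛 → 𝔛} (hT : K.IsCurvLike T)
include hT

/-- The classical octahedron argument: a signed sum of the four Bianchi identities obtained by
rotating (X,Y,Z,W) leaves twice the claim, and 2 is invertible. -/
theorem pair (X Y Z W : 𝔛) : K.g (T X Y Z) W = K.g (T Z W X) Y := by
  have b (X Y Z W : 𝔛) : K.g (T X Y Z) W + K.g (T Y Z X) W + K.g (T Z X Y) W = 0 := by
    rw [← LinearMap.add_apply, ← LinearMap.add_apply, ← map_add, ← map_add, hT.bianchi]; simp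
  have sk (X Y Z W : 𝔛) : K.g (T X Y Z) W = -K.g (T Y X Z) W := by
    rw [hT.skew]; simp
  have b1 := b X Y Z W
  have b2 := b Y Z W X
  have b3 := b Z W X Y
  have b4 := b W X Y Z
  apply two_cancel
  linear_combination b1 + b2 - b3 - b4 - hT.skew' Y Z W X - hT.skew' Z W Y X + hT.skew' W X Z Y
    + sk X Z W Y - hT.skew' Z X W Y + hT.skew' X Y W Z + sk Y W X Z - hT.skew' W Y X Z
end IsCurvLike
end KahlerAlgebra

namespace KahlerAlgebra

variable {A 𝔛 ι : Type*} [CommRing A] [Algebra ℝ A] [AddCommGroup 𝔛] [Module A 𝔛] [Fintype ι]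
  (K : KahlerAlgebra A 𝔛 ι)

theorem g_J_right (X Y : 𝔛) : K.g X (K.J Y) = -K.g (K.J X) Y := by
  rw [← K.J_iso X, K.J_sq]; simp

/-- An isometry carries Parseval frames to Parseval frames, so `trace_eq` allows s_i to be replaced
by J s_i in traces. -/
theorem J_parseval (X Y : 𝔛) :
    ∑ i, K.g X (K.J (K.s i)) * K.g (K.J (K.s i)) Y = K.g X Y := by
  rw [← K.J_iso X, ← K.g_parseval]
  refine Finset.sum_congr rfl fun i _ ↦ ?_
  rw [g_J_right, K.g_comm _ Y, g_J_right, K.g_comm _ (K.J Y)]; ring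

/-- Trace the form T(a, Jb) in the frame J s_i and use J² = −1. -/
theorem trace_J {P : Type*} [AddCommGroup P] [Module A P] (T : 𝔛 →ₗ[A] 𝔛 →ₗ[A] P) :
    ∑ i, T (K.J (K.s i)) (K.s i) = - ∑ i, T (K.s i) (K.J (K.s i)) := by
  have h := K.trace_eq (fun i ↦ K.J (K.s i)) K.J_parseval
    (LinearMap.mk₂ A (fun a b ↦ T a (K.J b)) (by simp) (by simp) (by simp) (by simp))
  simp only [LinearMap.mk₂_apply, K.J_sq, map_neg, Finset.sum_neg_distrib] at h
  rw [← h, neg_neg]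

namespace IsCurvLike
variable {K} {T T' : 𝔛 → 𝔛 → 𝔛 → 𝔛}

theorem neg₂ (hT : K.IsCurvLike T) (X Y Z : 𝔛) : T X (-Y) Z = -T X Y Z := by
  rw [hT.skew, hT.neg, hT.skew Y]; simp

theorem neg₃ (hT : K.IsCurvLike T) (X Y Z : 𝔛) : T X Y (-Z) = -T X Y Z := by
  rw [← K.J_sq, hT.map_J, hT.map_J, K.J_sq]

/-- Pair symmetry moves J from the first pair of arguments to the last pair, where it commutes with
T and is an isometry. -/
theorem J₁₂ (hT : K.IsCurvLike T) (X Y Z : 𝔛) : T (K.J X) (K.J Y) Z = T X Y Z := by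
  refine K.ext_g fun W ↦ ?_
  rw [hT.pair, hT.map_J, K.J_iso, hT.pair]

theorem J₁ (hT : K.IsCurvLike T) (X Y Z : 𝔛) : T (K.J X) Y Z = -T X (K.J Y) Z := by
  rw [← hT.J₁₂ X, K.J_sq, hT.neg₂, neg_neg]

theorem sub (hT : K.IsCurvLike T) (hT' : K.IsCurvLike T') :
    K.IsCurvLike fun X Y Z ↦ T X Y Z - T' X Y Z where
  neg X Y Z := by rw [hT.neg, hT'.neg]; abel
  skew X Y Z := by rw [hT.skew, hT'.skew]; abel
  skew' X Y Z W := by simp only [map_sub, LinearMap.sub_apply]; rw [hT.skew', hT'.skew']; ring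
  bianchi X Y Z := by
    rw [← sub_zero (0 : 𝔛)]; nth_rw 1 [← hT.bianchi X Y Z]; rw [← hT'.bianchi X Y Z]; abel
  map_J X Y Z := by rw [hT.map_J, hT'.map_J, map_sub]

/-- ∇_U is a derivation compatible with g and J. Differentiating a symmetry and subtracting its
instances with ∇_U inserted in one argument at a time gives the same symmetry for ∇_U T. -/
theorem deriv (hT : K.IsCurvLike T) (U : 𝔛) :
    K.IsCurvLike fun X Y Z ↦ K.nab U (T X Y Z) - T (K.nab U X) Y Z - T X (K.nab U Y) Z
      - T X Y (K.nab U Z) where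
  neg X Y Z := by simp only [hT.neg, map_neg]; abel
  skew X Y Z := by
    rw [hT.skew X Y, hT.skew _ Y, hT.skew X, hT.skew X Y, map_neg]; abel
  skew' X Y Z W := by
    have h := congrArg (K.D U) (hT.skew' X Y Z W)
    simp only [map_neg, K.metric] at h
    simp only [map_sub, LinearMap.sub_apply]
    linear_combination h - hT.skew' (K.nab U X) Y Z W - hT.skew' X (K.nab U Y) Z W
      - hT.skew' X Y (K.nab U Z) W - hT.skew' X Y Z (K.nab U W)
  bianchi X Y Z := by
    have h := congrArg (K.nab U) (hT.bianchi X Y Z)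
    simp only [map_add, map_zero] at h
    have h1 := hT.bianchi (K.nab U X) Y Z
    have h2 := hT.bianchi X (K.nab U Y) Z
    have h3 := hT.bianchi X Y (K.nab U Z)
    calc _ = (K.nab U (T X Y Z) + K.nab U (T Y Z X) + K.nab U (T Z X Y))
        - (T (K.nab U X) Y Z + T Y Z (K.nab U X) + T Z (K.nab U X) Y)
        - (T X (K.nab U Y) Z + T (K.nab U Y) Z X + T Z X (K.nab U Y))
        - (T X Y (K.nab U Z) + T Y (K.nab U Z) X + T (K.nab U Z) X Y) := by abel
      _ = 0 := by rw [h, h1, h2, h3]; abel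
  map_J X Y Z := by simp only [hT.map_J, K.nab_J, map_sub]

end IsCurvLike

theorem isCurvLike_curv : K.IsCurvLike fun X Y Z ↦ K.curv X Y Z where
  neg := by simp
  skew := K.curv_skew
  skew' := K.curv_skew'
  bianchi := K.curv_bianchi
  map_J := K.curv_J

theorem isCurvLike_dcurv (U : 𝔛) : K.IsCurvLike fun X Y Z ↦ K.dcurv U X Y Z :=
  K.isCurvLike_curv.deriv U

theorem isCurvLike_d2curv (W U : 𝔛) : K.IsCurvLike fun X Y Z ↦ K.d2curv W U X Y Z := by
  convert ((K.isCurvLike_dcurv U).deriv W).sub (K.isCurvLike_dcurv (K.nab W U)) using 4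
  simp only [d2curv]; abel

/-! ### The Ricci operator -/

/-- The Ricci contraction of a trilinear map. -/
def ricOf (T : 𝔛 →ₗ[A] 𝔛 →ₗ[A] 𝔛 →ₗ[A] 𝔛) : 𝔛 →ₗ[A] 𝔛 where
  toFun Y := ∑ i, T Y (K.s i) (K.s i)
  map_add' := by simp [Finset.sum_add_distrib]
  map_smul' := by simp [Finset.smul_sum]

theorem ricOf_apply (T : 𝔛 →ₗ[A] 𝔛 →ₗ[A] 𝔛 →ₗ[A] 𝔛) (Y : 𝔛) :
    K.ricOf T Y = ∑ i, T Y (K.s i) (K.s i) := rfl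

section
variable {K} {T : 𝔛 →ₗ[A] 𝔛 →ₗ[A] 𝔛 →ₗ[A] 𝔛} (hT : K.IsCurvLike fun X Y Z ↦ T X Y Z)
include hT

theorem ricOf_symm (X Y : 𝔛) : K.g (K.ricOf T X) Y = K.g X (K.ricOf T Y) := by
  rw [K.g_comm X]
  simp only [ricOf_apply, map_sum, LinearMap.sum_apply]
  refine Finset.sum_congr rfl fun i _ ↦ ?_
  have h1 := hT.pair X (K.s i) (K.s i) Y
  have h2 := hT.skew' (K.s i) Y X (K.s i)
  have h3 := hT.skew (K.s i) Y (K.s i)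
  rw [h1, h2, h3]
  simp

theorem ricOf_J (X : 𝔛) : K.ricOf T (K.J X) = K.J (K.ricOf T X) := by
  have h := K.trace_J (T X)
  have h1 (Y : 𝔛) : T X Y (K.J Y) = K.J (T X Y Y) := hT.map_J X Y Y
  have h2 (Y : 𝔛) : T (K.J X) Y Y = -T X (K.J Y) Y := hT.J₁ X Y Y
  simp only [h1, ← map_sum] at h
  simp only [ricOf_apply, h2, Finset.sum_neg_distrib, h, neg_neg]

/-- The Ricci form is half the J-trace of the curvature over its last two arguments: Bianchi splits
the trace into two Ricci terms, equal because Ric commutes with J. The first two arguments stay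
free, so the second Bianchi identity passes to the Ricci form. -/
theorem two_ricOf (X Y : 𝔛) :
    ∑ i, K.g (T X Y (K.s i)) (K.J (K.s i)) = 2 * K.g (K.ricOf T X) (K.J Y) := by
  have h1 : K.g (K.ricOf T X) (K.J Y) = K.g (K.J X) (K.ricOf T Y) * (-1) := by
    rw [ricOf_symm hT, ricOf_J hT, g_J_right]; ring
  have h2 : 2 * K.g (K.ricOf T X) (K.J Y) =
      K.g (K.ricOf T X) (K.J Y) - K.g (K.ricOf T Y) (K.J X) := by
    rw [K.g_comm (K.ricOf T Y)]; linear_combination h1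
  rw [h2]
  simp only [ricOf_apply, map_sum, LinearMap.sum_apply, ← Finset.sum_sub_distrib]
  refine Finset.sum_congr rfl fun i _ ↦ ?_
  have b : T X Y (K.s i) = - T Y (K.s i) X - T (K.s i) X Y := by
    have := hT.bianchi X Y (K.s i)
    rw [← sub_eq_zero, ← this]; abel
  have e1 := hT.map_J (K.s i) X Y
  have e2 := hT.map_J Y (K.s i) X
  have e3 := hT.skew' (K.s i) X (K.J Y) (K.s i)
  have e4 := hT.skew' Y (K.s i) (K.J X) (K.s i)
  have e5 := hT.skew X (K.s i) (K.s i)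
  rw [b, map_sub, map_neg, LinearMap.sub_apply, LinearMap.neg_apply, g_J_right, g_J_right,
    ← e1, ← e2, e3, e4, e5]
  simp
  ring

end

/-- The Ricci operator. -/
def Rc : 𝔛 →ₗ[A] 𝔛 := K.ricOf K.curv

/-- The covariant derivative of the Ricci operator. -/
def dRc (X : 𝔛) : 𝔛 →ₗ[A] 𝔛 := K.ricOf (K.dcurv X)

/-- The second covariant derivative of the Ricci operator. -/
def d2Rc (W X Y : 𝔛) : 𝔛 :=
  K.nab W (K.dRc X Y) - K.dRc (K.nab W X) Y - K.dRc X (K.nab W Y)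

/-- Contraction commutes with ∇: by `trace_nab` the derivatives of the frame fields drop out of the
trace. -/
theorem dRc_apply (X Y : 𝔛) : K.dRc X Y = K.nab X (K.Rc Y) - K.Rc (K.nab X Y) := by
  have h := K.trace_nab X (K.curv Y)
  simp only [dRc, Rc, ricOf_apply, dcurv_apply, map_sum, Finset.sum_sub_distrib,
    Finset.sum_add_distrib] at h ⊢
  rw [← sub_eq_zero, ← neg_eq_zero, ← h]; abel

theorem dRc_add (X X' Y : 𝔛) : K.dRc (X + X') Y = K.dRc X Y + K.dRc X' Y := by
  simp [dRc, ricOf_apply, Finset.sum_add_distrib]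

theorem dRc_smul (f : A) (X Y : 𝔛) : K.dRc (f • X) Y = f • K.dRc X Y := by
  simp [dRc, ricOf_apply, Finset.smul_sum]

theorem dRc_neg (X Y : 𝔛) : K.dRc (-X) Y = -K.dRc X Y := by
  simp [dRc, ricOf_apply]

theorem dRc_symm (U X Y : 𝔛) : K.g (K.dRc U X) Y = K.g X (K.dRc U Y) :=
  ricOf_symm (K.isCurvLike_dcurv U) X Y

theorem dRc_J (U X : 𝔛) : K.dRc U (K.J X) = K.J (K.dRc U X) :=
  ricOf_J (K.isCurvLike_dcurv U) X

/-- The Ricci form is closed. -/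
theorem dRc_closed (U X Y : 𝔛) :
    K.g (K.dRc U X) (K.J Y) + K.g (K.dRc X Y) (K.J U) + K.g (K.dRc Y U) (K.J X) = 0 := by
  apply two_cancel
  rw [mul_add, mul_add]
  simp only [dRc]
  -- Doubling turns the three terms into J-traces of ∇R, to which the second Bianchi identity
  -- applies summand by summand.
  rw [← two_ricOf (K.isCurvLike_dcurv U),
    ← two_ricOf (K.isCurvLike_dcurv X), ← two_ricOf (K.isCurvLike_dcurv Y),
    ← Finset.sum_add_distrib, ← Finset.sum_add_distrib, mul_zero]
  refine Finset.sum_eq_zero fun i _ ↦ ?_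
  rw [← LinearMap.add_apply, ← LinearMap.add_apply, ← map_add, ← map_add, K.dcurv_bianchi]; simp

/-- The scalar curvature. -/
def scal : A := ∑ i, K.g (K.Rc (K.s i)) (K.s i)

theorem D_scal (X : 𝔛) : K.D X K.scal = ∑ i, K.g (K.dRc X (K.s i)) (K.s i) := by
  have h := K.trace_nab X
    (LinearMap.mk₂ A (fun a b ↦ K.g (K.Rc a) b) (by simp) (by simp) (by simp) (by simp))
  simp only [LinearMap.mk₂_apply, Finset.sum_add_distrib] at h
  simp only [scal, map_sum, K.metric, dRc_apply, map_sub, LinearMap.sub_apply,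
    Finset.sum_sub_distrib, Finset.sum_add_distrib]
  linear_combination h

/-- Contracted Bianchi identity, obtained by tracing closedness of the Ricci form over X, s_i, J
s_i: one term is −dκ(X) and each of the other two is the divergence of Ric. -/
theorem D_scal_eq_div (X : 𝔛) : K.D X K.scal = 2 * ∑ i, K.g (K.dRc (K.s i) X) (K.s i) := by
  have h (i : ι) := K.dRc_closed X (K.s i) (K.J (K.s i))
  simp only [K.J_sq, dRc_J, K.J_iso, map_neg] at h
  have h1 := Finset.sum_eq_zero fun i (_ : i ∈ Finset.univ) ↦ h i
  have h2 := K.trace_eq (fun i ↦ K.J (K.s i)) K.J_parseval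
    (LinearMap.mk₂ A (fun a b ↦ K.g (K.dRc a X) b) (by simp [dRc_add]) (by simp [dRc_smul])
      (by simp) (by simp))
  simp only [LinearMap.mk₂_apply] at h2
  simp only [Finset.sum_add_distrib, Finset.sum_neg_distrib, ← D_scal] at h1
  have h3 (i : ι) : K.g (K.dRc (K.s i) (K.s i)) X = K.g (K.dRc (K.s i) X) (K.s i) := by
    rw [dRc_symm, K.g_comm]
  simp only [h3, h2] at h1
  linear_combination -h1

theorem d2Rc_symm (W U X Y : 𝔛) : K.g (K.d2Rc W U X) Y = K.g X (K.d2Rc W U Y) := by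
  have h := congrArg (K.D W) (K.dRc_symm U X Y)
  simp only [K.metric] at h
  simp only [d2Rc, map_sub, LinearMap.sub_apply]
  linear_combination h - K.dRc_symm (K.nab W U) X Y - K.dRc_symm U (K.nab W X) Y
    - K.dRc_symm U X (K.nab W Y)

theorem d2Rc_J (W U X : 𝔛) : K.d2Rc W U (K.J X) = K.J (K.d2Rc W U X) := by
  simp only [d2Rc, dRc_J, K.nab_J, map_sub]

theorem d2Rc_closed (W U X Y : 𝔛) :
    K.g (K.d2Rc W U X) (K.J Y) + K.g (K.d2Rc W X Y) (K.J U) + K.g (K.d2Rc W Y U) (K.J X) = 0 := by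
  have h := congrArg (K.D W) (K.dRc_closed U X Y)
  simp only [K.metric, map_add, K.nab_J, map_zero] at h
  simp only [d2Rc, map_sub, LinearMap.sub_apply]
  linear_combination h - K.dRc_closed (K.nab W U) X Y - K.dRc_closed U (K.nab W X) Y
    - K.dRc_closed U X (K.nab W Y)

/-- The Ricci identity for Ric: the curvature acts on an endomorphism by the commutator. -/
theorem d2Rc_comm (W X Y : 𝔛) : K.d2Rc W X Y - K.d2Rc X W Y =
    K.curv W X (K.Rc Y) - K.Rc (K.curv W X Y) := by
  have sub (X X' Y : 𝔛) : K.dRc (X - X') Y = K.dRc X Y - K.dRc X' Y := by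
    rw [sub_eq_add_neg, dRc_add, dRc_neg, sub_eq_add_neg]
  simp only [d2Rc, dRc_apply, map_sub, curv_apply, AddMonoidHom.sub_apply]
  abel

/-! ### Bochner formula for the Ricci tensor -/

/-- The quadratic curvature expression in the Bochner formula for the Ricci tensor. -/
def bochnerRic (V : 𝔛) : A :=
  -∑ i, (K.g (K.Rc (K.curv (K.s i) V V)) (K.s i) + K.g (K.Rc V) (K.curv (K.s i) V (K.s i)))

/-- Interchange the two derivatives by the Ricci identity. The interchanged term is the derivative
of the divergence of Ric, which vanishes for constant scalar curvature, so only the commutator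
remains. -/
theorem sum_d2Rc (h : ∀ X, K.D X K.scal = 0) (V : 𝔛) :
    ∑ i, K.g (K.d2Rc (K.s i) V V) (K.s i) = K.bochnerRic V := by
  have hdiv (Y : 𝔛) : ∑ i, K.g (K.dRc (K.s i) Y) (K.s i) = 0 := by
    apply two_cancel; rw [← D_scal_eq_div, h, mul_zero]
  -- Differentiate div Ric = 0 along V; `trace_nab` removes the derivatives of the frame.
  have h1 : ∑ i, K.g (K.d2Rc V (K.s i) V) (K.s i) = 0 := by
    have t := K.trace_nab V
      (LinearMap.mk₂ A (fun a b ↦ K.g (K.dRc a V) b) (by simp [dRc_add]) (by simp [dRc_smul])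
        (by simp) (by simp))
    have t2 := congrArg (K.D V) (hdiv V)
    have t3 := hdiv (K.nab V V)
    simp only [LinearMap.mk₂_apply, map_sum, K.metric, Finset.sum_add_distrib, map_zero] at t t2
    simp only [d2Rc, map_sub, LinearMap.sub_apply, Finset.sum_sub_distrib]
    linear_combination t2 - t - t3
  have h2 (i : ι) : K.g (K.d2Rc (K.s i) V V) (K.s i) = K.g (K.d2Rc V (K.s i) V) (K.s i) -
      (K.g (K.Rc (K.curv (K.s i) V V)) (K.s i) + K.g (K.Rc V) (K.curv (K.s i) V (K.s i))) := by
    have := congrArg (fun Z ↦ K.g Z (K.s i)) (K.d2Rc_comm (K.s i) V V)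
    simp only [map_sub, LinearMap.sub_apply, K.curv_skew' (K.s i) V (K.Rc V)] at this
    rw [K.g_comm (K.Rc V)]
    linear_combination this
  simp only [h2, Finset.sum_sub_distrib, h1, bochnerRic, zero_sub]

/-- The Bochner formula for the Ricci tensor of a Kähler metric of constant scalar curvature. -/
theorem laplacian_ric (h : ∀ X, K.D X K.scal = 0) (V : 𝔛) :
    ∑ i, K.g (K.d2Rc (K.s i) (K.s i) V) V = K.bochnerRic V + K.bochnerRic (K.J V) := by
  rw [← K.sum_d2Rc h, ← K.sum_d2Rc h, ← Finset.sum_add_distrib]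
  refine Finset.sum_congr rfl fun i _ ↦ ?_
  -- Closedness of the Ricci form on (s_i, V, JV), differentiated along s_i, trades the pure second
  -- derivative for two mixed ones, one for V and one for JV.
  have := K.d2Rc_closed (K.s i) (K.s i) V (K.J V)
  rw [K.J_sq, d2Rc_J, K.J_iso, K.d2Rc_symm (K.s i) (K.J V), K.g_comm (K.s i), map_neg,
    d2Rc_J] at this
  rw [d2Rc_J]
  simp only [K.g_comm (K.J _)] at this ⊢
  linear_combination -this
end KahlerAlgebra

/-! ### Bochner formula for the curvature tensor -/

namespace KahlerAlgebra

variable {A 𝔛 ι : Type*} [CommRing A] [Algebra ℝ A] [AddCommGroup 𝔛] [Module A 𝔛] [Fintype ι]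
  (K : KahlerAlgebra A 𝔛 ι)

theorem d2curv_bianchi (W U X Y Z : 𝔛) :
    K.d2curv W U X Y Z + K.d2curv W X Y U Z + K.d2curv W Y U X Z = 0 := by
  have h := congrArg (K.nab W) (K.dcurv_bianchi U X Y Z)
  simp only [map_add, map_zero] at h
  have h1 := K.dcurv_bianchi (K.nab W U) X Y Z
  have h2 := K.dcurv_bianchi U (K.nab W X) Y Z
  have h3 := K.dcurv_bianchi U X (K.nab W Y) Z
  have h4 := K.dcurv_bianchi U X Y (K.nab W Z)
  simp only [d2curv]
  linear_combination (norm := module) h - h1 - h2 - h3 - h4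

/-- If the Ricci tensor is parallel, the curvature is divergence-free. -/
theorem div_curv (h : ∀ X Y, K.dRc X Y = 0) (X Z : 𝔛) :
    ∑ i, K.dcurv (K.s i) X (K.s i) Z = 0 := by
  refine K.ext_g fun W ↦ ?_
  simp only [map_sum, LinearMap.sum_apply, map_zero, LinearMap.zero_apply]
  have h1 : ∑ i, K.g (K.dcurv Z W (K.s i) (K.s i)) X = 0 := by
    rw [← LinearMap.sum_apply, ← map_sum]
    have := h Z W
    rw [dRc, ricOf_apply] at this
    rw [this]; simp
  have h2 : ∑ i, K.g (K.dcurv W Z (K.s i) (K.s i)) X = 0 := by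
    rw [← LinearMap.sum_apply, ← map_sum]
    have := h W Z
    rw [dRc, ricOf_apply] at this
    rw [this]; simp
  rw [← sub_zero 0]
  nth_rw 1 [← h1]
  rw [← h2, ← Finset.sum_sub_distrib]
  refine Finset.sum_congr rfl fun i _ ↦ ?_
  -- Pair symmetry brings the differentiated index next to Z and W; the second Bianchi identity then
  -- leaves derivatives along Z and W, whose traces are the components of ∇Ric in `h1` and `h2`.
  have e1 := (K.isCurvLike_dcurv (K.s i)).pair X (K.s i) Z W
  have e2 := congrArg (fun V ↦ K.g V (K.s i)) (K.dcurv_bianchi (K.s i) Z W X)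
  have e3 := (K.isCurvLike_dcurv Z).skew' W (K.s i) X (K.s i)
  have e4 := (K.isCurvLike_dcurv W).skew' (K.s i) Z X (K.s i)
  have e5 := congrArg (fun V ↦ K.g V X) ((K.isCurvLike_dcurv W).skew (K.s i) Z (K.s i))
  simp only [map_add, LinearMap.add_apply, map_zero, LinearMap.zero_apply, map_neg,
    LinearMap.neg_apply] at e2 e5
  linear_combination e1 + e2 - e3 - e4 + e5

/-- The quadratic curvature expression in the Bochner formula for the curvature tensor. -/
def bochnerCurv (V : 𝔛) : A :=
  -∑ i, (K.g (K.curv (K.curv (K.s i) V (K.s i)) (K.J V) (K.J V)) V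
    + K.g (K.curv (K.curv (K.s i) V V) (K.J (K.s i)) (K.J V)) V
    + K.g (K.curv (K.curv (K.s i) V V) (K.J V) (K.J (K.s i))) V
    + K.g (K.curv (K.curv (K.s i) V V) (K.J V) (K.J V)) (K.s i))

/-- As for Ric: after the interchange of derivatives the divergence of R appears and vanishes, and
the commutator R(s_i,V) acts on the four slots of R. -/
theorem sum_d2curv (h : ∀ X Y, K.dRc X Y = 0) (V : 𝔛) :
    -∑ i, K.g (K.d2curv (K.s i) V (K.J V) (K.s i) (K.J V)) V = K.bochnerCurv V := by
  have h1 : ∑ i, K.d2curv V (K.s i) (K.J V) (K.s i) (K.J V) = 0 := by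
    have t := K.trace_nab V
      (LinearMap.mk₂ A (fun a b ↦ K.dcurv a (K.J V) b (K.J V)) (by simp) (by simp)
        (by simp) (by simp))
    have t2 := congrArg (K.nab V) (K.div_curv h (K.J V) (K.J V))
    have t3 := K.div_curv h (K.nab V (K.J V)) (K.J V)
    have t4 := K.div_curv h (K.J V) (K.nab V (K.J V))
    simp only [LinearMap.mk₂_apply, map_sum, Finset.sum_add_distrib, map_zero] at t t2
    simp only [d2curv, Finset.sum_sub_distrib]
    linear_combination (norm := module) t2 - t - t3 - t4
  have h1' : ∑ i, K.g (K.d2curv V (K.s i) (K.J V) (K.s i) (K.J V)) V = 0 := by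
    rw [← LinearMap.sum_apply, ← map_sum, h1]; simp
  rw [bochnerCurv, neg_inj, ← sub_zero (∑ i, _), ← h1', ← Finset.sum_sub_distrib]
  refine Finset.sum_congr rfl fun i _ ↦ ?_
  rw [← LinearMap.sub_apply, ← map_sub, d2curv_comm]
  have kc := K.isCurvLike_curv
  set s := K.s i
  set B := K.curv s V V with hB
  -- `e1` with `p1`, and `p2` to `p4`, use the Kähler symmetries to match the four commutator terms
  -- with the four summands of `bochnerCurv`.
  have e1 := kc.skew' s V (K.curv (K.J V) s (K.J V)) V
  have p1 : K.g (K.curv (K.J V) s (K.J V)) B = -K.g (K.curv B (K.J V) (K.J V)) s := by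
    rw [kc.pair, kc.skew]; simp
  have p2 : K.g (K.curv (K.J B) s (K.J V)) V = -K.g (K.curv B (K.J s) (K.J V)) V := by
    rw [kc.J₁]; simp
  have p3 : K.g (K.curv (K.J V) (K.curv s V s) (K.J V)) V =
      -K.g (K.curv (K.curv s V s) (K.J V) (K.J V)) V := by
    rw [kc.skew]; simp
  have p4 : K.g (K.curv (K.J V) s (K.J B)) V = -K.g (K.curv B (K.J V) (K.J s)) V := by
    rw [kc.pair, kc.J₁, kc.skew' B _ (K.J s) V, g_J_right, ← K.curv_J]
    simp
  rw [K.curv_J s V V, ← hB]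
  simp only [map_sub, LinearMap.sub_apply]
  rw [e1, ← hB, K.g_comm B, p1, p2, p3, p4]
  ring

/-- The Bochner formula for the curvature of a Kähler metric with parallel Ricci tensor. -/
theorem laplacian_curv (h : ∀ X Y, K.dRc X Y = 0) (V : 𝔛) :
    ∑ i, K.g (K.d2curv (K.s i) (K.s i) V (K.J V) (K.J V)) V
      = K.bochnerCurv V + K.bochnerCurv (K.J V) := by
  rw [← K.sum_d2curv h, ← K.sum_d2curv h, ← neg_add, ← Finset.sum_add_distrib,
    ← Finset.sum_neg_distrib]
  refine Finset.sum_congr rfl fun i _ ↦ ?_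
  set s := K.s i
  have kc := K.isCurvLike_d2curv s
  -- The second Bianchi identity on (s_i, V, JV) produces two mixed terms; by `h2` the second of
  -- them is the mixed term belonging to JV.
  have h1 := congrArg (fun Z ↦ K.g Z V) (K.d2curv_bianchi s s V (K.J V) (K.J V))
  simp only [map_add, LinearMap.add_apply, map_zero, LinearMap.zero_apply] at h1
  have h2 : K.g (K.d2curv s (K.J V) (K.J (K.J V)) s (K.J (K.J V))) (K.J V) =
      K.g (K.d2curv s (K.J V) s V (K.J V)) V := by
    rw [K.J_sq, (kc (K.J V)).neg, (kc (K.J V)).neg₃, (kc (K.J V)).skew',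
      (kc (K.J V)).skew V]
    simp
  rw [h2]
  linear_combination h1

/-! ### Holomorphic sectional curvature determines a Kähler curvature tensor -/

/-- A Kähler curvature-like tensor with vanishing holomorphic sectional curvature vanishes. -/
theorem IsCurvLike.eq_zero {K : KahlerAlgebra A 𝔛 ι} {T : 𝔛 →ₗ[A] 𝔛 →ₗ[A] 𝔛 →ₗ[A] 𝔛}
    (hT : K.IsCurvLike fun X Y Z ↦ T X Y Z) (φ : A →+* ℝ)
    (h : ∀ V, φ (K.g (T V (K.J V) (K.J V)) V) = 0) (X Y Z W : 𝔛) :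
    φ (K.g (T X Y Z) W) = 0 := by
  set b : 𝔛 → 𝔛 → 𝔛 → 𝔛 → ℝ := fun X Y Z W ↦ φ (K.g (T X Y Z) W) with hb
  have s1 (X Y Z W : 𝔛) : b X Y Z W = -b Y X Z W := by
    simp only [hb]; rw [hT.skew]; simp
  have s2 (X Y Z W : 𝔛) : b X Y Z W = -b X Y W Z := by
    simp only [hb]; rw [hT.skew']; simp
  have s3 (X Y Z W : 𝔛) : b X Y Z W = b Z W X Y := by
    simp only [hb]; rw [hT.pair]
  have s4 (X Y Z W : 𝔛) : b X Y Z W + b Y Z X W + b Z X Y W = 0 := by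
    have := congrArg (fun V ↦ φ (K.g V W)) (hT.bianchi X Y Z)
    simpa [hb] using this
  have s5 (X Y Z W : 𝔛) : b X Y (K.J Z) W = -b X Y Z (K.J W) := by
    simp only [hb]; rw [hT.map_J, g_J_right]; simp
  have s6 (X Y Z W : 𝔛) : b (K.J X) Y Z W = -b X (K.J Y) Z W := by
    simp only [hb]; rw [hT.J₁]; simp
  have n1 (X Y Z W : 𝔛) : b X (-Y) Z W = -b X Y Z W := by simp [hb]
  have n2 (X Y Z W : 𝔛) : b X Y (-Z) W = -b X Y Z W := by simp [hb]
  -- Adding the hypotheses at V + W and V − W isolates the part of degree two in W. Its six terms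
  -- reduce, by the Kähler symmetries, to twice the stated combination.
  have hJ (V W : 𝔛) : b V W W V + 3 * b V (K.J W) (K.J W) V = 0 := by
    have h1 := h (V + W)
    have h2 := h (V - W)
    have h3 := h V
    have h4 := h W
    simp only [map_add, map_sub, LinearMap.add_apply, LinearMap.sub_apply] at h1 h2
    have q : b W (K.J W) (K.J V) V + b W (K.J V) (K.J W) V + b W (K.J V) (K.J V) W
      + b V (K.J W) (K.J W) V + b V (K.J W) (K.J V) W + b V (K.J V) (K.J W) W = 0 := by
      simp only [hb]; linarith
    have e1 : b W (K.J W) (K.J V) V = b V (K.J V) (K.J W) W := by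
      rw [s3, s1, s2]; ring
    have e2 : b W (K.J V) (K.J W) V = b V (K.J W) (K.J W) V := by
      rw [s1, s6]; ring
    have e3 : b V (K.J W) (K.J V) W = b V (K.J W) (K.J W) V := by
      rw [s5, s2]; ring
    have e4 : b W (K.J V) (K.J V) W = b V (K.J W) (K.J W) V := by
      rw [s3, s6, ← s5]
    have e5 : b V (K.J V) (K.J W) W = b V W W V + b V (K.J W) (K.J W) V := by
      have := s4 V (K.J V) (K.J W) W
      have f1 : b (K.J V) (K.J W) V W = - b V W W V := by
        rw [s6, K.J_sq, n1, s2 V W]; ring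
      have f2 : b (K.J W) V (K.J V) W = - b V (K.J W) (K.J W) V := by
        rw [s1, e3]
      linarith
    linarith
  -- Replacing W by JW swaps the two unknowns; the system x + 3y = 0, y + 3x = 0 has only the zero
  -- solution.
  have hsec (V W : 𝔛) : b V W W V = 0 := by
    have h1 := hJ V W
    have h2 := hJ V (K.J W)
    rw [K.J_sq, n1, n2] at h2
    linarith
  have h3 (V W U : 𝔛) : b V W W U = 0 := by
    have h1 := hsec (V + U) W
    have h2 := hsec V W
    have h3 := hsec U W
    have h4 := s3 U W W V
    have h5 := s1 W V U W
    have h6 := s2 V W U W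
    have h7 : b (V + U) W W (V + U) = b V W W V + b V W W U + (b U W W V + b U W W U) := by
      simp [hb]
    linarith
  -- Polarising once more makes b skew in its middle arguments too; with the other skew symmetries
  -- the Bianchi sum becomes 3 b.
  have h4 (V W Z U : 𝔛) : b V W Z U = -b V Z W U := by
    have h1 := h3 V (W + Z) U
    have h7 : b V (W + Z) (W + Z) U = b V W W U + b V Z W U + (b V W Z U + b V Z Z U) := by
      simp [hb]; ring
    linarith [h3 V W U, h3 V Z U]
  have := s4 X Y Z W
  have e1 := h4 Y Z X W
  have e2 := s1 Y X Z W
  have e3 := s1 Z X Y W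
  have e4 := h4 X Z Y W
  change b X Y Z W = 0
  linarith
end KahlerAlgebra

/-! ### Smooth orthonormal frames and global Parseval frames -/

namespace RiemannianGeometry

variable {E : Type*} [NormedAddCommGroup E] [NormedSpace ℝ E]
  {M : Type*} [TopologicalSpace M] [ChartedSpace E M] [IsManifold 𝓘(ℝ, E) ∞ M]
  [RiemannianBundle (fun x : M ↦ TangentSpace 𝓘(ℝ, E) x)]
  [IsContMDiffRiemannianBundle 𝓘(ℝ, E) ∞ E (fun x : M ↦ TangentSpace 𝓘(ℝ, E) x)]

theorem contMDiffOn_inner {X Y : Π x : M, TangentSpace 𝓘(ℝ, E) x} {u : Set M}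
    (hX : CMDiff[u] ∞ (T% X)) (hY : CMDiff[u] ∞ (T% Y)) :
    CMDiff[u] ∞ (fun y ↦ inner ℝ (X y) (Y y)) :=
  ContMDiffOn.inner_bundle (IB := 𝓘(ℝ, E)) (F := E)
    (E := fun x : M ↦ TangentSpace 𝓘(ℝ, E) x) (b := fun y ↦ y) hX hY

theorem contMDiffOn_comp_of_pos {f : M → ℝ} {g : ℝ → ℝ} {u : Set M} (hf : CMDiff[u] ∞ f)
    (hg : ContDiffOn ℝ ∞ g (Set.Ioi 0)) (hpos : ∀ x ∈ u, 0 < f x) :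
    CMDiff[u] ∞ (fun x ↦ g (f x)) :=
  hg.contMDiffOn.comp hf hpos

theorem contDiffOn_inv_sqrt : ContDiffOn ℝ ∞ (fun t : ℝ ↦ (√t)⁻¹) (Set.Ioi 0) := fun _ ht ↦
  ((Real.contDiffAt_sqrt (ne_of_gt ht)).inv (Real.sqrt_ne_zero'.mpr ht)).contDiffWithinAt

open InnerProductSpace in
/-- The Gram–Schmidt process preserves smoothness of local frames. -/
theorem contMDiffOn_gramSchmidtNormed {d : ℕ} {u : Set M}
    {b : Fin d → Π x : M, TangentSpace 𝓘(ℝ, E) x} (hb : ∀ i, CMDiff[u] ∞ (T% (b i)))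
    (hli : ∀ x ∈ u, LinearIndependent ℝ fun i ↦ b i x) (i : Fin d) :
    CMDiff[u] ∞ (T% (fun x ↦ gramSchmidtNormed ℝ (fun i ↦ b i x) i)) := by
  have hsq (i : Fin d)
      (h : CMDiff[u] ∞ (T% (fun x ↦ gramSchmidt ℝ (fun i ↦ b i x) i))) :
      CMDiff[u] ∞ (fun x ↦ ‖gramSchmidt ℝ (fun i ↦ b i x) i‖ ^ 2) := by
    refine (contMDiffOn_inner h h).congr fun x _ ↦ ?_
    rw [real_inner_self_eq_norm_sq]
  have hpos (i : Fin d) (x : M) (hx : x ∈ u) : 0 < ‖gramSchmidt ℝ (fun i ↦ b i x) i‖ := by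
    rw [norm_pos_iff]
    exact gramSchmidt_ne_zero i (hli x hx)
  have h (i : Fin d) : CMDiff[u] ∞ (T% (fun x ↦ gramSchmidt ℝ (fun i ↦ b i x) i)) := by
    induction i using WellFoundedLT.induction with
    | ind i ih =>
      have hsum : CMDiff[u] ∞ (T% (fun x ↦ ∑ j ∈ Finset.Iio i,
          (inner ℝ (gramSchmidt ℝ (fun i ↦ b i x) j) (b i x) *
            (‖gramSchmidt ℝ (fun i ↦ b i x) j‖ ^ 2)⁻¹) • gramSchmidt ℝ (fun i ↦ b i x) j)) := by
        refine ContMDiffOn.sum_section fun j hj ↦ ?_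
        have hj' := ih j (Finset.mem_Iio.1 hj)
        refine ContMDiffOn.smul_section (ContMDiffOn.mul (contMDiffOn_inner hj' (hb i)) ?_) hj'
        exact (hsq j hj').inv₀ fun x hx ↦ (pow_pos (hpos j x hx) 2).ne'
      refine ((hb i).sub_section hsum).congr fun x _ ↦ ?_
      simp only [Pi.sub_apply]
      rw [gramSchmidt_def]
      simp only [Submodule.starProjection_singleton, div_eq_mul_inv]
      rfl
  -- The normalising factor is t ↦ 1/√t applied to the squared norm, which is smooth and positive.
  refine (ContMDiffOn.smul_section (contMDiffOn_comp_of_pos (hsq i (h i)) contDiffOn_inv_sqrt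
    fun x hx ↦ pow_pos (hpos i x hx) 2) (h i)).congr fun x hx ↦ ?_
  simp only [Pi.smul_apply', gramSchmidtNormed, Real.sqrt_sq (norm_nonneg _)]
  rfl

variable [FiniteDimensional ℝ E]

/-- Smooth local orthonormal frames. -/
theorem exists_local_orthonormal_frame (p : M) : ∃ u : Set M, IsOpen u ∧ p ∈ u ∧
    ∃ e : Fin (Module.finrank ℝ E) → Π x : M, TangentSpace 𝓘(ℝ, E) x,
      (∀ i, CMDiff[u] ∞ (T% (e i))) ∧ ∀ x ∈ u, Orthonormal ℝ fun i ↦ e i x := by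
  let t := trivializationAt E (fun x : M ↦ TangentSpace 𝓘(ℝ, E) x) p
  let b := t.localFrame (Module.finBasis ℝ E)
  have hb := t.isLocalFrameOn_localFrame_baseSet 𝓘(ℝ, E) ∞ (Module.finBasis ℝ E)
  refine ⟨t.baseSet, t.open_baseSet, FiberBundle.mem_baseSet_trivializationAt' p,
    fun i x ↦ InnerProductSpace.gramSchmidtNormed ℝ (fun i ↦ b i x) i,
    contMDiffOn_gramSchmidtNormed (fun i ↦ hb.contMDiffOn i) (fun x hx ↦ hb.linearIndependent hx),
    fun x hx ↦ InnerProductSpace.gramSchmidtNormed_orthonormal (hb.linearIndependent hx)⟩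

theorem sum_inner_smul_of_orthonormal {x : M}
    {e : Fin (Module.finrank ℝ E) → TangentSpace 𝓘(ℝ, E) x} (he : Orthonormal ℝ e)
    (v : TangentSpace 𝓘(ℝ, E) x) : ∑ i, inner ℝ v (e i) • e i = v := by
  let o := OrthonormalBasis.mk he
    (he.linearIndependent.span_eq_top_of_card_eq_finrank' (by simp; rfl)).ge
  have ho : ⇑o = e := OrthonormalBasis.coe_mk _ _
  conv_rhs => rw [← o.sum_repr v]
  refine Finset.sum_congr rfl fun i _ ↦ ?_
  rw [o.repr_apply_apply, ho, real_inner_comm]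

/-- The smooth vector fields on `M`. -/
abbrev VF (E M : Type*) [NormedAddCommGroup E] [NormedSpace ℝ E] [TopologicalSpace M]
    [ChartedSpace E M] [IsManifold 𝓘(ℝ, E) ∞ M] : Type _ :=
  Cₛ^∞⟮𝓘(ℝ, E); E, fun x : M ↦ TangentSpace 𝓘(ℝ, E) x⟯

variable (E M) in
/-- Compact Riemannian manifolds carry finite Parseval frames. -/
theorem exists_parseval_frame [T2Space M] [CompactSpace M] : ∃ (n : ℕ) (s : Fin n → VF E M),
    ∀ (x : M) (v : TangentSpace 𝓘(ℝ, E) x), ∑ i, inner ℝ v (s i x) • s i x = v := by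
  choose u hu hpu e he heo using fun p : M ↦ exists_local_orthonormal_frame (E := E) p
  choose χ hχ using fun p : M ↦ ((SmoothBumpFunction.nhds_basis_tsupport (I := 𝓘(ℝ, E)) p).mem_iff).1
    ((hu p).mem_nhds (hpu p))
  obtain ⟨t, ht⟩ := CompactSpace.elim_nhds_subcover (fun p : M ↦ Function.support (χ p))
    (fun p ↦ (χ p).support_mem_nhds)
  have hpos (x : M) : 0 < ∑ p ∈ t, (χ p x) ^ 2 := by
    have hx : x ∈ (⊤ : Set M) := trivial
    rw [← ht] at hx
    simp only [Set.mem_iUnion, Function.mem_support] at hx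
    obtain ⟨p, hp, hx⟩ := hx
    exact Finset.sum_pos' (fun _ _ ↦ sq_nonneg _) ⟨p, hp, by positivity⟩
  have hS : CMDiff[Set.univ] ∞ (fun x : M ↦ ∑ p ∈ t, (χ p x) ^ 2) :=
    contMDiffOn_finsetSum fun p _ ↦ ((χ p).contMDiff.pow 2).contMDiffOn
  have hr := contMDiffOn_univ.1 (contMDiffOn_comp_of_pos hS contDiffOn_inv_sqrt fun x _ ↦ hpos x)
  -- The local frames are weighted by χ_p / √(∑ χ²). The squares of these weights sum to 1, and it
  -- is the squares that enter the Parseval identity.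
  let s (k : t × Fin (Module.finrank ℝ E)) : VF E M :=
    ⟨(fun x ↦ (√(∑ p ∈ t, (χ p x) ^ 2))⁻¹) • (⇑(χ k.1) • e k.1 k.2), hr.smul_section
      (ContMDiffOn.smul_section_of_tsupport (χ k.1).contMDiff.contMDiffOn (hu k.1) (hχ k.1).2
        (he k.1 k.2))⟩
  refine ⟨_, s ∘ (Fintype.equivFin _).symm, fun x v ↦ ?_⟩
  simp only [Function.comp_apply]
  rw [(Fintype.equivFin _).symm.sum_comp (fun k ↦ inner ℝ v (s k x) • s k x), Fintype.sum_prod_type]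
  have hk (p : t) : ∑ i, inner ℝ v (s (p, i) x) • s (p, i) x =
      ((∑ p ∈ t, (χ p x) ^ 2)⁻¹ * (χ p x) ^ 2) • v := by
    have hs (i) : s (p, i) x = ((√(∑ p ∈ t, (χ p x) ^ 2))⁻¹ * χ p x) • e p i x := by
      rw [mul_smul]; rfl
    by_cases hx : χ p x = 0
    · simp [hs, hx]
    have hxu : x ∈ u p := (hχ p).2 (subset_tsupport _ hx)
    conv_rhs => rw [← sum_inner_smul_of_orthonormal (heo p x hxu) v]
    rw [Finset.smul_sum]
    refine Finset.sum_congr rfl fun i _ ↦ ?_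
    rw [hs, inner_smul_right, smul_smul, smul_smul]
    congr 1
    have hr : (∑ p ∈ t, (χ p x) ^ 2)⁻¹ =
        (√(∑ p ∈ t, (χ p x) ^ 2))⁻¹ * (√(∑ p ∈ t, (χ p x) ^ 2))⁻¹ := by
      rw [← mul_inv, Real.mul_self_sqrt (hpos x).le]
    rw [hr]
    ring
  simp only [hk]
  rw [← Finset.sum_smul, ← Finset.mul_sum, Finset.sum_coe_sort t (fun p ↦ (χ p x) ^ 2),
    inv_mul_cancel₀ (hpos x).ne', one_smul]

end RiemannianGeometry

/-! ### The module of smooth vector fields -/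

namespace RiemannianGeometry

section fields

variable {E : Type*} [NormedAddCommGroup E] [NormedSpace ℝ E]
  {M : Type*} [TopologicalSpace M] [ChartedSpace E M] [IsManifold 𝓘(ℝ, E) ∞ M]

/-- The smooth functions on `M`. -/
abbrev SF (E M : Type*) [NormedAddCommGroup E] [NormedSpace ℝ E] [TopologicalSpace M]
    [ChartedSpace E M] : Type _ :=
  C^∞⟮𝓘(ℝ, E), M; 𝓘(ℝ), ℝ⟯

instance smulVF : SMul (SF E M) (VF E M) :=
  ⟨fun f X ↦ ⟨(⇑f) • (⇑X), f.contMDiff.smul_section X.contMDiff⟩⟩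

@[simp] theorem smul_VF_apply (f : SF E M) (X : VF E M) (x : M) : (f • X) x = f x • X x := rfl

instance moduleVF : Module (SF E M) (VF E M) where
  one_smul X := by ext x; simp
  mul_smul f h X := by ext x; simp [mul_smul]
  smul_zero f := by ext x; simp
  smul_add f X Y := by ext x; simp
  add_smul f h X := by ext x; simp [add_smul]
  zero_smul X := by ext x; simp

/-- Evaluation of vector fields at a point. -/
def evalVF (x : M) : VF E M →+ TangentSpace 𝓘(ℝ, E) x where
  toFun X := X x
  map_zero' := rfl
  map_add' _ _ := rfl

@[simp] theorem sum_VF_apply {ι : Type*} (t : Finset ι) (X : ι → VF E M) (x : M) :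
    (∑ i ∈ t, X i) x = ∑ i ∈ t, X i x :=
  map_sum (evalVF x) X t

/-- Evaluation of smooth functions at a point. -/
def evalSF (x : M) : SF E M →+* ℝ where
  toFun f := f x
  map_one' := rfl
  map_zero' := rfl
  map_add' _ _ := rfl
  map_mul' _ _ := rfl

@[simp] theorem sum_SF_apply {ι : Type*} (t : Finset ι) (f : ι → SF E M) (x : M) :
    (∑ i ∈ t, f i) x = ∑ i ∈ t, f i x :=
  map_sum (evalSF x) f t

theorem contMDiff_mvfderiv {f : M → ℝ} {X : Π x : M, TangentSpace 𝓘(ℝ, E) x}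
    (hf : CMDiff ∞ f) (hX : CMDiff ∞ (T% X)) : CMDiff ∞ (fun x ↦ d% f x (X x)) := by
  have h := (hf.contMDiff_tangentMap (m := ∞) (by simp)).comp hX
  exact (contMDiff_snd_tangentBundle_modelSpace ℝ 𝓘(ℝ)).comp h

/-- The derivative of a smooth function along a smooth vector field. -/
def derivVF : VF E M →+ SF E M →+ SF E M where
  toFun X :=
    { toFun := fun f ↦ ⟨fun x ↦ d% (⇑f) x (X x), contMDiff_mvfderiv f.contMDiff X.contMDiff⟩
      map_zero' := by
        ext x
        change d% (0 : M → ℝ) x (X x) = 0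
        rw [mvfderiv_zero]; rfl
      map_add' := fun f h ↦ by
        ext x
        have := mvfderiv_add (f.mdifferentiableAt (x := x)) h.mdifferentiableAt
        change d% (⇑f + ⇑h) x (X x) = d% (⇑f) x (X x) + d% (⇑h) x (X x)
        rw [this]; rfl }
  map_zero' := by ext f x; exact map_zero (d% (⇑f) x)
  map_add' X Y := by ext f x; exact map_add (d% (⇑f) x) _ _

theorem derivVF_apply (X : VF E M) (f : SF E M) (x : M) :
    derivVF X f x = d% (⇑f) x (X x) := rfl

theorem derivVF_mul (X : VF E M) (f h : SF E M) :
    derivVF X (f * h) = derivVF X f * h + f * derivVF X h := by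
  ext x
  have := mvfderiv_mul (f.mdifferentiableAt (x := x)) h.mdifferentiableAt
  change d% (⇑f * ⇑h) x (X x) = d% (⇑f) x (X x) * h x + f x * d% (⇑h) x (X x)
  rw [this]
  simp; ring

variable [CompleteSpace E]

theorem isManifold_minSmoothness_two (E M : Type*) [NormedAddCommGroup E] [NormedSpace ℝ E]
    [TopologicalSpace M] [ChartedSpace E M] [IsManifold 𝓘(ℝ, E) ∞ M] :
    IsManifold 𝓘(ℝ, E) (minSmoothness ℝ 2) M :=
  IsManifold.of_le (n := ∞) (by simpa using ENat.LEInfty.out)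

/-- The Lie bracket of smooth vector fields. -/
def bracketVF (X Y : VF E M) : VF E M :=
  ⟨VectorField.mlieBracket 𝓘(ℝ, E) X Y, by
    have := IsManifold.of_le (I := 𝓘(ℝ, E)) (M := M) (m := ∞ + 1) (n := ∞) (by simp)
    have := isManifold_minSmoothness_two E M
    exact ContDiff.mlieBracket_vectorField (m := ⊤) (n := ⊤) X.contMDiff Y.contMDiff (by simp)⟩

theorem bracketVF_add_right (X Y Z : VF E M) :
    bracketVF X (Y + Z) = bracketVF X Y + bracketVF X Z := by
  ext x; exact VectorField.mlieBracket_add_right Y.mdifferentiableAt Z.mdifferentiableAt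

theorem bracketVF_smul_right (X Y : VF E M) (f : SF E M) :
    bracketVF X (f • Y) = derivVF X f • Y + f • bracketVF X Y := by
  ext x; exact VectorField.mlieBracket_smul_right f.mdifferentiableAt Y.mdifferentiableAt

theorem bracketVF_jacobi (X Y Z : VF E M) :
    bracketVF X (bracketVF Y Z) = bracketVF (bracketVF X Y) Z + bracketVF Y (bracketVF X Z) := by
  ext x
  have h (X : VF E M) : CMDiffAt (minSmoothness ℝ 2) (T% (⇑X)) x := by
    simpa using X.contMDiff.contMDiffAt.of_le (m := 2) ENat.LEInfty.out
  have := IsManifold.of_le (I := 𝓘(ℝ, E)) (M := M) (m := minSmoothness ℝ 3) (n := ∞)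
    (by simpa using ENat.LEInfty.out)
  exact VectorField.leibniz_identity_mlieBracket_apply (h X) (h Y) (h Z)

/-- Write the Jacobi identity for X, Y and fZ and compare the coefficients of Z. This gives the
commutator formula for derivations, multiplied by an auxiliary field Z. -/
theorem derivVF_bracketVF_smul (X Y Z : VF E M) (f : SF E M) :
    derivVF (bracketVF X Y) f • Z =
      (derivVF X (derivVF Y f) - derivVF Y (derivVF X f)) • Z := by
  have h := bracketVF_jacobi X Y (f • Z)
  simp only [bracketVF_smul_right, bracketVF_add_right] at h
  rw [bracketVF_jacobi X Y Z] at h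
  linear_combination (norm := module) -h

end fields

end RiemannianGeometry

/-! ### The Kähler algebra of a Kähler manifold -/

namespace RiemannianGeometry

variable {E : Type*} [NormedAddCommGroup E] [NormedSpace ℝ E]
  {M : Type*} [TopologicalSpace M] [ChartedSpace E M] [IsManifold 𝓘(ℝ, E) ∞ M]
  [RiemannianBundle (fun x : M ↦ TangentSpace 𝓘(ℝ, E) x)]
  [IsContMDiffRiemannianBundle 𝓘(ℝ, E) ∞ E (fun x : M ↦ TangentSpace 𝓘(ℝ, E) x)]

/-- The inner product of smooth vector fields. -/
def innerVF : VF E M →ₗ[SF E M] VF E M →ₗ[SF E M] SF E M :=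
  LinearMap.mk₂ _ (fun X Y ↦ ⟨fun x ↦ inner ℝ (X x) (Y x), contMDiffOn_univ.1
      (contMDiffOn_inner X.contMDiff.contMDiffOn Y.contMDiff.contMDiffOn)⟩)
    (fun X X' Y ↦ by ext x; exact inner_add_left (𝕜 := ℝ) (X x) (X' x) (Y x))
    (fun f X Y ↦ by ext x; exact real_inner_smul_left (X x) (Y x) (f x))
    (fun X Y Y' ↦ by ext x; exact inner_add_right (𝕜 := ℝ) (X x) (Y x) (Y' x))
    (fun f X Y ↦ by ext x; exact real_inner_smul_right (X x) (Y x) (f x))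

@[simp] theorem innerVF_apply (X Y : VF E M) (x : M) : innerVF X Y x = inner ℝ (X x) (Y x) := rfl

/-- A finite family of smooth vector fields is a Parseval frame. -/
def IsParsevalFrame {n : ℕ} (s : Fin n → VF E M) : Prop :=
  ∀ (x : M) (v : TangentSpace 𝓘(ℝ, E) x), ∑ i, inner ℝ v (s i x) • s i x = v

variable [FiniteDimensional ℝ E] {n : ℕ} {s : Fin n → VF E M}

theorem leviCivita_add_right (X Y : VF E M) (x : M) :
    leviCivita E M (⇑(X + Y)) x = leviCivita E M (⇑X) x + leviCivita E M (⇑Y) x :=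
  (leviCivita E M).isCovariantDerivativeOnUniv.add X.mdifferentiableAt Y.mdifferentiableAt trivial

theorem leviCivita_smul_right (f : SF E M) (X : VF E M) (x v) :
    leviCivita E M (⇑(f • X)) x v = d% (⇑f) x v • X x + f x • leviCivita E M (⇑X) x v := by
  have := (leviCivita E M).isCovariantDerivativeOnUniv.leibniz X.mdifferentiableAt
    (f.mdifferentiableAt (x := x)) trivial
  change leviCivita E M (⇑f • ⇑X) x v = _
  rw [show leviCivita E M (⇑f • ⇑X) x = _ from this]
  simp [add_comm]

/-- The Koszul expression of smooth vector fields is smooth. -/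
def koszulVF (X Y Z : VF E M) : SF E M :=
  derivVF X (innerVF Y Z) + derivVF Y (innerVF X Z) - derivVF Z (innerVF X Y)
    + innerVF (bracketVF X Y) Z - innerVF (bracketVF X Z) Y - innerVF (bracketVF Y Z) X

/-- The frame coefficients of ∇_X Y are half the Koszul expressions, which are smooth. This yields
the smoothness of ∇_X Y, since the connection itself is defined pointwise by duality. -/
theorem leviCivita_eq_sum (hs : IsParsevalFrame s) (X Y : VF E M) (x : M) :
    leviCivita E M (⇑Y) x (X x) =
      (∑ i, ((algebraMap ℝ (SF E M) (1 / 2)) * koszulVF X Y (s i)) • s i) x := by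
  rw [← hs x (leviCivita E M (⇑Y) x (X x)), sum_VF_apply]
  refine Finset.sum_congr rfl fun i _ ↦ ?_
  have := inner_leviCivitaAux X.mdifferentiableAt (Y.mdifferentiableAt (x := x))
    (s i).mdifferentiableAt
  rw [smul_VF_apply]
  congr 1
  change inner ℝ (leviCivitaAux (⇑Y) x (X x)) (s i x) = 1 / 2 * koszul X Y (s i) x
  rw [← this]; ring

/-- The covariant derivative of smooth vector fields. -/
def nabVF (hs : IsParsevalFrame s) : VF E M →+ VF E M →+ VF E M where
  toFun X :=
    { toFun := fun Y ↦ ⟨fun x ↦ leviCivita E M (⇑Y) x (X x), by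
        simp_rw [leviCivita_eq_sum hs X Y]
        exact ContMDiffSection.contMDiff _⟩
      map_zero' := by
        ext x
        change leviCivita E M (⇑(0 : VF E M)) x (X x) = 0
        rw [ContMDiffSection.coe_zero, CovariantDerivative.zero]; rfl
      map_add' := fun Y Y' ↦ by
        ext x
        exact congrArg (fun A ↦ A (X x)) (leviCivita_add_right Y Y' x) }
  map_zero' := by ext Y x; exact map_zero (leviCivita E M (⇑Y) x)
  map_add' X X' := by ext Y x; exact map_add (leviCivita E M (⇑Y) x) _ _

theorem nabVF_apply (hs : IsParsevalFrame s) (X Y : VF E M) (x : M) :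
    nabVF hs X Y x = leviCivita E M (⇑Y) x (X x) := rfl

theorem nabVF_sub_nabVF (hs : IsParsevalFrame s) (X Y : VF E M) :
    nabVF hs X Y - nabVF hs Y X = bracketVF X Y := by
  ext x
  exact ((CovariantDerivative.torsion_eq_zero_iff _).1 (leviCivita_torsion (E := E) (M := M)))
    X.mdifferentiableAt Y.mdifferentiableAt

theorem sum_innerVF_smul (hs : IsParsevalFrame s) (X : VF E M) :
    ∑ i, innerVF X (s i) • s i = X := by
  ext x; rw [sum_VF_apply]; exact hs x (X x)

theorem derivVF_bracketVF (hs : IsParsevalFrame s) (X Y : VF E M) (f : SF E M) :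
    derivVF (bracketVF X Y) f = derivVF X (derivVF Y f) - derivVF Y (derivVF X f) := by
  ext x
  -- The auxiliary field is a frame field that does not vanish at x. If all of them vanish, the
  -- tangent space at x is zero.
  by_cases h : ∃ i, s i x ≠ 0
  · obtain ⟨i, hi⟩ := h
    have := congrArg (fun Z : VF E M ↦ Z x) (derivVF_bracketVF_smul X Y (s i) f)
    exact smul_left_injective ℝ hi this
  · push Not at h
    have hz (v : TangentSpace 𝓘(ℝ, E) x) : v = 0 := by
      rw [← hs x v]; simp [h]
    change d% (⇑f) x (bracketVF X Y x) =
      d% (⇑(derivVF Y f)) x (X x) - d% (⇑(derivVF X f)) x (Y x)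
    rw [hz (bracketVF X Y x), hz (X x), hz (Y x)]
    simp

variable {J : Π x : M, TangentSpace 𝓘(ℝ, E) x →L[ℝ] TangentSpace 𝓘(ℝ, E) x}

/-- The complex structure acting on smooth vector fields. -/
def complexVF (hJ : IsKahler J) : VF E M →ₗ[SF E M] VF E M where
  toFun X := ⟨fun x ↦ J x (X x), fun x ↦
    ContMDiffAt.clm_bundle_apply (hJ.smooth x) (X.contMDiff x)⟩
  map_add' X Y := by ext x; exact map_add (J x) _ _
  map_smul' f X := by ext x; exact map_smul (J x) _ _

theorem complexVF_apply (hJ : IsKahler J) (X : VF E M) (x : M) :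
    complexVF hJ X x = J x (X x) := rfl

/-- The Kähler algebra of a Kähler manifold with a Parseval frame. -/
def kahlerAlgebra (hJ : IsKahler J) (hs : IsParsevalFrame s) :
    KahlerAlgebra (SF E M) (VF E M) (Fin n) where
  D := derivVF
  nab := nabVF hs
  g := innerVF
  J := complexVF hJ
  s := s
  D_mul := derivVF_mul
  nab_smul_left f X Y := by ext x; exact map_smul (leviCivita E M (⇑Y) x) _ _
  nab_smul X f Y := by ext x; exact leviCivita_smul_right f Y x (X x)
  g_comm X Y := by ext x; exact real_inner_comm (Y x) (X x)
  metric X Y Z := by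
    ext x
    exact leviCivita_metric X.mdifferentiableAt Y.mdifferentiableAt Z.mdifferentiableAt
  D_bracket X Y f := by rw [nabVF_sub_nabVF, derivVF_bracketVF hs]
  jacobi X Y Z := by
    simp only [nabVF_sub_nabVF]
    exact bracketVF_jacobi X Y Z
  J_sq X := by ext x; exact hJ.sq_eq_neg x (X x)
  J_iso X Y := by ext x; exact hJ.inner_map x _ _
  nab_J X Y := by ext x; exact hJ.parallel x Y (Y.contMDiff x) (X x)
  parseval X := sum_innerVF_smul hs X

end RiemannianGeometry

/-! ### Hopf's strong maximum principle -/

open Filter Topology Metric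

/-- If c > 0, the point is also a local minimum, so h is locally constant and its second derivative
is 0. -/
theorem second_deriv_nonpos_of_isLocalMax {h h₁ : ℝ → ℝ} {c t₀ : ℝ} (hmax : IsLocalMax h t₀)
    (hd : ∀ᶠ t in 𝓝 t₀, HasDerivAt h (h₁ t) t) (hd₁ : HasDerivAt h₁ c t₀) : c ≤ 0 := by
  by_contra! hc
  have hder : deriv h =ᶠ[𝓝 t₀] h₁ := hd.mono fun t ht ↦ ht.deriv
  have hdd : deriv (deriv h) t₀ = c := by rw [hder.deriv_eq, hd₁.deriv]
  have hmin : IsLocalMin h t₀ := isLocalMin_of_deriv_deriv_pos (by rwa [hdd]) hmax.deriv_eq_zero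
    hd.self_of_nhds.continuousAt
  have hconst : h =ᶠ[𝓝 t₀] fun _ ↦ h t₀ := by
    filter_upwards [hmax, hmin] with t h1 h2 using le_antisymm h1 h2
  have : deriv (deriv h) t₀ = 0 := by
    rw [hconst.deriv.deriv_eq]; simp
  linarith

/-- If a function attains a local maximum at `a` without being locally constant there, then there
is a ball touching the set of maximum points at exactly one point. -/
theorem exists_touching_ball {F : Type*} [NormedAddCommGroup F] [InnerProductSpace ℝ F]
    [FiniteDimensional ℝ F] {g : F → ℝ} {a : F} {R : ℝ} (hR : 0 < R)
    (hg : ContinuousOn g (ball a R)) (hmax : ∀ z ∈ ball a R, g z ≤ g a)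
    (hne : ¬ ∀ᶠ z in 𝓝 a, g z = g a) :
    ∃ (q c : F) (r : ℝ), 0 < r ∧ dist q c = r ∧ closedBall c r ⊆ ball a R ∧ g q = g a ∧
      ∀ z ∈ closedBall c r, z ≠ q → g z < g a := by
  have hsub : closedBall a (R / 2) ⊆ ball a R := closedBall_subset_ball (by linarith)
  set K := closedBall a (R / 2) ∩ g ⁻¹' {g a} with hK
  have hKc : IsCompact K :=
    (isCompact_closedBall a (R / 2)).of_isClosed_subset
      ((hg.mono hsub).preimage_isClosed_of_isClosed isClosed_closedBall isClosed_singleton)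
      Set.inter_subset_left
  have haK : a ∈ K := ⟨mem_closedBall_self (by linarith), rfl⟩
  -- The radius R/4 keeps the nearest maximum point and the ball built from it within R/2 of a,
  -- inside the compact set on which q is nearest.
  obtain ⟨z₀, hz₀, hgz₀⟩ : ∃ z ∈ ball a (R / 4), g z ≠ g a := by
    by_contra! h
    exact hne (eventually_of_mem (ball_mem_nhds a (by linarith)) h)
  obtain ⟨q, hqK, hq⟩ := hKc.exists_infDist_eq_dist ⟨a, haK⟩ z₀
  have hz₀q : dist z₀ q ≤ dist z₀ a := by rw [← hq]; exact infDist_le_dist_of_mem haK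
  rw [mem_ball] at hz₀
  have hpos : 0 < dist z₀ q := by
    rw [dist_pos]; rintro rfl; exact hgz₀ hqK.2
  -- The open ball about z₀ through q contains no maximum point of K. The ball with diameter z₀q
  -- lies inside its closure and meets its boundary only at q.
  set c := midpoint ℝ z₀ q with hc
  have hcz : dist c z₀ = dist z₀ q / 2 := by rw [hc, dist_midpoint_left]; norm_num; ring
  have hcq : dist q c = dist z₀ q / 2 := by rw [hc, dist_right_midpoint]; norm_num; ring
  have hin (z : F) (hz : z ∈ closedBall c (dist z₀ q / 2)) : dist z a < R / 2 := by
    rw [mem_closedBall] at hz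
    have h1 := dist_triangle z c z₀
    have h2 := dist_triangle z z₀ a
    linarith
  refine ⟨q, c, dist z₀ q / 2, by positivity, hcq, fun z hz ↦ ?_, hqK.2, fun z hz hzq ↦ ?_⟩
  · rw [mem_ball]; linarith [hin z hz]
  · have hzR := hin z hz
    refine lt_of_le_of_ne (hmax z (by rw [mem_ball]; linarith)) fun hgz ↦ hzq ?_
    have h1 : dist z₀ q ≤ dist z₀ z := by
      rw [← hq]; exact infDist_le_dist_of_mem ⟨mem_closedBall.2 hzR.le, hgz⟩
    rw [mem_closedBall] at hz
    -- Equality case of the triangle inequality: the distances force z − c = c − z₀, that is, z = q.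
    have h2 := parallelogram_law_with_norm ℝ (z - c) (c - z₀)
    rw [sub_add_sub_cancel, ← dist_eq_norm, ← dist_eq_norm z c, ← dist_eq_norm c z₀,
      dist_comm z z₀, hcz] at h2
    have h3 : ‖z - c - (c - z₀)‖ = 0 := by
      have : 0 ≤ ‖z - c - (c - z₀)‖ := norm_nonneg _
      have := dist_nonneg (x := z) (y := c)
      nlinarith
    rw [norm_eq_zero, sub_eq_zero] at h3
    have h4 : c + c = z₀ + q := by rw [hc, midpoint_add_self]
    have : z = c + c - z₀ := by rw [← sub_eq_zero] at h3 ⊢; rw [← h3]; abel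
    rw [this, h4]; abel

namespace RiemannianGeometry

variable {E : Type*} [NormedAddCommGroup E] [NormedSpace ℝ E]
  {M : Type*} [TopologicalSpace M] [ChartedSpace E M] [IsManifold 𝓘(ℝ, E) ∞ M]

theorem hasDerivAt_comp_integralCurve {γ : ℝ → M} {t : ℝ} (f : SF E M) (X : VF E M)
    (h : HasMFDerivAt 𝓘(ℝ, ℝ) 𝓘(ℝ, E) γ t ((1 : ℝ →L[ℝ] ℝ).smulRight (X (γ t)))) :
    HasDerivAt (fun t ↦ f (γ t)) (derivVF X f (γ t)) t := by
  have := (f.mdifferentiableAt (x := γ t)).hasMFDerivAt.comp t h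
  have h2 : HasFDerivAt (fun t ↦ f (γ t)) ((d% (⇑f) (γ t)).comp
      ((1 : ℝ →L[ℝ] ℝ).smulRight (X (γ t)))) t := this.hasFDerivAt
  refine h2.hasDerivAt.congr_deriv ?_
  change d% (⇑f) (γ t) ((1 : ℝ) • X (γ t)) = _
  rw [one_smul]; rfl

variable [FiniteDimensional ℝ E] [T2Space M]

/-- Restrict f to an integral curve of X through x: its first and second derivatives there are Xf
and X(Xf), so the one-variable tests apply. -/
theorem derivVF_of_isLocalMax {f : SF E M} {x : M} (hf : IsLocalMax f x) (X : VF E M) :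
    derivVF X f x = 0 ∧ derivVF X (derivVF X f) x ≤ 0 := by
  have := FiniteDimensional.complete ℝ E
  have : IsManifold 𝓘(ℝ, E) 1 M := IsManifold.of_le (n := ∞) ENat.LEInfty.out
  obtain ⟨γ, h0, hγ⟩ := exists_isMIntegralCurveAt_of_contMDiffAt_boundaryless (I := 𝓘(ℝ, E)) 0
    ((X.contMDiff x).of_le ENat.LEInfty.out)
  have hd : ∀ᶠ t in 𝓝 0, HasDerivAt (fun t ↦ f (γ t)) (derivVF X f (γ t)) t :=
    hγ.mono fun t ht ↦ hasDerivAt_comp_integralCurve f X ht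
  have hd₁ := hasDerivAt_comp_integralCurve (derivVF X f) X hγ.self_of_nhds
  have hcont : ContinuousAt γ 0 := hγ.self_of_nhds.continuousAt
  have hmax : IsLocalMax (fun t ↦ f (γ t)) 0 := by
    have : ∀ᶠ y in 𝓝 (γ 0), f y ≤ f (γ 0) := by rw [h0]; exact hf
    exact hcont.eventually this
  refine ⟨?_, ?_⟩
  · rw [← h0, ← hd.self_of_nhds.deriv]; exact hmax.deriv_eq_zero
  · have := second_deriv_nonpos_of_isLocalMax hmax hd hd₁
    rwa [h0] at this

end RiemannianGeometry

namespace RiemannianGeometry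

variable {E : Type*} [NormedAddCommGroup E] [NormedSpace ℝ E]
  {M : Type*} [TopologicalSpace M] [ChartedSpace E M] [IsManifold 𝓘(ℝ, E) ∞ M]

/-- The exponential of a smooth function. -/
def expSF (f : SF E M) : SF E M :=
  ⟨fun x ↦ Real.exp (f x), Real.contDiff_exp.contMDiff.comp f.contMDiff⟩

theorem derivVF_expSF (X : VF E M) (f : SF E M) : derivVF X (expSF f) = expSF f * derivVF X f := by
  ext x
  have h1 := (f.mdifferentiableAt (x := x)).hasMFDerivAt
  have h2 := (Real.hasDerivAt_exp (f x)).hasFDerivAt.hasMFDerivAt.comp x h1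
  have h3 : d% (⇑(expSF f)) x (X x) = d% (⇑f) x (X x) * Real.exp (f x) :=
    congrArg (fun A ↦ A (X x)) h2.mfderiv
  rw [derivVF_apply, h3, mul_comm]; rfl

theorem derivVF_algebraMap (X : VF E M) (c : ℝ) : derivVF X (algebraMap ℝ (SF E M) c) = 0 := by
  ext x
  change d% (fun _ ↦ c : M → ℝ) x (X x) = 0
  rw [mvfderiv_const]; rfl

variable {n : ℕ} (s : Fin n → VF E M) (Z : VF E M)

/-- The second-order operator `∑ sᵢ sᵢ - Z`. -/
def lapVF : SF E M →+ SF E M :=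
  ∑ i, (derivVF (s i)).comp (derivVF (s i)) - derivVF Z

theorem lapVF_apply (f : SF E M) :
    lapVF s Z f = ∑ i, derivVF (s i) (derivVF (s i) f) - derivVF Z f := by
  simp [lapVF]

theorem lapVF_algebraMap_mul (c : ℝ) (f : SF E M) :
    lapVF s Z (algebraMap ℝ (SF E M) c * f) = algebraMap ℝ (SF E M) c * lapVF s Z f := by
  simp only [lapVF_apply, derivVF_mul, derivVF_algebraMap, zero_mul, zero_add, mul_sub,
    Finset.mul_sum]

theorem lapVF_expSF (f : SF E M) : lapVF s Z (expSF f) =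
    expSF f * (∑ i, derivVF (s i) f ^ 2 + lapVF s Z f) := by
  simp only [lapVF_apply, derivVF_expSF, derivVF_mul, Finset.sum_add_distrib, mul_add, mul_sub,
    Finset.mul_sum, add_sub_assoc]
  congr 1
  exact Finset.sum_congr rfl fun i _ ↦ by ring

variable [FiniteDimensional ℝ E]

/-- The model space E is only normed; a Euclidean target provides smooth squared distances and the
geometry of round balls. -/
theorem exists_euclidean_chart (p : M) :
    ∃ e : OpenPartialHomeomorph M (EuclideanSpace ℝ (Fin (Module.finrank ℝ E))),
      p ∈ e.source ∧ CMDiff[e.source] ∞ (⇑e) ∧ CMDiff[e.target] ∞ (⇑e.symm) := by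
  let L := toEuclidean (E := E)
  refine ⟨(chartAt E p).trans L.toHomeomorph.toOpenPartialHomeomorph, by simp, ?_, ?_⟩
  · have : CMDiff[(chartAt E p).source] ∞ (⇑L ∘ ⇑(chartAt E p)) :=
      L.contDiff.contMDiff.comp_contMDiffOn contMDiffOn_chart
    exact this.mono (by simp)
  · have : CMDiff[⇑L.symm ⁻¹' (chartAt E p).target] ∞ (⇑(chartAt E p).symm ∘ ⇑L.symm) :=
      contMDiffOn_chart_symm.comp L.symm.contDiff.contMDiff.contMDiffOn (fun _ h ↦ h)
    exact this.mono (by simp)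

variable [T2Space M]

/-- Squared distance functions in charts, globalised. -/
theorem exists_sqdist {F : Type*} [NormedAddCommGroup F] [InnerProductSpace ℝ F]
    {e : OpenPartialHomeomorph M F} (he : CMDiff[e.source] ∞ (⇑e))
    (he' : CMDiff[e.target] ∞ (⇑e.symm)) {y : M} (hy : y ∈ e.source) {c : F} (hc : e y ≠ c) :
    ∃ ρ : SF E M, (∀ᶠ z in 𝓝 y, ρ z = dist (e z) c ^ 2) ∧ d% (⇑ρ) y ≠ 0 := by
  obtain ⟨χ, -, hχ⟩ := ((SmoothBumpFunction.nhds_basis_tsupport (I := 𝓘(ℝ, E)) y).mem_iff).1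
    (e.open_source.mem_nhds hy)
  have hsm : ContDiff ℝ ∞ fun z : F ↦ dist z c ^ 2 := by
    simp_rw [dist_eq_norm]
    exact (contDiff_id.sub contDiff_const).norm_sq ℝ
  let ρ : SF E M := ⟨fun z ↦ χ z * dist (e z) c ^ 2, contMDiff_of_tsupport fun x hx ↦ by
    have hx' : x ∈ e.source := hχ (closure_mono (Function.support_mul_subset_left _ _) hx)
    exact χ.contMDiff.contMDiffAt.mul (hsm.contMDiff.contMDiffAt.comp x
      (he.contMDiffAt (e.open_source.mem_nhds hx')))⟩
  have hρ : ∀ᶠ z in 𝓝 y, ρ z = dist (e z) c ^ 2 := by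
    filter_upwards [χ.eventuallyEq_one] with z hz
    change χ z * _ = _
    rw [hz]; simp
  refine ⟨ρ, hρ, fun h0 ↦ ?_⟩
  -- Along the radial line through e y the function is (1+t)² d², with derivative 2d² ≠ 0 at t = 0.
  have hl : HasDerivAt (fun t : ℝ ↦ e y + t • (e y - c)) (e y - c) 0 := by
    simpa using ((hasDerivAt_id (0 : ℝ)).smul_const (e y - c)).const_add (e y)
  have hl0 : e y + (0 : ℝ) • (e y - c) = e y := by simp
  have h1 : MDiffAt (⇑e.symm) (e y + (0 : ℝ) • (e y - c)) := by
    rw [hl0]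
    exact (he'.contMDiffAt (e.open_target.mem_nhds (e.map_source hy))).mdifferentiableAt
      (by simp)
  have h2 := h1.hasMFDerivAt.comp (0 : ℝ) hl.hasFDerivAt.hasMFDerivAt
  have hy0 : (⇑e.symm ∘ fun t : ℝ ↦ e y + t • (e y - c)) 0 = y := by
    simp [e.left_inv hy]
  have h3 := (ρ.mdifferentiableAt
    (x := (⇑e.symm ∘ fun t : ℝ ↦ e y + t • (e y - c)) 0)).hasMFDerivAt.comp (0 : ℝ) h2
  have h4 : mfderiv% (⇑ρ) ((⇑e.symm ∘ fun t : ℝ ↦ e y + t • (e y - c)) 0) = 0 := by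
    rw [hy0]; exact h0
  rw [h4, ContinuousLinearMap.zero_comp] at h3
  have h5' : HasFDerivAt (⇑ρ ∘ ⇑e.symm ∘ fun t : ℝ ↦ e y + t • (e y - c)) (0 : ℝ →L[ℝ] ℝ) 0 :=
    h3.hasFDerivAt
  have h5 : HasDerivAt (⇑ρ ∘ ⇑e.symm ∘ fun t : ℝ ↦ e y + t • (e y - c)) 0 0 := by
    simpa using h5'.hasDerivAt
  have h6 : HasDerivAt (fun t : ℝ ↦ (1 + t) ^ 2 * dist (e y) c ^ 2) (2 * dist (e y) c ^ 2) 0 := by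
    have := (((hasDerivAt_id (0 : ℝ)).const_add 1).pow 2).mul_const (dist (e y) c ^ 2)
    simpa using this
  have h7 : (⇑ρ ∘ ⇑e.symm ∘ fun t : ℝ ↦ e y + t • (e y - c)) =ᶠ[𝓝 0]
      fun t : ℝ ↦ (1 + t) ^ 2 * dist (e y) c ^ 2 := by
    have c1 : ContinuousAt (fun t : ℝ ↦ e y + t • (e y - c)) 0 := hl.continuousAt
    have e1 : ∀ᶠ t in 𝓝 (0 : ℝ), e y + t • (e y - c) ∈ e.target :=
      c1.eventually (by
      change e.target ∈ 𝓝 (e y + (0 : ℝ) • (e y - c))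
      rw [hl0]; exact e.open_target.mem_nhds (e.map_source hy))
    have c2 : ContinuousAt (⇑e.symm ∘ fun t : ℝ ↦ e y + t • (e y - c)) 0 :=
      h2.continuousAt
    have e2 := c2.eventually (p := fun z ↦ ρ z = dist (e z) c ^ 2) (by rw [hy0]; exact hρ)
    filter_upwards [e1, e2] with t ht1 ht2
    simp only [Function.comp_apply] at ht2 ⊢
    rw [ht2, e.right_inv ht1, dist_eq_norm, dist_eq_norm,
      show e y + t • (e y - c) - c = (1 + t) • (e y - c) by module, norm_smul, mul_pow,
      Real.norm_eq_abs, sq_abs]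
  have := (h5.congr_of_eventuallyEq h7.symm).unique h6
  have hpos : 0 < dist (e y) c := dist_pos.2 hc
  have : (0 : ℝ) < 2 * dist (e y) c ^ 2 := by positivity
  linarith

theorem lapVF_nonpos_of_isLocalMax {f : SF E M} {x : M} (hf : IsLocalMax f x) :
    lapVF s Z f x ≤ 0 := by
  rw [lapVF_apply]
  change (∑ i, derivVF (s i) (derivVF (s i) f)) x - derivVF Z f x ≤ 0
  rw [(derivVF_of_isLocalMax hf Z).1, sub_zero, sum_SF_apply]
  exact Finset.sum_nonpos fun i _ ↦ (derivVF_of_isLocalMax hf (s i)).2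

variable {s}

/-- Hopf's barrier w = exp(−αρ), with ρ the squared distance. For L = `lapVF s Z`, one has Lw = αw(α
∑ (s_i ρ)² − Lρ). Since the s_i span and dρ ≠ 0 at y, the sum is positive there, and a large α makes
Lw positive. -/
theorem exists_barrier (hs : ∀ x (v : TangentSpace 𝓘(ℝ, E) x), v ∈ Submodule.span ℝ
      (Set.range fun i ↦ s i x)) {F : Type*} [NormedAddCommGroup F] [InnerProductSpace ℝ F]
    {e : OpenPartialHomeomorph M F} (he : CMDiff[e.source] ∞ (⇑e))
    (he' : CMDiff[e.target] ∞ (⇑e.symm)) {y : M} (hy : y ∈ e.source) {c : F} (hc : e y ≠ c) :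
    ∃ (w : SF E M) (α : ℝ), 0 < α ∧ (∀ᶠ z in 𝓝 y, w z = Real.exp (-α * dist (e z) c ^ 2)) ∧
      ∀ᶠ z in 𝓝 y, 0 < lapVF s Z w z := by
  obtain ⟨ρ, hρ, hd⟩ := exists_sqdist (E := E) he he' hy hc
  have hG : 0 < ∑ i, (derivVF (s i) ρ y) ^ 2 := by
    by_contra! h
    have h0 := (Finset.sum_eq_zero_iff_of_nonneg (fun i _ ↦ sq_nonneg (derivVF (s i) ρ y))).1
      (le_antisymm h (Finset.sum_nonneg fun i _ ↦ sq_nonneg _))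
    refine hd (ContinuousLinearMap.ext fun v ↦ ?_)
    refine Submodule.span_induction (p := fun v _ ↦ d% (⇑ρ) y v = 0) ?_ (map_zero _)
      (fun a b _ _ ha hb ↦ by rw [map_add, ha, hb, add_zero])
      (fun a b _ hb ↦ by rw [map_smul, hb, smul_zero]) (hs y v)
    rintro _ ⟨i, rfl⟩
    exact pow_eq_zero_iff two_ne_zero |>.1 (h0 i (Finset.mem_univ i))
  obtain ⟨α, hα, hαG⟩ : ∃ α : ℝ, 0 < α ∧ lapVF s Z ρ y < α * ∑ i, (derivVF (s i) ρ y) ^ 2 := by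
    refine ⟨|lapVF s Z ρ y| / (∑ i, (derivVF (s i) ρ y) ^ 2) + 1, by positivity, ?_⟩
    rw [add_mul, div_mul_cancel₀ _ hG.ne']
    linarith [le_abs_self (lapVF s Z ρ y)]
  let w := expSF (algebraMap ℝ (SF E M) (-α) * ρ)
  refine ⟨w, α, hα, hρ.mono fun z hz ↦ ?_, ?_⟩
  · change Real.exp (-α * ρ z) = _
    rw [hz]
  · have hpos : 0 < lapVF s Z w y := by
      have h1 : lapVF s Z w y = w y * (α * (α * ∑ i, (derivVF (s i) ρ y) ^ 2 - lapVF s Z ρ y)) := by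
        rw [lapVF_expSF, lapVF_algebraMap_mul]
        simp only [derivVF_mul, derivVF_algebraMap, zero_mul, zero_add, mul_pow, ← Finset.mul_sum]
        change w y * ((-α) ^ 2 * (∑ i, derivVF (s i) ρ ^ 2) y + -α * lapVF s Z ρ y) = _
        rw [sum_SF_apply]
        change w y * ((-α) ^ 2 * (∑ i, (derivVF (s i) ρ y) ^ 2) + -α * lapVF s Z ρ y) = _
        ring
      rw [h1]
      exact mul_pos (Real.exp_pos _) (mul_pos hα (by linarith))
    exact (lapVF s Z w).contMDiff.continuous.continuousAt.eventually (lt_mem_nhds hpos)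

end RiemannianGeometry

namespace RiemannianGeometry

variable {E : Type*} [NormedAddCommGroup E] [NormedSpace ℝ E]
  {M : Type*} [TopologicalSpace M] [ChartedSpace E M] [IsManifold 𝓘(ℝ, E) ∞ M]
  {n : ℕ} {s : Fin n → VF E M} (Z : VF E M) [FiniteDimensional ℝ E] [T2Space M]

/-- Hopf's strong maximum principle, local version. -/
theorem eventually_eq_of_isLocalMax (hs : ∀ x (v : TangentSpace 𝓘(ℝ, E) x),
      v ∈ Submodule.span ℝ (Set.range fun i ↦ s i x)) {f : SF E M}
    (hf : ∀ x, 0 ≤ lapVF s Z f x) {p : M} (hp : IsLocalMax f p) :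
    ∀ᶠ y in 𝓝 p, f y = f p := by
  by_contra hne
  obtain ⟨e, hpe, he, he'⟩ := exists_euclidean_chart (E := E) p
  have hpt : e p ∈ e.target := e.map_source hpe
  have hcs : ContinuousAt e.symm (e p) := e.continuousAt_symm hpt
  have hfc : Continuous f := f.contMDiff.continuous
  have hloc : ∀ᶠ z in 𝓝 (e p), z ∈ e.target ∧ f (e.symm z) ≤ f p := by
    filter_upwards [e.open_target.mem_nhds hpt,
      hcs.eventually (p := fun y ↦ f y ≤ f p) (by rw [e.left_inv hpe]; exact hp)] with z h1 h2
    exact ⟨h1, h2⟩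
  obtain ⟨R, hR, hball⟩ := Metric.mem_nhds_iff.1 hloc
  have hgc : ContinuousOn (f ∘ e.symm) (ball (e p) R) :=
    hfc.comp_continuousOn (e.continuousOn_symm.mono fun z hz ↦ (hball hz).1)
  have hgp : (f ∘ e.symm) (e p) = f p := by simp [e.left_inv hpe]
  obtain ⟨q, c, r, hr, hqc, hcR, hq, hlt⟩ := exists_touching_ball hR hgc
    (fun z hz ↦ by rw [hgp]; exact (hball hz).2) (fun h ↦ hne (by
      have := (e.continuousAt hpe).eventually h
      filter_upwards [this, e.open_source.mem_nhds hpe] with y hy hys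
      rwa [hgp, Function.comp_apply, e.left_inv hys] at hy))
  rw [hgp] at hq hlt
  have hqR : q ∈ ball (e p) R := hcR (by rw [mem_closedBall, hqc])
  have hqt : q ∈ e.target := (hball hqR).1
  have hqe : e (e.symm q) = q := e.right_inv hqt
  obtain ⟨w, α, hα, hw, hLw⟩ := exists_barrier (E := E) Z hs he he' (e.map_target hqt) (c := c)
    (by rw [hqe]; rintro rfl; simp at hqc; linarith)
  have hnear : ∀ᶠ z in 𝓝 q, z ∈ ball (e p) R ∧ w (e.symm z) = Real.exp (-α * dist z c ^ 2) ∧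
      0 < lapVF s Z w (e.symm z) := by
    have h1 := (e.continuousAt_symm hqt).eventually hw
    have h2 := (e.continuousAt_symm hqt).eventually hLw
    filter_upwards [h1, h2, isOpen_ball.mem_nhds hqR, e.open_target.mem_nhds hqt] with z h1 h2 h3 h4
    rw [e.right_inv h4] at h1
    exact ⟨h3, h1, h2⟩
  obtain ⟨δ', hδ', hδball⟩ := Metric.mem_nhds_iff.1 hnear
  set δ := δ' / 2 with hδ
  have hδpos : 0 < δ := by positivity
  have hsub (z) (hz : z ∈ closedBall q δ) : z ∈ ball (e p) R ∧
      w (e.symm z) = Real.exp (-α * dist z c ^ 2) ∧ 0 < lapVF s Z w (e.symm z) :=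
    hδball (closedBall_subset_ball (by linarith) hz)
  have hsph : IsCompact (sphere q δ ∩ closedBall c r) :=
    (isCompact_sphere q δ).inter_right isClosed_closedBall
  obtain ⟨m, hm, hmS⟩ : ∃ m < f p, ∀ z ∈ sphere q δ ∩ closedBall c r, f (e.symm z) ≤ m := by
    rcases (sphere q δ ∩ closedBall c r).eq_empty_or_nonempty with h | h
    · exact ⟨f p - 1, by linarith, by simp [h]⟩
    · obtain ⟨z₀, hz₀, hmax⟩ := hsph.exists_isMaxOn h (hgc.mono fun z hz ↦ hcR hz.2)
      refine ⟨_, hlt z₀ hz₀.2 ?_, fun z hz ↦ hmax hz⟩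
      rintro rfl
      simpa [hδpos.ne] using hz₀.1
  -- Half the gap: m + ε is still below f p, and w ≤ 1 on the small sphere.
  set ε := (f p - m) / 2 with hε
  have hεpos : 0 < ε := by rw [hε]; linarith
  set b := Real.exp (-α * r ^ 2) with hb
  have hbpos : 0 < b := Real.exp_pos _
  let h : SF E M := f + algebraMap ℝ (SF E M) ε * w
  have hh (y : M) : h y = f y + ε * w y := rfl
  have hhc : ContinuousOn (fun z ↦ h (e.symm z)) (closedBall q δ) :=
    h.contMDiff.continuous.comp_continuousOn
      (e.continuousOn_symm.mono fun z hz ↦ (hball (hsub z hz).1).1)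
  have hhq : h (e.symm q) = f p + ε * b := by
    rw [hh, (hsub q (mem_closedBall_self hδpos.le)).2.1, hqc]
    congr 1
  -- Inside the touching ball f is at most m; outside it w is below its value b at q. So the maximum
  -- of h = f + εw over the small closed ball is interior, where the operator would be ≤ 0 on h
  -- although it is positive on w and non-negative on f.
  have hbd (z) (hz : z ∈ sphere q δ) : h (e.symm z) < f p + ε * b := by
    have hz' := hsub z (sphere_subset_closedBall hz)
    rw [hh]
    by_cases hzc : z ∈ closedBall c r
    · have h1 := hmS z ⟨hz, hzc⟩
      have h2 : w (e.symm z) ≤ 1 := by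
        rw [hz'.2.1, Real.exp_le_one_iff]
        have := sq_nonneg (dist z c)
        nlinarith
      have h3 : ε * w (e.symm z) ≤ ε := by nlinarith
      have h4 : 0 < ε * b := mul_pos hεpos hbpos
      linarith
    · have h1 := (hball hz'.1).2
      have h2 : w (e.symm z) < b := by
        rw [hz'.2.1, hb, Real.exp_lt_exp]
        rw [mem_closedBall, not_le] at hzc
        have : r ^ 2 < dist z c ^ 2 := by gcongr
        nlinarith
      have h3 : ε * w (e.symm z) < ε * b := mul_lt_mul_of_pos_left h2 hεpos
      linarith
  obtain ⟨z₁, hz₁, hmax⟩ := (isCompact_closedBall q δ).exists_isMaxOn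
    ⟨q, mem_closedBall_self hδpos.le⟩ hhc
  have hz₁b : z₁ ∈ ball q δ := by
    rcases (closedBall_sdiff_sphere (x := q) (ε := δ)) ▸ (show z₁ ∈ closedBall q δ \ sphere q δ from
      ⟨hz₁, fun hs ↦ by
        have h1 := hbd z₁ hs
        have h2 : h (e.symm q) ≤ h (e.symm z₁) := hmax (mem_closedBall_self hδpos.le)
        linarith⟩) with h
    exact h
  have hz₁t : z₁ ∈ e.target := (hball (hsub z₁ hz₁).1).1
  have hlocmax : IsLocalMax h (e.symm z₁) := by
    have hc : ContinuousAt e (e.symm z₁) := e.continuousAt (e.map_target hz₁t)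
    have h1 : ∀ᶠ y in 𝓝 (e.symm z₁), e y ∈ ball q δ :=
      hc.eventually (by rw [e.right_inv hz₁t]; exact isOpen_ball.mem_nhds hz₁b)
    filter_upwards [h1, e.open_source.mem_nhds (e.map_target hz₁t)] with y hy hys
    have : h (e.symm (e y)) ≤ h (e.symm z₁) := hmax (ball_subset_closedBall hy)
    rwa [e.left_inv hys] at this
  have h1 := lapVF_nonpos_of_isLocalMax s Z hlocmax
  have h2 : lapVF s Z h (e.symm z₁) =
      lapVF s Z f (e.symm z₁) + ε * lapVF s Z w (e.symm z₁) := by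
    rw [map_add, lapVF_algebraMap_mul]; rfl
  have h3 := hf (e.symm z₁)
  have h4 := mul_pos hεpos (hsub z₁ hz₁).2.2
  linarith

/-- The strong maximum principle on compact manifolds. -/
theorem eventually_eq_of_lapVF_nonneg [CompactSpace M]
    (hs : ∀ x (v : TangentSpace 𝓘(ℝ, E) x), v ∈ Submodule.span ℝ (Set.range fun i ↦ s i x))
    {f : SF E M} (hf : ∀ x, 0 ≤ lapVF s Z f x) (x : M) : ∀ᶠ y in 𝓝 x, f y = f x := by
  have := ChartedSpace.locallyConnectedSpace E M
  have hfc : Continuous f := f.contMDiff.continuous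
  have hC : IsOpen (connectedComponent x) := isOpen_connectedComponent
  obtain ⟨p, hpC, hpmax⟩ := (isClosed_connectedComponent (x := x)).isCompact.exists_isMaxOn
    ⟨x, mem_connectedComponent⟩ hfc.continuousOn
  -- By the local principle, the set where f attains its maximum over the component is open as well
  -- as closed, hence the whole component.
  have hK : IsClopen (connectedComponent x ∩ f ⁻¹' {f p}) := by
    refine ⟨isClosed_connectedComponent.inter (isClosed_singleton.preimage hfc),
      isOpen_iff_mem_nhds.2 fun y hy ↦ ?_⟩
    have hyp : f y = f p := hy.2
    have hloc : IsLocalMax f y := by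
      filter_upwards [hC.mem_nhds hy.1] with z hz
      rw [hyp]; exact hpmax hz
    filter_upwards [hC.mem_nhds hy.1, eventually_eq_of_isLocalMax Z hs hf hloc] with z hz hz'
    exact ⟨hz, hz'.trans hyp⟩
  have hsub := hK.connectedComponent_subset (x := p) ⟨hpC, rfl⟩
  rw [← connectedComponent_eq hpC] at hsub
  filter_upwards [hC.mem_nhds mem_connectedComponent] with y hy
  exact (hsub hy).2.trans (hsub mem_connectedComponent).2.symm

theorem derivVF_eq_zero_of_lapVF_nonneg [CompactSpace M]
    (hs : ∀ x (v : TangentSpace 𝓘(ℝ, E) x), v ∈ Submodule.span ℝ (Set.range fun i ↦ s i x))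
    {f : SF E M} (hf : ∀ x, 0 ≤ lapVF s Z f x) (X : VF E M) : derivVF X f = 0 := by
  ext x
  have h := eventually_eq_of_lapVF_nonneg Z hs hf x
  exact (derivVF_of_isLocalMax (h.mono fun y hy ↦ hy.le) X).1

end RiemannianGeometry

/-! ### Integration over the fibres -/

open MeasureTheory

namespace RiemannianGeometry

section weight

variable {ι : Type*} [Fintype ι]

/-- A radial cut-off function. -/
def weight (η : ι → ℝ) : ℝ := Real.smoothTransition (1 - ∑ i, η i ^ 2)

theorem contDiff_weight : ContDiff ℝ 1 (weight (ι := ι)) :=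
  (Real.smoothTransition.contDiff (n := 1)).comp (by fun_prop)

theorem continuous_weight : Continuous (weight (ι := ι)) := contDiff_weight.continuous

theorem weight_nonneg (η : ι → ℝ) : 0 ≤ weight η := Real.smoothTransition.nonneg _

theorem weight_pos {η : ι → ℝ} (h : ∑ i, η i ^ 2 < 1) : 0 < weight η :=
  Real.smoothTransition.pos_of_pos (by linarith)

theorem hasCompactSupport_weight : HasCompactSupport (weight (ι := ι)) := by
  refine .of_support_subset_isCompact (isCompact_closedBall 0 1) fun η hη ↦ ?_
  have h : ∑ i, η i ^ 2 < 1 := by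
    by_contra h
    exact hη (Real.smoothTransition.zero_of_nonpos (by linarith))
  rw [mem_closedBall_zero_iff, pi_norm_le_iff_of_nonneg zero_le_one]
  intro i
  have := Finset.single_le_sum (f := fun i ↦ η i ^ 2) (fun i _ ↦ sq_nonneg _) (Finset.mem_univ i)
  rw [Real.norm_eq_abs, ← sq_le_one_iff_abs_le_one]
  linarith

theorem integrable_weight_mul {h : (ι → ℝ) → ℝ} (hh : Continuous h) :
    Integrable fun η ↦ weight η * h η :=
  (continuous_weight.mul hh).integrable_of_hasCompactSupport hasCompactSupport_weight.mul_right

variable [DecidableEq ι]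

/-- The gradient of the cut-off is radial, so fields tangent to the spheres do not see it when
integrating by parts. -/
theorem fderiv_weight (η : ι → ℝ) (i : ι) : fderiv ℝ weight η (Pi.single i 1) =
    -2 * deriv Real.smoothTransition (1 - ∑ i, η i ^ 2) * η i := by
  have h1 : HasFDerivAt (fun η : ι → ℝ ↦ 1 - ∑ i, η i ^ 2)
      (-∑ i, (2 • η i ^ (2 - 1)) • ContinuousLinearMap.proj (R := ℝ) (φ := fun _ : ι ↦ ℝ) i)
      η :=
    (HasFDerivAt.fun_sum fun i _ ↦ (hasFDerivAt_apply i η).pow 2).const_sub 1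
  have h2 : HasDerivAt Real.smoothTransition _ (1 - ∑ i, η i ^ 2) :=
    ((Real.smoothTransition.contDiff (n := 1)).differentiable one_ne_zero _).hasDerivAt
  have h3 : HasFDerivAt weight _ η := h2.comp_hasFDerivAt η h1
  rw [h3.fderiv]
  simp [Pi.single_apply]
  ring

/-- The divergence theorem for vector fields tangent to spheres. -/
theorem integral_weight_mul_div {V : ι → (ι → ℝ) → ℝ} (hV : ∀ i, ContDiff ℝ 1 (V i))
    (h : ∀ η, ∑ i, η i * V i η = 0) :
    ∫ η, weight η * ∑ i, fderiv ℝ (V i) η (Pi.single i 1) = 0 := by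
  have hc (i : ι) : Continuous fun η ↦ fderiv ℝ (V i) η (Pi.single i 1) :=
    ((hV i).continuous_fderiv one_ne_zero).clm_apply continuous_const
  have hw (i : ι) : Continuous fun η : ι → ℝ ↦ fderiv ℝ weight η (Pi.single i 1) :=
    (contDiff_weight.continuous_fderiv one_ne_zero).clm_apply continuous_const
  have hwi (i : ι) : Integrable fun η ↦ fderiv ℝ weight η (Pi.single i 1) * V i η :=
    ((hw i).mul (hV i).continuous).integrable_of_hasCompactSupport
      (HasCompactSupport.mul_right (hasCompactSupport_weight.fderiv_apply ℝ _))
  simp_rw [Finset.mul_sum]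
  rw [integral_finsetSum _ fun i _ ↦ integrable_weight_mul (hc i)]
  have key (i : ι) := integral_mul_fderiv_eq_neg_fderiv_mul_of_integrable (hwi i)
    (integrable_weight_mul (hc i)) (integrable_weight_mul (hV i).continuous)
    (fun η _ ↦ contDiff_weight.differentiable one_ne_zero η)
    (fun η _ ↦ (hV i).differentiable one_ne_zero η)
  simp_rw [key]
  rw [Finset.sum_neg_distrib, ← integral_finsetSum _ fun i _ ↦ hwi i, neg_eq_zero]
  refine integral_eq_zero_of_ae (.of_forall fun η ↦ ?_)
  simp only [fderiv_weight, Pi.zero_apply]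
  rw [← mul_zero (-2 * deriv Real.smoothTransition (1 - ∑ i, η i ^ 2)), ← h η, Finset.mul_sum]
  exact Finset.sum_congr rfl fun i _ ↦ by ring

theorem eq_zero_of_integral_weight_mul_sq {h : (ι → ℝ) → ℝ} (hh : Continuous h)
    (h0 : ∫ η, weight η * h η ^ 2 = 0) {η : ι → ℝ} (hη : ∑ i, η i ^ 2 < 1) : h η = 0 := by
  by_contra hne
  have h1 : Continuous fun η ↦ weight η * h η ^ 2 := continuous_weight.mul (hh.pow 2)
  have h2 : HasCompactSupport fun η ↦ weight η * h η ^ 2 := hasCompactSupport_weight.mul_right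
  have h3 : (0 : (ι → ℝ) → ℝ) ≤ fun η ↦ weight η * h η ^ 2 :=
    fun η ↦ mul_nonneg (weight_nonneg η) (sq_nonneg _)
  have h4 : weight η * h η ^ 2 ≠ 0 := mul_ne_zero (weight_pos hη).ne' (pow_ne_zero 2 hne)
  exact (h1.integral_pos_of_hasCompactSupport_nonneg_nonzero h2 h3 h4).ne' h0

end weight

section pointwise

variable {W : Type*} [NormedAddCommGroup W] [InnerProductSpace ℝ W] {ι κ : Type*} [Fintype ι]
  [Fintype κ]

theorem inner_parseval {t : ι → W} (ht : ∀ v, ∑ i, inner ℝ v (t i) • t i = v) (v w : W) :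
    ∑ i, inner ℝ v (t i) * inner ℝ (t i) w = inner ℝ v w := by
  conv_rhs => rw [← ht v]
  simp [sum_inner, real_inner_smul_left]

/-- The metric trace can be computed with any Parseval frame. -/
theorem sum_eq_sum_of_parseval {t : ι → W} (ht : ∀ v, ∑ i, inner ℝ v (t i) • t i = v)
    {t' : κ → W} (ht' : ∀ v, ∑ i, inner ℝ v (t' i) • t' i = v) {P : Type*} [AddCommGroup P]
    [Module ℝ P] (T : W →ₗ[ℝ] W →ₗ[ℝ] P) : ∑ i, T (t i) (t i) = ∑ i, T (t' i) (t' i) := by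
  have h (i : ι) : T (t i) (t i) = ∑ j, inner ℝ (t i) (t' j) • T (t i) (t' j) := by
    conv_lhs => enter [2]; rw [← ht' (t i)]
    simp
  simp_rw [h]
  rw [Finset.sum_comm]
  refine Finset.sum_congr rfl fun j _ ↦ ?_
  conv_rhs => enter [1]; rw [← ht (t' j)]
  simp [real_inner_comm]

/-- The vector with coordinates `η` in the frame `t`. -/
def comb (t : ι → W) : (ι → ℝ) →L[ℝ] W :=
  ∑ i, (ContinuousLinearMap.proj (R := ℝ) (φ := fun _ : ι ↦ ℝ) i).smulRight (t i)

theorem comb_apply (t : ι → W) (η : ι → ℝ) : comb t η = ∑ i, η i • t i := by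
  simp [comb]

theorem comb_single [DecidableEq ι] (t : ι → W) (i : ι) : comb t (Pi.single i 1) = t i := by
  simp [comb_apply, Pi.single_apply]

/-- Integrals over the fibre are parallel. -/
theorem integral_fderiv_comb_eq_zero {t ξ : ι → W}
    (ht : ∀ v, ∑ i, inner ℝ v (t i) • t i = v)
    (hξ : ∀ Y Z : W, ∑ i, (inner ℝ Y (ξ i) * inner ℝ (t i) Z + inner ℝ Y (t i) * inner ℝ (ξ i) Z) = 0)
    {G : W → ℝ} (hG : ContDiff ℝ 1 G) :
    ∫ η, weight η * fderiv ℝ G (comb t η) (comb ξ η) = 0 := by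
  classical
  -- A skew matrix with ∑_j B_jk t_j = ξ_k: the derivative ξ of the frame is realised by an
  -- infinitesimal rotation of the coordinates η. The field η ↦ G(comb t η) Bη is then tangent to
  -- the spheres.
  let B (j k : ι) : ℝ := inner ℝ (ξ k) (t j) - inner ℝ (ξ j) (t k)
    - ∑ l, inner ℝ (t j) (ξ l) * inner ℝ (t l) (t k)
  have hP (j k : ι) : ∑ l, inner ℝ (t j) (ξ l) * inner ℝ (t l) (t k)
      = -∑ l, inner ℝ (t k) (ξ l) * inner ℝ (t l) (t j) := by
    have := hξ (t j) (t k)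
    rw [Finset.sum_add_distrib] at this
    rw [eq_neg_iff_add_eq_zero, ← this]
    congr 1
    exact Finset.sum_congr rfl fun l _ ↦ by rw [real_inner_comm (ξ l), real_inner_comm (t j)]; ring
  have hB (j k : ι) : B j k = -B k j := by
    simp only [B]; rw [hP j k]; ring
  have hBt (k : ι) : ∑ j, B j k • t j = ξ k := by
    have h1 := ht (ξ k)
    have h3 : ∑ j, (inner ℝ (ξ j) (t k) • t j + (∑ l, inner ℝ (t j) (ξ l) * inner ℝ (t l) (t k)) • t j) = 0 := by
      have e : ∑ j, (∑ l, inner ℝ (t j) (ξ l) * inner ℝ (t l) (t k)) • t j =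
          ∑ l, inner ℝ (t l) (t k) • ξ l := by
        simp_rw [Finset.sum_smul]
        rw [Finset.sum_comm]
        refine Finset.sum_congr rfl fun l _ ↦ ?_
        conv_rhs => rw [← ht (ξ l)]
        rw [Finset.smul_sum]
        exact Finset.sum_congr rfl fun j _ ↦ by rw [smul_smul, real_inner_comm, mul_comm]
      rw [Finset.sum_add_distrib, e, ← Finset.sum_add_distrib]
      refine ext_inner_right ℝ fun Z ↦ ?_
      rw [inner_zero_left, ← hξ (t k) Z, sum_inner]
      refine Finset.sum_congr rfl fun l _ ↦ ?_
      rw [inner_add_left, real_inner_smul_left, real_inner_smul_left, real_inner_comm (t k),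
        real_inner_comm (t k)]
    simp only [B, sub_smul, Finset.sum_sub_distrib]
    rw [h1, sub_sub, ← Finset.sum_add_distrib, h3, sub_zero]
  let V (j : ι) (η : ι → ℝ) : ℝ := (∑ k, B j k * η k) * G (comb t η)
  have hGc : ContDiff ℝ 1 fun η ↦ G (comb t η) := hG.comp (comb t).contDiff
  have hV (j : ι) : ContDiff ℝ 1 (V j) := by
    refine ContDiff.mul (by fun_prop) hGc
  have h0 (η : ι → ℝ) : ∑ j, η j * V j η = 0 := by
    have e : ∑ j, η j * V j η = (∑ j, ∑ k, B j k * (η j * η k)) * G (comb t η) := by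
      rw [Finset.sum_mul]
      refine Finset.sum_congr rfl fun j _ ↦ ?_
      simp only [V, ← mul_assoc, Finset.mul_sum]
      congr 1
      exact Finset.sum_congr rfl fun k _ ↦ by ring
    have e2 : ∑ j, ∑ k, B j k * (η j * η k) = -∑ j, ∑ k, B j k * (η j * η k) := by
      conv_lhs => rw [Finset.sum_comm]
      simp_rw [← Finset.sum_neg_distrib]
      exact Finset.sum_congr rfl fun j _ ↦ Finset.sum_congr rfl fun k _ ↦ by rw [hB]; ring
    rw [e, show ∑ j, ∑ k, B j k * (η j * η k) = 0 by linarith, zero_mul]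
  rw [← integral_weight_mul_div hV h0]
  refine integral_congr_ae (.of_forall fun η ↦ ?_)
  simp only
  congr 1
  have hd (j : ι) : fderiv ℝ (V j) η (Pi.single j 1) =
      (∑ k, B j k * η k) * fderiv ℝ G (comb t η) (t j) := by
    have h1 : HasFDerivAt (fun η : ι → ℝ ↦ ∑ k, B j k * η k)
        (∑ k, B j k • ContinuousLinearMap.proj (R := ℝ) (φ := fun _ : ι ↦ ℝ) k) η :=
      HasFDerivAt.fun_sum fun k _ ↦ (hasFDerivAt_apply k η).const_mul _
    have h2 : HasFDerivAt (fun η ↦ G (comb t η)) ((fderiv ℝ G (comb t η)).comp (comb t)) η :=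
      (hG.differentiable one_ne_zero _).hasFDerivAt.comp η (comb t).hasFDerivAt
    rw [show V j = fun η ↦ (∑ k, B j k * η k) * G (comb t η) from rfl, (h1.fun_mul h2).fderiv]
    -- A skew matrix has zero diagonal, so the rotation field contributes no divergence of its own.
    have : B j j = 0 := by linarith [hB j j]
    simp [comb_single, Pi.single_apply, this]
  simp_rw [hd]
  rw [show comb ξ η = ∑ j, (∑ k, B j k * η k) • t j by
    rw [comb_apply]
    simp_rw [← hBt, Finset.sum_smul, Finset.smul_sum, smul_smul]
    rw [Finset.sum_comm]
    exact Finset.sum_congr rfl fun j _ ↦ Finset.sum_congr rfl fun k _ ↦ by rw [mul_comm]]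
  simp

end pointwise

end RiemannianGeometry

/-! ### The two curvature integral inequalities -/

namespace RiemannianGeometry

section pointwise

variable {W : Type*} [NormedAddCommGroup W] [InnerProductSpace ℝ W] {ι κ : Type*} [Fintype ι]
  [Fintype κ]

theorem fderiv_comp_comb [DecidableEq ι] {t : ι → W} {g : W → ℝ} (hg : ContDiff ℝ 1 g)
    {η : ι → ℝ} {i : ι} {d : ℝ} (hd : HasDerivAt (fun τ : ℝ ↦ g (comb t η + τ • t i)) d 0) :
    fderiv ℝ (fun η ↦ g (comb t η)) η (Pi.single i 1) = d := by
  have h1 : HasFDerivAt g _ (comb t η) := (hg.differentiable one_ne_zero _).hasFDerivAt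
  have h2 : HasFDerivAt (fun η ↦ g (comb t η)) _ η := h1.comp η (comb t).hasFDerivAt
  rw [h2.fderiv, ContinuousLinearMap.comp_apply, comb_single]
  exact (h1.hasLineDerivAt (t i)).unique hd

/-- Integration by parts over the fibre for products. -/
theorem integral_comb_mul_eq {t : ι → W} {F : W → ℝ} {Φ : ι → W → ℝ} {F' : W → ι → ℝ}
    {Φ' : W → ι → ℝ} (hF : ContDiff ℝ 1 F) (hΦ : ∀ i, ContDiff ℝ 1 (Φ i))
    (hF' : ∀ v i, HasDerivAt (fun τ : ℝ ↦ F (v + τ • t i)) (F' v i) 0)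
    (hΦ' : ∀ v i, HasDerivAt (fun τ : ℝ ↦ Φ i (v + τ • t i)) (Φ' v i) 0)
    (h0 : ∀ η : ι → ℝ, ∑ i, η i * Φ i (comb t η) = 0) :
    ∫ η, weight η * (∑ i, F' (comb t η) i * Φ i (comb t η) + F (comb t η) * ∑ i, Φ' (comb t η) i)
      = 0 := by
  classical
  have hc (i : ι) : ContDiff ℝ 1 fun v ↦ F v * Φ i v := hF.mul (hΦ i)
  rw [← integral_weight_mul_div (V := fun i η ↦ F (comb t η) * Φ i (comb t η))
    (fun i ↦ (hc i).comp (comb t).contDiff) fun η ↦ by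
      rw [← mul_zero (F (comb t η)), ← h0, Finset.mul_sum]
      exact Finset.sum_congr rfl fun i _ ↦ by ring]
  refine integral_congr_ae (.of_forall fun η ↦ ?_)
  simp only
  congr 1
  rw [Finset.mul_sum, ← Finset.sum_add_distrib]
  refine Finset.sum_congr rfl fun i _ ↦ ?_
  rw [fderiv_comp_comb (hc i) ((hF' (comb t η) i).mul (hΦ' (comb t η) i))]
  simp

/-- If a pair of functions satisfies a divergence identity with non-negative remainder, then the
integral of the product is non-negative. -/
theorem integral_nonneg_of_div {t : ι → W} {F Q : W → ℝ} {Φ : ι → W → ℝ} {F' : W → ι → ℝ}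
    {Φ' : W → ι → ℝ} (hF : ContDiff ℝ 1 F) (hΦ : ∀ i, ContDiff ℝ 1 (Φ i))
    (hF' : ∀ v i, HasDerivAt (fun τ : ℝ ↦ F (v + τ • t i)) (F' v i) 0)
    (hΦ' : ∀ v i, HasDerivAt (fun τ : ℝ ↦ Φ i (v + τ • t i)) (Φ' v i) 0)
    (h0 : ∀ η : ι → ℝ, ∑ i, η i * Φ i (comb t η) = 0)
    (hQ : ∀ v, Q v = -∑ i, Φ' v i) (hQc : Continuous Q) (h1 : ∀ v, 0 ≤ ∑ i, F' v i * Φ i v) :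
    0 ≤ ∫ η, weight η * (F (comb t η) * Q (comb t η)) := by
  have h := integral_comb_mul_eq hF hΦ hF' hΦ' h0
  have hc : Continuous fun η ↦ F (comb t η) * Q (comb t η) :=
    (hF.continuous.mul hQc).comp (comb t).continuous
  by_cases hi : Integrable fun η ↦ weight η * ∑ i, F' (comb t η) i * Φ i (comb t η)
  · have e : ∫ η, weight η * (F (comb t η) * Q (comb t η)) =
        ∫ η, weight η * ∑ i, F' (comb t η) i * Φ i (comb t η) := by
      rw [← sub_eq_zero, ← integral_sub (integrable_weight_mul hc) hi, ← neg_eq_zero,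
        ← integral_neg, ← h]
      refine integral_congr_ae (.of_forall fun η ↦ ?_)
      simp only [hQ]; ring
    rw [e]
    exact integral_nonneg fun η ↦ mul_nonneg (weight_nonneg η) (h1 _)
  · refine absurd ?_ hi
    -- The values F' are directional derivatives of a C¹ function, hence continuous, so the
    -- non-integrable case cannot occur.
    have hF'c (i : ι) : Continuous fun v ↦ F' v i := by
      have : (fun v ↦ F' v i) = fun v ↦ fderiv ℝ F v (t i) := by
        ext v
        exact (hF' v i).unique ((hF.differentiable one_ne_zero v).hasFDerivAt.hasLineDerivAt (t i))
      rw [this]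
      exact (hF.continuous_fderiv one_ne_zero).clm_apply continuous_const
    have := integrable_weight_mul (ι := ι)
      (h := fun η ↦ ∑ i, F' (comb t η) i * Φ i (comb t η))
      (continuous_finsetSum _ fun i _ ↦
        ((hF'c i).mul (hΦ i).continuous).comp (comb t).continuous)
    exact this

instance normedAddCommGroupBilinear : NormedAddCommGroup (W →L[ℝ] W →L[ℝ] W) :=
  ContinuousLinearMap.toNormedAddCommGroup

instance normedSpaceBilinear : NormedSpace ℝ (W →L[ℝ] W →L[ℝ] W) :=
  ContinuousLinearMap.toNormedSpace

variable {R : W →L[ℝ] W →L[ℝ] W →L[ℝ] W} {t : ι → W}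

theorem hasDerivAt_line (v w : W) : HasDerivAt (fun τ : ℝ ↦ v + τ • w) w 0 := by
  simpa using ((hasDerivAt_id (0 : ℝ)).smul_const w).const_add v

theorem sum_mul_of_isLinearMap {l : W → ℝ} (hl : IsLinearMap ℝ l) (η : ι → ℝ) :
    ∑ i, η i * l (t i) = l (comb t η) := by
  rw [comb_apply]
  change _ = hl.mk' l _
  simp

theorem sum_inner_mul_of_isLinearMap (ht : ∀ v, ∑ i, inner ℝ v (t i) • t i = v) {l : W → ℝ}
    (hl : IsLinearMap ℝ l) (w : W) : ∑ i, inner ℝ w (t i) * l (t i) = l w := by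
  conv_rhs => rw [← ht w]
  change _ = hl.mk' l _
  simp

/-- Take F(v) = ⟨Rc v, v⟩ and Φ_i(v) = ⟨Rc R(t_i,v)v, v⟩. Tangency to the spheres is R(v,v) = 0.
Summing the derivatives of F against Φ replaces t_i by Rc v and leaves 2⟨R(Rc v,v)v, Rc v⟩ ≥ 0. -/
theorem integral_ricci_nonneg {Rc : W →L[ℝ] W} (ht : ∀ v, ∑ i, inner ℝ v (t i) • t i = v)
    (hRc : ∀ u v, inner ℝ (Rc u) v = inner ℝ u (Rc v)) (hR : ∀ u v, R u u v = 0)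
    (hsec : ∀ u v, 0 ≤ inner ℝ (R u v v) u) :
    0 ≤ ∫ η : ι → ℝ, weight η * (inner ℝ (Rc (comb t η)) (comb t η) *
      -∑ i, (inner ℝ (Rc (R (t i) (comb t η) (comb t η))) (t i) +
        inner ℝ (Rc (comb t η)) (R (t i) (comb t η) (t i)))) := by
  refine integral_nonneg_of_div (F := fun v ↦ inner ℝ (Rc v) v)
    (Q := fun v ↦ -∑ i, (inner ℝ (Rc (R (t i) v v)) (t i) + inner ℝ (Rc v) (R (t i) v (t i))))
    (Φ := fun i v ↦ inner ℝ (Rc (R (t i) v v)) v) (F' := fun v i ↦ 2 * inner ℝ (Rc v) (t i))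
    (Φ' := fun v i ↦ inner ℝ (Rc (R (t i) v v)) (t i) + inner ℝ (Rc v) (R (t i) v (t i)))
    (.inner ℝ (by fun_prop) (by fun_prop)) (fun i ↦ .inner ℝ (by fun_prop) (by fun_prop))
    (fun v i ↦ ?_) (fun v i ↦ ?_) (fun η ↦ ?_) (fun v ↦ rfl) (by fun_prop) fun v ↦ ?_
  · have h := hasDerivAt_line v (t i)
    have h1 : HasDerivAt (fun τ : ℝ ↦ Rc (v + τ • t i)) _ 0 :=
      Rc.hasFDerivAt.comp_hasDerivAt 0 h
    refine (h1.inner ℝ h).congr_deriv ?_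
    rw [hRc (t i), real_inner_comm (Rc _) (t i)]; simp; ring
  · have h := hasDerivAt_line v (t i)
    have h1 : HasDerivAt (fun τ : ℝ ↦ Rc (R (t i) (v + τ • t i) (v + τ • t i))) _ 0 :=
      Rc.hasFDerivAt.comp_hasDerivAt 0
        (((R (t i)).hasFDerivAt.comp_hasDerivAt 0 h).clm_apply h)
    refine (h1.inner ℝ h).congr_deriv ?_
    simp [hR, hRc, real_inner_comm]
  · have hl : IsLinearMap ℝ fun w ↦ inner ℝ (Rc (R w (comb t η) (comb t η))) (comb t η) :=
      ⟨fun _ _ ↦ by simp [inner_add_left], fun _ _ ↦ by simp [real_inner_smul_left]⟩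
    rw [sum_mul_of_isLinearMap hl, hR]
    simp
  · have hl : IsLinearMap ℝ fun w ↦ inner ℝ (Rc (R w v v)) v :=
      ⟨fun _ _ ↦ by simp [inner_add_left], fun _ _ ↦ by simp [real_inner_smul_left]⟩
    simp_rw [mul_assoc]
    rw [← Finset.mul_sum, sum_inner_mul_of_isLinearMap ht hl, hRc]
    exact mul_nonneg zero_le_two (hsec _ _)

/-- The same scheme with F(v) = ⟨R(v,Jv)Jv, v⟩ and Φ_i(v) = ⟨R(R(t_i,v)v, Jv)Jv, v⟩. By the Kähler
symmetries all four slots contribute equally to dF, so with w = R(v,Jv)Jv the remainder is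
4⟨R(w,v)v, w⟩ ≥ 0. -/
theorem integral_curvature_nonneg {J : W →L[ℝ] W} (ht : ∀ v, ∑ i, inner ℝ v (t i) • t i = v)
    (hskew : ∀ u v w, R u v w = -R v u w)
    (hskew' : ∀ u v w z, inner ℝ (R u v w) z = -inner ℝ (R u v z) w)
    (hpair : ∀ u v w z, inner ℝ (R u v w) z = inner ℝ (R w z u) v)
    (hRJ : ∀ u v w, R u v (J w) = J (R u v w)) (hJ : ∀ u v, inner ℝ (J u) (J v) = inner ℝ u v)
    (hJ2 : ∀ u, J (J u) = -u) (hsec : ∀ u v, 0 ≤ inner ℝ (R u v v) u) :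
    0 ≤ ∫ η : ι → ℝ, weight η *
      (inner ℝ (R (comb t η) (J (comb t η)) (J (comb t η))) (comb t η) *
      -∑ i, (inner ℝ (R (R (t i) (comb t η) (t i)) (J (comb t η)) (J (comb t η))) (comb t η)
        + inner ℝ (R (R (t i) (comb t η) (comb t η)) (J (t i)) (J (comb t η))) (comb t η)
        + inner ℝ (R (R (t i) (comb t η) (comb t η)) (J (comb t η)) (J (t i))) (comb t η)
        + inner ℝ (R (R (t i) (comb t η) (comb t η)) (J (comb t η)) (J (comb t η))) (t i))) := by
  have hR (u v : W) : R u u v = 0 := by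
    have := hskew u u v
    have h2 : (2 : ℝ) • R u u v = 0 := by rw [two_smul]; nth_rw 1 [this]; simp
    simpa using h2
  have e1 (u v : W) : inner ℝ (R u (J v) (J v)) v = inner ℝ (R v (J v) (J v)) u := by
    rw [hpair, hskew, inner_neg_left, hskew', neg_neg]
  refine integral_nonneg_of_div (F := fun v ↦ inner ℝ (R v (J v) (J v)) v)
    (Q := fun v ↦ -∑ i, (inner ℝ (R (R (t i) v (t i)) (J v) (J v)) v
        + inner ℝ (R (R (t i) v v) (J (t i)) (J v)) v
        + inner ℝ (R (R (t i) v v) (J v) (J (t i))) v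
        + inner ℝ (R (R (t i) v v) (J v) (J v)) (t i)))
    (Φ := fun i v ↦ inner ℝ (R (R (t i) v v) (J v) (J v)) v)
    (F' := fun v i ↦ 4 * inner ℝ (R v (J v) (J v)) (t i))
    (Φ' := fun v i ↦ inner ℝ (R (R (t i) v (t i)) (J v) (J v)) v
        + inner ℝ (R (R (t i) v v) (J (t i)) (J v)) v
        + inner ℝ (R (R (t i) v v) (J v) (J (t i))) v
        + inner ℝ (R (R (t i) v v) (J v) (J v)) (t i))
    (.inner ℝ (by fun_prop) (by fun_prop)) (fun i ↦ .inner ℝ (by fun_prop) (by fun_prop))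
    (fun v i ↦ ?_) (fun v i ↦ ?_) (fun η ↦ ?_) (fun v ↦ rfl) (by fun_prop) fun v ↦ ?_
  · have h := hasDerivAt_line v (t i)
    have hJd : HasDerivAt (fun τ : ℝ ↦ J (v + τ • t i)) _ 0 := J.hasFDerivAt.comp_hasDerivAt 0 h
    refine ((((R.hasFDerivAt.comp_hasDerivAt 0 h).clm_apply hJd).clm_apply hJd).inner ℝ
      h).congr_deriv ?_
    have a2 : inner ℝ (R v (J (t i)) (J v)) v = inner ℝ (R v (J v) (J v)) (t i) := by
      rw [hpair, hskew, inner_neg_left, ← hJ, hJ2, ← hRJ, inner_neg_right, neg_neg]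
    have a3 : inner ℝ (R v (J v) (J (t i))) v = inner ℝ (R v (J v) (J v)) (t i) := by
      rw [hskew', ← hJ, hJ2, ← hRJ, inner_neg_right, neg_neg]
    have a1 := e1 (t i) v
    simp [inner_add_left]
    linarith
  · have h := hasDerivAt_line v (t i)
    have hJd : HasDerivAt (fun τ : ℝ ↦ J (v + τ • t i)) _ 0 := J.hasFDerivAt.comp_hasDerivAt 0 h
    have hRd : HasDerivAt (fun τ : ℝ ↦ R (t i) (v + τ • t i) (v + τ • t i)) _ 0 :=
        (((R (t i)).hasFDerivAt.comp_hasDerivAt 0 h).clm_apply h)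
    refine ((((R.hasFDerivAt.comp_hasDerivAt 0 hRd).clm_apply hJd).clm_apply hJd).inner ℝ
      h).congr_deriv ?_
    simp [inner_add_left, hR]
    ring
  · have hl : IsLinearMap ℝ fun w ↦
        inner ℝ (R (R w (comb t η) (comb t η)) (J (comb t η)) (J (comb t η))) (comb t η) :=
      ⟨fun _ _ ↦ by simp [inner_add_left], fun _ _ ↦ by simp [real_inner_smul_left]⟩
    rw [sum_mul_of_isLinearMap hl, hR]
    simp
  · have hl : IsLinearMap ℝ fun w ↦ inner ℝ (R (R w v v) (J v) (J v)) v :=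
      ⟨fun _ _ ↦ by simp [inner_add_left], fun _ _ ↦ by simp [real_inner_smul_left]⟩
    simp_rw [mul_assoc]
    rw [← Finset.mul_sum, sum_inner_mul_of_isLinearMap ht hl, e1, real_inner_comm]
    exact mul_nonneg (by norm_num) (hsec _ _)

end pointwise

end RiemannianGeometry

/-! ### Differentiating fibre integrals; the Bochner argument -/

namespace RiemannianGeometry

section fibrePoly

variable {A P Q S ι : Type*} [CommRing A] [Algebra ℝ A] [AddCommGroup P] [Module A P]
  [AddCommGroup Q] [Module A Q] [AddCommGroup S] [Module A S]

/-- Functions of finitely many real variables with values in an `A`-module which are finite sums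
of continuous functions times constants. -/
inductive IsFibrePoly (A : Type*) {P ι : Type*} [CommRing A] [Algebra ℝ A] [AddCommGroup P]
    [Module A P] : ((ι → ℝ) → P) → Prop
  | mono (p : (ι → ℝ) → ℝ) (hp : Continuous p) (c : P) :
      IsFibrePoly A fun η ↦ algebraMap ℝ A (p η) • c
  | add {u v : (ι → ℝ) → P} (hu : IsFibrePoly A u) (hv : IsFibrePoly A v) :
      IsFibrePoly A fun η ↦ u η + v η

namespace IsFibrePoly

theorem zero : IsFibrePoly A fun _ : ι → ℝ ↦ (0 : P) := by
  simpa using mono (A := A) (ι := ι) (fun _ ↦ 0) continuous_const (0 : P)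

theorem sum {κ : Type*} (t : Finset κ) {u : κ → (ι → ℝ) → P} (hu : ∀ i, IsFibrePoly A (u i)) :
    IsFibrePoly A fun η ↦ ∑ i ∈ t, u i η := by
  classical
  induction t using Finset.induction_on with
  | empty => simpa using zero
  | insert i t hi ih => simpa [Finset.sum_insert hi] using add (hu i) ih

theorem map {u : (ι → ℝ) → P} (hu : IsFibrePoly A u) (B : P →ₗ[A] Q) :
    IsFibrePoly A fun η ↦ B (u η) := by
  induction hu with
  | mono p hp c => simpa using mono p hp (B c)
  | add _ _ hu hv => simpa using add hu hv

theorem smul {u : (ι → ℝ) → P} (hu : IsFibrePoly A u) {p : (ι → ℝ) → ℝ} (hp : Continuous p) :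
    IsFibrePoly A fun η ↦ algebraMap ℝ A (p η) • u η := by
  induction hu with
  | mono q hq c => simpa [smul_smul] using mono (A := A) _ (hp.mul hq) c
  | add _ _ hu hv => simpa using add hu hv

theorem map₂ {u : (ι → ℝ) → P} {v : (ι → ℝ) → Q} (hu : IsFibrePoly A u) (hv : IsFibrePoly A v)
    (B : P →ₗ[A] Q →ₗ[A] S) : IsFibrePoly A fun η ↦ B (u η) (v η) := by
  induction hu with
  | mono p hp c =>
    simpa using (hv.map (B c)).smul hp
  | add _ _ hu hv => simpa using add hu hv

theorem mul {u v : (ι → ℝ) → A} (hu : IsFibrePoly A u) (hv : IsFibrePoly A v) :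
    IsFibrePoly A fun η ↦ u η * v η :=
  hu.map₂ hv (LinearMap.mul A A)

end IsFibrePoly

end fibrePoly

section manifold

variable {E : Type*} [NormedAddCommGroup E] [NormedSpace ℝ E]
  {M : Type*} [TopologicalSpace M] [ChartedSpace E M] [IsManifold 𝓘(ℝ, E) ∞ M]
  {ι : Type*} [Fintype ι]

namespace IsFibrePoly

variable {u v : (ι → ℝ) → SF E M} (hu : IsFibrePoly (SF E M) u)
include hu

theorem continuous_apply (x : M) : Continuous fun η ↦ u η x := by
  induction hu with
  | mono p hp c => exact hp.mul continuous_const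
  | add _ _ hu hv => exact hu.add hv

theorem derivVF (X : VF E M) : IsFibrePoly (SF E M) fun η ↦ derivVF X (u η) := by
  induction hu with
  | mono p hp c =>
    simpa [derivVF_mul, derivVF_algebraMap] using mono (A := SF E M) p hp (RiemannianGeometry.derivVF X c)
  | add _ _ hu hv => simpa using add hu hv

/-- For a finite sum of terms p(η)c the integral acts on the scalar factors p alone. Smoothness in x
and differentiation under the integral sign are therefore formal. -/
theorem exists_integral : ∃ a : SF E M, (∀ x, a x = ∫ η, weight η * u η x) ∧
    ∀ X x, RiemannianGeometry.derivVF X a x =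
      ∫ η, weight η * RiemannianGeometry.derivVF X (u η) x := by
  induction hu with
  | mono p hp c =>
    refine ⟨algebraMap ℝ _ (∫ η, weight η * p η) * c, fun x ↦ ?_, fun X x ↦ ?_⟩
    · change (∫ η, weight η * p η) * c x = ∫ η, weight η * (p η * c x)
      rw [← integral_mul_const]
      exact integral_congr_ae (.of_forall fun η ↦ mul_assoc _ _ _)
    · simp only [smul_eq_mul, derivVF_mul, derivVF_algebraMap, zero_mul, zero_add]
      change (∫ η, weight η * p η) * RiemannianGeometry.derivVF X c x =
        ∫ η, weight η * (p η * RiemannianGeometry.derivVF X c x)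
      rw [← integral_mul_const]
      exact integral_congr_ae (.of_forall fun η ↦ mul_assoc _ _ _)
  | @add u v hu' hv' hu hv =>
    obtain ⟨a, ha, ha'⟩ := hu
    obtain ⟨b, hb, hb'⟩ := hv
    refine ⟨a + b, fun x ↦ ?_, fun X x ↦ ?_⟩
    · change a x + b x = ∫ η, weight η * (u η x + v η x)
      rw [ha, hb, ← integral_add (integrable_weight_mul (hu'.continuous_apply x))
        (integrable_weight_mul (hv'.continuous_apply x))]
      simp only [mul_add]
    · simp only [map_add]
      change RiemannianGeometry.derivVF X a x + RiemannianGeometry.derivVF X b x =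
        ∫ η, weight η * (RiemannianGeometry.derivVF X (u η) x + RiemannianGeometry.derivVF X (v η) x)
      rw [ha', hb', ← integral_add (integrable_weight_mul ((hu'.derivVF X).continuous_apply x))
        (integrable_weight_mul ((hv'.derivVF X).continuous_apply x))]
      simp only [mul_add]

end IsFibrePoly

/-- The vector field with constant coordinates `η` in the frame `s`. -/
def combVF (s : ι → VF E M) (η : ι → ℝ) : VF E M := ∑ i, algebraMap ℝ (SF E M) (η i) • s i

theorem isFibrePoly_combVF (s : ι → VF E M) : IsFibrePoly (SF E M) (combVF s) :=
  .sum _ fun i ↦ .mono _ (_root_.continuous_apply i) (s i)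

variable [RiemannianBundle (fun x : M ↦ TangentSpace 𝓘(ℝ, E) x)]
  [IsContMDiffRiemannianBundle 𝓘(ℝ, E) ∞ E (fun x : M ↦ TangentSpace 𝓘(ℝ, E) x)]
  [FiniteDimensional ℝ E]

theorem combVF_apply (s : ι → VF E M) (η : ι → ℝ) (x : M) :
    combVF s η x = comb (fun i ↦ s i x) η := by
  rw [combVF, sum_VF_apply, comb_apply]; rfl

variable {n : ℕ} {s : Fin n → VF E M} (hs : IsParsevalFrame s)

/-- `F'` is the covariant derivative of the fibrewise function `F` in the direction `X`. -/
def HasCov (X : VF E M) (F F' : VF E M → SF E M) : Prop :=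
  ∀ x, ∃ G : TangentSpace 𝓘(ℝ, E) x → ℝ, ContDiff ℝ 1 G ∧ (∀ V, F V x = G (V x)) ∧
    ∀ V, derivVF X (F V) x = F' V x + fderiv ℝ G (V x) (nabVF hs X V x)

variable {hs}

theorem HasCov.mul {X : VF E M} {F F' H H' : VF E M → SF E M} (hF : HasCov hs X F F')
    (hH : HasCov hs X H H') :
    HasCov hs X (fun V ↦ F V * H V) fun V ↦ F' V * H V + F V * H' V := by
  intro x
  obtain ⟨G, hG, hG1, hG2⟩ := hF x
  obtain ⟨L, hL, hL1, hL2⟩ := hH x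
  refine ⟨fun v ↦ G v * L v, hG.mul hL, fun V ↦ ?_, fun V ↦ ?_⟩
  · change F V x * H V x = _
    rw [hG1, hL1]
  · rw [derivVF_mul, fderiv_fun_mul (hG.differentiable one_ne_zero _)
      (hL.differentiable one_ne_zero _)]
    change derivVF X (F V) x * H V x + F V x * derivVF X (H V) x =
      F' V x * H V x + F V x * H' V x + (G (V x) * fderiv ℝ L (V x) (nabVF hs X V x) +
        L (V x) * fderiv ℝ G (V x) (nabVF hs X V x))
    rw [hG2, hL2, hG1, hL1]
    ring

theorem HasCov.add {X : VF E M} {F F' H H' : VF E M → SF E M} (hF : HasCov hs X F F')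
    (hH : HasCov hs X H H') : HasCov hs X (fun V ↦ F V + H V) fun V ↦ F' V + H' V := by
  intro x
  obtain ⟨G, hG, hG1, hG2⟩ := hF x
  obtain ⟨L, hL, hL1, hL2⟩ := hH x
  refine ⟨fun v ↦ G v + L v, hG.add hL, fun V ↦ ?_, fun V ↦ ?_⟩
  · change F V x + H V x = _
    rw [hG1, hL1]
  · rw [map_add, fderiv_fun_add (hG.differentiable one_ne_zero _)
      (hL.differentiable one_ne_zero _)]
    change derivVF X (F V) x + derivVF X (H V) x = F' V x + H' V x +
      (fderiv ℝ G (V x) (nabVF hs X V x) + fderiv ℝ L (V x) (nabVF hs X V x))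
    rw [hG2, hL2]
    ring

theorem nabVF_combVF (X : VF E M) (η : Fin n → ℝ) (x : M) :
    nabVF hs X (combVF s η) x = comb (fun i ↦ nabVF hs X (s i) x) η := by
  rw [combVF, map_sum, sum_VF_apply, comb_apply]
  refine Finset.sum_congr rfl fun i _ ↦ ?_
  have h := leviCivita_smul_right (algebraMap ℝ (SF E M) (η i)) (s i) x (X x)
  have h2 : d% (⇑(algebraMap ℝ (SF E M) (η i))) x (X x) = 0 :=
    congrArg (fun f : SF E M ↦ f x) (derivVF_algebraMap X (η i))
  rw [h2, zero_smul, zero_add] at h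
  exact h

/-- The extension of a tangent vector to a vector field by means of a Parseval frame. -/
def extVF (s : Fin n → VF E M) {x : M} (v : TangentSpace 𝓘(ℝ, E) x) : VF E M :=
  combVF s fun i ↦ inner ℝ v (s i x)

theorem extVF_apply_self (hs : IsParsevalFrame s) {x : M} (v : TangentSpace 𝓘(ℝ, E) x) : extVF s v x = v := by
  rw [extVF, combVF_apply, comb_apply]; exact hs x v

variable {J : Π x : M, TangentSpace 𝓘(ℝ, E) x →L[ℝ] TangentSpace 𝓘(ℝ, E) x} (hJ : IsKahler J)
include hJ

/-- The derivative of F(V) consists of the covariant derivative F' and a fibre derivative along ∇_X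
V. The latter integrates to zero, because the fields ∇_X s_i satisfy the differentiated Parseval
identity `parseval_nab`. -/
theorem HasCov.derivVF_integral {X : VF E M} {F F' : VF E M → SF E M} (hF : HasCov hs X F F')
    (hu' : IsFibrePoly (SF E M) fun η ↦ F' (combVF s η)) {x : M} :
    ∫ η, weight η * derivVF X (F (combVF s η)) x = ∫ η, weight η * F' (combVF s η) x := by
  obtain ⟨G, hG, hG1, hG2⟩ := hF x
  have key := integral_fderiv_comb_eq_zero (t := fun i ↦ s i x)
    (ξ := fun i ↦ nabVF hs X (s i) x) (hs x) (fun Y Z ↦ by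
      have h := congrArg (fun f : SF E M ↦ f x)
        ((kahlerAlgebra hJ hs).parseval_nab X (extVF s Y) (extVF s Z))
      simp only [sum_SF_apply] at h
      conv_lhs at h =>
        enter [2, i]
        change inner ℝ (extVF s Y x) (nabVF hs X (s i) x) * inner ℝ (s i x) (extVF s Z x) +
          inner ℝ (extVF s Y x) (s i x) * inner ℝ (nabVF hs X (s i) x) (extVF s Z x)
      simp only [extVF_apply_self hs] at h
      exact h) hG
  have hc : Continuous fun η : Fin n → ℝ ↦ fderiv ℝ G (comb (fun i ↦ s i x) η)
      (comb (fun i ↦ nabVF hs X (s i) x) η) :=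
    ((hG.continuous_fderiv one_ne_zero).comp (comb _).continuous).clm_apply (comb _).continuous
  rw [← add_zero (∫ η, weight η * F' (combVF s η) x), ← key,
    ← integral_add (integrable_weight_mul (hu'.continuous_apply x)) (integrable_weight_mul hc)]
  simp_rw [hG2, combVF_apply, nabVF_combVF, mul_add]

/-- The Bochner argument on fibre integrals. -/
theorem eq_zero_of_bochner [T2Space M] [CompactSpace M] {F S₀ : VF E M → SF E M}
    {S T : Fin n → VF E M → SF E M} {Z : VF E M}
    (hF : ∀ i, HasCov hs (s i) F (S i)) (hS : ∀ i, HasCov hs (s i) (S i) (T i))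
    (hZ : HasCov hs Z F S₀) (pF : IsFibrePoly (SF E M) fun η ↦ F (combVF s η))
    (pS : ∀ i, IsFibrePoly (SF E M) fun η ↦ S i (combVF s η))
    (pT : ∀ i, IsFibrePoly (SF E M) fun η ↦ T i (combVF s η))
    (pZ : IsFibrePoly (SF E M) fun η ↦ S₀ (combVF s η))
    (hpos : ∀ x, 0 ≤ ∫ η, weight η *
      (F (combVF s η) * (∑ i, T i (combVF s η) - S₀ (combVF s η))) x)
    (i : Fin n) (x : M) {η : Fin n → ℝ} (hη : ∑ i, η i ^ 2 < 1) : S i (combVF s η) x = 0 := by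
  -- N is the fibrewise squared L² norm of F, to which the maximum principle is applied.
  obtain ⟨N, hN, hN'⟩ := (pF.mul pF).exists_integral
  have d1 (i : Fin n) := (hF i).mul (hF i)
  have p1 (i : Fin n) := ((pS i).mul pF).add (pF.mul (pS i))
  have d2 (i : Fin n) := ((hS i).mul (hF i)).add ((hF i).mul (hS i))
  have p2 (i : Fin n) := (((pT i).mul pF).add ((pS i).mul (pS i))).add
    (((pS i).mul (pS i)).add (pF.mul (pT i)))
  have p0 := (pZ.mul pF).add (pF.mul pZ)
  have hDZ (x : M) : derivVF Z N x = ∫ η, weight η *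
      (S₀ (combVF s η) * F (combVF s η) + F (combVF s η) * S₀ (combVF s η)) x := by
    rw [hN', (hZ.mul hZ).derivVF_integral hJ p0]
  have hDD (i : Fin n) (x : M) : derivVF (s i) (derivVF (s i) N) x = ∫ η, weight η *
      ((T i (combVF s η) * F (combVF s η) + S i (combVF s η) * S i (combVF s η)) +
        (S i (combVF s η) * S i (combVF s η) + F (combVF s η) * T i (combVF s η))) x := by
    obtain ⟨b, hb, hb'⟩ := (p1 i).exists_integral
    have e : derivVF (s i) N = b := by
      ext x; rw [hN', (d1 i).derivVF_integral hJ (p1 i), hb]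
    rw [e, hb', (d2 i).derivVF_integral hJ (p2 i)]
  have ci (i : Fin n) (x : M) := integrable_weight_mul (((pS i).mul (pS i)).continuous_apply x)
  have cF (x : M) : Integrable fun η ↦ weight η *
      (F (combVF s η) * (∑ i, T i (combVF s η) - S₀ (combVF s η))) x := by
    refine integrable_weight_mul ((pF.continuous_apply x).mul ?_)
    have h : Continuous fun η ↦ ∑ i, T i (combVF s η) x - S₀ (combVF s η) x :=
      (continuous_finsetSum _ fun i _ ↦ (pT i).continuous_apply x).sub (pZ.continuous_apply x)
    refine h.congr fun η ↦ ?_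
    rw [← sum_SF_apply]; rfl
  -- The Bochner identity ½ΔN = ∫ |∇F|² + ∫ F ΔF; both integrals are non-negative.
  have hlap (x : M) : lapVF s Z N x = 2 * ∑ i, (∫ η, weight η *
      (S i (combVF s η) * S i (combVF s η)) x) + 2 * ∫ η, weight η *
      (F (combVF s η) * (∑ i, T i (combVF s η) - S₀ (combVF s η))) x := by
    rw [lapVF_apply]
    change (∑ i, derivVF (s i) (derivVF (s i) N)) x - derivVF Z N x = _
    simp_rw [sum_SF_apply, hDD, hDZ]
    rw [← integral_finsetSum _ fun i _ ↦ integrable_weight_mul ((p2 i).continuous_apply x),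
      ← integral_finsetSum _ fun i _ ↦ ci i x, ← integral_sub
        (integrable_finsetSum _ fun i _ ↦ integrable_weight_mul ((p2 i).continuous_apply x))
        (integrable_weight_mul (p0.continuous_apply x)), ← mul_add, ← integral_add
        (integrable_finsetSum _ fun i _ ↦ ci i x) (cF x), ← integral_const_mul]
    refine integral_congr_ae (.of_forall fun η ↦ ?_)
    change ∑ i, weight η * ((T i (combVF s η) x * F (combVF s η) x +
        S i (combVF s η) x * S i (combVF s η) x) + (S i (combVF s η) x * S i (combVF s η) x +
        F (combVF s η) x * T i (combVF s η) x)) - weight η * (S₀ (combVF s η) x * F (combVF s η) x +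
        F (combVF s η) x * S₀ (combVF s η) x) =
      2 * (∑ i, weight η * (S i (combVF s η) x * S i (combVF s η) x) + weight η *
        (F (combVF s η) x * ((∑ i, T i (combVF s η)) x - S₀ (combVF s η) x)))
    rw [sum_SF_apply]
    simp only [← Finset.mul_sum, Finset.sum_add_distrib, ← Finset.sum_mul]
    ring
  have hsq (i : Fin n) (x : M) : 0 ≤ ∫ η, weight η * (S i (combVF s η) * S i (combVF s η)) x :=
    integral_nonneg fun η ↦ mul_nonneg (weight_nonneg η) (mul_self_nonneg (S i (combVF s η) x))
  have hspan (x : M) (v : TangentSpace 𝓘(ℝ, E) x) :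
      v ∈ Submodule.span ℝ (Set.range fun i ↦ s i x) := by
    rw [← hs x v]
    exact Submodule.sum_mem _ fun i _ ↦
      Submodule.smul_mem _ _ (Submodule.subset_span ⟨i, rfl⟩)
  have hD := derivVF_eq_zero_of_lapVF_nonneg Z hspan (f := N) fun x ↦ by
    rw [hlap]
    have := Finset.sum_nonneg fun i (_ : i ∈ Finset.univ) ↦ hsq i x
    have := hpos x
    positivity
  -- All first derivatives of N vanish, hence ΔN = 0, and each non-negative term of the Bochner
  -- identity is zero.
  have hl0 : lapVF s Z N x = 0 := by
    rw [lapVF_apply]; simp [hD]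
  rw [hlap] at hl0
  have h1 := Finset.single_le_sum (fun i _ ↦ hsq i x) (Finset.mem_univ i)
  have h2 : ∫ η, weight η * (S i (combVF s η) x) ^ 2 = 0 := by
    refine le_antisymm ?_ (integral_nonneg fun η ↦ mul_nonneg (weight_nonneg η) (sq_nonneg _))
    simp_rw [sq]
    have := hpos x
    change ∫ η, weight η * (S i (combVF s η) * S i (combVF s η)) x ≤ 0
    linarith
  exact eq_zero_of_integral_weight_mul_sq ((pS i).continuous_apply x) h2 hη

end manifold

end RiemannianGeometry

/-! ### Tensors at a point and covariant derivatives of fibre functions -/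

namespace RiemannianGeometry

section pointwise

variable {E : Type*} [NormedAddCommGroup E] [NormedSpace ℝ E]
  {M : Type*} [TopologicalSpace M] [ChartedSpace E M] [IsManifold 𝓘(ℝ, E) ∞ M]
  [RiemannianBundle (fun x : M ↦ TangentSpace 𝓘(ℝ, E) x)]
  [IsContMDiffRiemannianBundle 𝓘(ℝ, E) ∞ E (fun x : M ↦ TangentSpace 𝓘(ℝ, E) x)]
  [FiniteDimensional ℝ E] {n : ℕ} {s : Fin n → VF E M} (hs : IsParsevalFrame s)

include hs in
/-- Linear maps of modules of vector fields are local. -/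
theorem linearMap_apply_congr (T : VF E M →ₗ[SF E M] VF E M) {U V : VF E M} {x : M}
    (h : U x = V x) : T U x = T V x := by
  rw [← sum_innerVF_smul hs U, ← sum_innerVF_smul hs V]
  simp [h]

include hs in
theorem linearMap_apply_extVF (T : VF E M →ₗ[SF E M] VF E M) (V : VF E M) (x : M) :
    T (extVF s (V x)) x = T V x :=
  linearMap_apply_congr hs T (extVF_apply_self hs _)

include hs in
theorem linearMap_extVF_add (T : VF E M →ₗ[SF E M] VF E M) {x : M}
    (u v : TangentSpace 𝓘(ℝ, E) x) :
    T (extVF s (u + v)) x = T (extVF s u) x + T (extVF s v) x := by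
  rw [linearMap_apply_congr hs T (V := extVF s u + extVF s v), map_add]; rfl
  change _ = extVF s u x + extVF s v x
  simp only [extVF_apply_self hs]

include hs in
theorem linearMap_extVF_smul (T : VF E M →ₗ[SF E M] VF E M) {x : M} (c : ℝ)
    (u : TangentSpace 𝓘(ℝ, E) x) : T (extVF s (c • u)) x = c • T (extVF s u) x := by
  rw [linearMap_apply_congr hs T (V := algebraMap ℝ (SF E M) c • extVF s u), map_smul]; rfl
  change _ = c • extVF s u x
  simp only [extVF_apply_self hs]

/-- The value at a point of a tensorial endomorphism. -/
def endAt (T : VF E M →ₗ[SF E M] VF E M) (x : M) :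
    TangentSpace 𝓘(ℝ, E) x →L[ℝ] TangentSpace 𝓘(ℝ, E) x :=
  LinearMap.toContinuousLinearMap
    { toFun := fun u ↦ T (extVF s u) x
      map_add' := linearMap_extVF_add hs T
      map_smul' := linearMap_extVF_smul hs T }

theorem endAt_apply (T : VF E M →ₗ[SF E M] VF E M) (x : M) (u : TangentSpace 𝓘(ℝ, E) x) :
    endAt hs T x u = T (extVF s u) x := rfl

theorem endAt_apply_self (T : VF E M →ₗ[SF E M] VF E M) (x : M) (V : VF E M) :
    endAt hs T x (V x) = T V x := linearMap_apply_extVF hs T V x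

/-- The value at a point of a tensorial trilinear map. -/
def triAt (T : VF E M →ₗ[SF E M] VF E M →ₗ[SF E M] VF E M →ₗ[SF E M] VF E M) (x : M) :
    TangentSpace 𝓘(ℝ, E) x →L[ℝ] TangentSpace 𝓘(ℝ, E) x →L[ℝ]
      TangentSpace 𝓘(ℝ, E) x →L[ℝ] TangentSpace 𝓘(ℝ, E) x :=
  LinearMap.toContinuousLinearMap
    { toFun := fun u ↦ LinearMap.toContinuousLinearMap
        { toFun := fun v ↦ endAt hs (T (extVF s u) (extVF s v)) x
          map_add' := fun v v' ↦ by
            ext w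
            exact linearMap_extVF_add hs ((T (extVF s u)).flip (extVF s w)) v v'
          map_smul' := fun c v ↦ by
            ext w
            exact linearMap_extVF_smul hs ((T (extVF s u)).flip (extVF s w)) c v }
      map_add' := fun u u' ↦ by
        ext v w
        exact linearMap_extVF_add hs ((T.flip (extVF s v)).flip (extVF s w)) u u'
      map_smul' := fun c u ↦ by
        ext v w
        exact linearMap_extVF_smul hs ((T.flip (extVF s v)).flip (extVF s w)) c u }

variable (T : VF E M →ₗ[SF E M] VF E M →ₗ[SF E M] VF E M →ₗ[SF E M] VF E M)

theorem triAt_apply (x : M) (u v w : TangentSpace 𝓘(ℝ, E) x) :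
    triAt hs T x u v w = T (extVF s u) (extVF s v) (extVF s w) x := rfl

theorem triAt_apply_self (x : M) (U V W : VF E M) :
    triAt hs T x (U x) (V x) (W x) = T U V W x := by
  rw [triAt_apply, linearMap_apply_extVF hs]
  exact (linearMap_apply_extVF hs ((T (extVF s (U x))).flip W) V x).trans
    (linearMap_apply_extVF hs ((T.flip V).flip W) U x)

theorem fderiv_eq_of_hasDerivAt {W : Type*} [NormedAddCommGroup W] [NormedSpace ℝ W] {G : W → ℝ}
    (hG : ContDiff ℝ 1 G) {v u : W} {d : ℝ} (hd : HasDerivAt (fun τ : ℝ ↦ G (v + τ • u)) d 0) :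
    fderiv ℝ G v u = d :=
  ((hG.differentiable one_ne_zero v).hasFDerivAt.hasLineDerivAt u).unique hd

/-- By metric compatibility, the terms in which ∇_X V replaces one V form the fibre derivative of
the quadratic form; the rest is the form of ∇_X T. -/
theorem hasCov_quadratic (T : VF E M →ₗ[SF E M] VF E M) (X : VF E M) :
    HasCov hs X (fun V ↦ innerVF (T V) V)
      fun V ↦ innerVF (nabVF hs X (T V) - T (nabVF hs X V)) V := by
  intro x
  have hG : ContDiff ℝ 1 fun v ↦ inner ℝ (endAt hs T x v) v :=
    .inner ℝ (by fun_prop) (by fun_prop)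
  refine ⟨_, hG, fun V ↦ ?_, fun V ↦ ?_⟩
  · simp only [endAt_apply_self]; rfl
  · have h := hasDerivAt_line (V x) (nabVF hs X V x)
    have h1 : HasDerivAt (fun τ : ℝ ↦ endAt hs T x (V x + τ • nabVF hs X V x)) _ 0 :=
      (endAt hs T x).hasFDerivAt.comp_hasDerivAt 0 h
    rw [fderiv_eq_of_hasDerivAt hG (h1.inner ℝ h)]
    have hm : derivVF X (innerVF (T V) V) x = inner ℝ (nabVF hs X (T V) x) (V x) +
        inner ℝ (T V x) (nabVF hs X V x) :=
      leviCivita_metric X.mdifferentiableAt (T V).mdifferentiableAt V.mdifferentiableAt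
    rw [hm]
    change _ = inner ℝ (nabVF hs X (T V) x - T (nabVF hs X V) x) (V x) + _
    simp only [zero_smul, add_zero, endAt_apply_self, inner_sub_left]
    ring

variable {J : Π x : M, TangentSpace 𝓘(ℝ, E) x →L[ℝ] TangentSpace 𝓘(ℝ, E) x} (hJ : IsKahler J)

theorem hasCov_quartic (X : VF E M) :
    HasCov hs X (fun V ↦ innerVF (T V (complexVF hJ V) (complexVF hJ V)) V)
      fun V ↦ innerVF (nabVF hs X (T V (complexVF hJ V) (complexVF hJ V))
        - T (nabVF hs X V) (complexVF hJ V) (complexVF hJ V)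
        - T V (nabVF hs X (complexVF hJ V)) (complexVF hJ V)
        - T V (complexVF hJ V) (nabVF hs X (complexVF hJ V))) V := by
  intro x
  have hG : ContDiff ℝ 1 fun v ↦ inner ℝ (triAt hs T x v (J x v) (J x v)) v :=
    .inner ℝ (by fun_prop) (by fun_prop)
  refine ⟨_, hG, fun V ↦ ?_, fun V ↦ ?_⟩
  · rw [← complexVF_apply hJ, triAt_apply_self]; rfl
  · set JV := complexVF hJ V with hJV
    have hnJ : nabVF hs X JV = complexVF hJ (nabVF hs X V) := (kahlerAlgebra hJ hs).nab_J X V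
    have h := hasDerivAt_line (V x) (nabVF hs X V x)
    have hJd : HasDerivAt (fun τ : ℝ ↦ J x (V x + τ • nabVF hs X V x)) _ 0 :=
      (J x).hasFDerivAt.comp_hasDerivAt 0 h
    rw [fderiv_eq_of_hasDerivAt hG (((((triAt hs T x).hasFDerivAt.comp_hasDerivAt 0 h).clm_apply
      hJd).clm_apply hJd).inner ℝ h)]
    have hm : derivVF X (innerVF (T V JV JV) V) x = inner ℝ (nabVF hs X (T V JV JV) x) (V x) +
        inner ℝ (T V JV JV x) (nabVF hs X V x) :=
      leviCivita_metric X.mdifferentiableAt (T V JV JV).mdifferentiableAt V.mdifferentiableAt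
    rw [hm]
    change _ = inner ℝ (nabVF hs X (T V JV JV) x - T (nabVF hs X V) JV JV x
      - T V (nabVF hs X JV) JV x - T V JV (nabVF hs X JV) x) (V x) + _
    rw [hnJ]
    simp only [← triAt_apply_self hs, complexVF_apply, hJV]
    simp only [zero_smul, add_zero, inner_sub_left, inner_add_left, add_apply]
    ring

end pointwise

end RiemannianGeometry

/-! ### Constant scalar curvature implies parallel Ricci tensor -/

namespace RiemannianGeometry

open KahlerAlgebra

variable {E : Type*} [NormedAddCommGroup E] [NormedSpace ℝ E]
  {M : Type*} [TopologicalSpace M] [ChartedSpace E M] [IsManifold 𝓘(ℝ, E) ∞ M]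
  [RiemannianBundle (fun x : M ↦ TangentSpace 𝓘(ℝ, E) x)]
  [IsContMDiffRiemannianBundle 𝓘(ℝ, E) ∞ E (fun x : M ↦ TangentSpace 𝓘(ℝ, E) x)]
  [FiniteDimensional ℝ E] {n : ℕ} {s : Fin n → VF E M} (hs : IsParsevalFrame s)

include hs in
/-- A homogeneous function which vanishes on vectors with small coordinates vanishes. -/
theorem eq_zero_of_homogeneous {P : VF E M → SF E M} {x : M} {k : ℕ}
    (hloc : ∀ U V : VF E M, U x = V x → P U x = P V x)
    (hhom : ∀ (c : ℝ) V, P (algebraMap ℝ (SF E M) c • V) x = c ^ k * P V x)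
    (h : ∀ η : Fin n → ℝ, ∑ i, η i ^ 2 < 1 → P (combVF s η) x = 0) (V : VF E M) : P V x = 0 := by
  set η : Fin n → ℝ := fun i ↦ inner ℝ (V x) (s i x) with hη
  have hV : combVF s η x = V x := extVF_apply_self hs (V x)
  set r : ℝ := ∑ i, η i ^ 2 with hr
  have hr0 : 0 ≤ r := Finset.sum_nonneg fun i _ ↦ sq_nonneg _
  -- Rescaling by c gives squared length r/(1+r)² < 1.
  set c : ℝ := (1 + r)⁻¹ with hc
  have hc0 : 0 < c := by positivity
  have hsmall : ∑ i, (c • η) i ^ 2 < 1 := by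
    have : ∑ i, (c • η) i ^ 2 = c ^ 2 * r := by
      simp [mul_pow, ← Finset.mul_sum, hr]
    rw [this, hc, inv_pow, inv_mul_lt_one₀ (by positivity)]
    nlinarith
  have h1 := h _ hsmall
  rw [hloc _ (algebraMap ℝ (SF E M) c • V) (by
    rw [combVF_apply, map_smul, ← combVF_apply, hV]; rfl), hhom] at h1
  exact (mul_eq_zero.1 h1).resolve_left (by positivity)

theorem IsFibrePoly.sub {A P ι : Type*} [CommRing A] [Algebra ℝ A] [AddCommGroup P] [Module A P]
    {u v : (ι → ℝ) → P} (hu : IsFibrePoly A u) (hv : IsFibrePoly A v) :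
    IsFibrePoly A fun η ↦ u η - v η := by
  simpa [sub_eq_add_neg] using hu.add (hv.map (-LinearMap.id))

variable {J : Π x : M, TangentSpace 𝓘(ℝ, E) x →L[ℝ] TangentSpace 𝓘(ℝ, E) x} (hJ : IsKahler J)

include hJ in
theorem isFibrePoly_nabVF {ι : Type*} {u : (ι → ℝ) → VF E M} (hu : IsFibrePoly (SF E M) u)
    (X : VF E M) : IsFibrePoly (SF E M) fun η ↦ nabVF hs X (u η) := by
  induction hu with
  | mono p hp c =>
    have h (η : ι → ℝ) : nabVF hs X (algebraMap ℝ (SF E M) (p η) • c) =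
        algebraMap ℝ (SF E M) (p η) • nabVF hs X c := by
      have := (kahlerAlgebra hJ hs).nab_smul X (algebraMap ℝ (SF E M) (p η)) c
      change nabVF hs X _ = derivVF X _ • _ + _ • nabVF hs X c
        at this
      rw [this, derivVF_algebraMap, zero_smul, zero_add]
    simp_rw [h]
    exact .mono p hp _
  | add _ _ hu hv => simpa using hu.add hv

theorem isFibrePoly_bochnerRic (t : Fin n → VF E M) :
    IsFibrePoly (SF E M) fun η ↦ (kahlerAlgebra hJ hs).bochnerRic (combVF t η) := by
  set K := kahlerAlgebra hJ hs
  have p := isFibrePoly_combVF t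
  have h (i : Fin n) := (((p.map₂ p (K.curv (K.s i))).map K.Rc).map (K.g.flip (K.s i))).add
    ((p.map K.Rc).map₂ (p.map ((K.curv (K.s i)).flip (K.s i))) K.g)
  exact (IsFibrePoly.sum Finset.univ h).map (-LinearMap.id)

-- In the frame J s_i the vector with coordinates η is JV, so the integral inequality in this frame
-- controls Q(JV).
include hs in
theorem isParsevalFrame_complexVF : IsParsevalFrame fun i ↦ complexVF hJ (s i) := by
  intro x v
  have h (i : Fin n) : inner ℝ v (J x (s i x)) = -inner ℝ (J x v) (s i x) := by
    rw [← hJ.inner_map, hJ.sq_eq_neg, inner_neg_right]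
  simp only [complexVF_apply, h, neg_smul, Finset.sum_neg_distrib, ← map_smul, ← map_sum]
  rw [hs x, map_neg, hJ.sq_eq_neg, neg_neg]

theorem combVF_complexVF (η : Fin n → ℝ) :
    combVF (fun i ↦ complexVF hJ (s i)) η = complexVF hJ (combVF s η) := by
  simp [combVF]

theorem integral_bochnerRic_nonneg
    (hsec : ∀ (x : M) (u v : TangentSpace 𝓘(ℝ, E) x),
      0 ≤ inner ℝ (triAt hs (kahlerAlgebra hJ hs).curv x u v v) u)
    {t : Fin n → VF E M} (ht : IsParsevalFrame t) (x : M) :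
    0 ≤ ∫ η, weight η * (innerVF ((kahlerAlgebra hJ hs).Rc (combVF t η)) (combVF t η) *
      (kahlerAlgebra hJ hs).bochnerRic (combVF t η)) x := by
  set K := kahlerAlgebra hJ hs with hK
  have hRc (u v : TangentSpace 𝓘(ℝ, E) x) :
      inner ℝ (endAt hs K.Rc x u) v = inner ℝ u (endAt hs K.Rc x v) := by
    have h := congrArg (fun f : SF E M ↦ f x)
      (ricOf_symm K.isCurvLike_curv (extVF s u) (extVF s v))
    change inner ℝ (endAt hs K.Rc x u) (extVF s v x) =
      inner ℝ (extVF s u x) (endAt hs K.Rc x v) at h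
    simpa only [extVF_apply_self hs] using h
  have hR (u v : TangentSpace 𝓘(ℝ, E) x) : triAt hs K.curv x u u v = 0 := by
    rw [triAt_apply, curv_apply]
    simp
  convert integral_ricci_nonneg (t := fun i ↦ t i x) (ht x) hRc hR (hsec x) using 3 with η
  rw [← combVF_apply]
  -- The trace defining Q does not depend on the Parseval frame, so the frame `t` of integration may
  -- be used.
  have hB : K.bochnerRic (combVF t η) = -∑ i, (K.g (K.Rc (K.curv (t i) (combVF t η) (combVF t η)))
      (t i) + K.g (K.Rc (combVF t η)) (K.curv (t i) (combVF t η) (t i))) := by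
    set V := combVF t η
    have := K.trace_eq t (fun X Y ↦ by
      ext x; rw [sum_SF_apply]; exact inner_parseval (ht x) (X x) (Y x))
      (LinearMap.mk₂ _ (fun a b ↦ K.g (K.Rc (K.curv a V V)) b + K.g (K.Rc V) (K.curv a V b))
        (by intros; simp; ring) (by intros; simp; ring) (by intros; simp; ring)
        (by intros; simp; ring))
    simp only [LinearMap.mk₂_apply] at this
    rw [bochnerRic, this]
  rw [hB]
  set V := combVF t η
  congr 1
  change inner ℝ (K.Rc V x) (V x) * -((∑ i, (K.g (K.Rc (K.curv (t i) V V)) (t i) +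
    K.g (K.Rc V) (K.curv (t i) V (t i)))) x) = _
  rw [sum_SF_apply]
  simp only [triAt_apply_self, endAt_apply_self]
  rfl

theorem _root_.KahlerAlgebra.dRc_sum {A 𝔛 ι κ : Type*} [CommRing A] [Algebra ℝ A] [AddCommGroup 𝔛]
    [Module A 𝔛] [Fintype ι] (K : KahlerAlgebra A 𝔛 ι) (t : Finset κ) (f : κ → A) (X : κ → 𝔛)
    (Y : 𝔛) : K.dRc (∑ i ∈ t, f i • X i) Y = ∑ i ∈ t, f i • K.dRc (X i) Y := by
  let L : 𝔛 →ₗ[A] 𝔛 :=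
    { toFun := fun X ↦ K.dRc X Y
      map_add' := fun X X' ↦ K.dRc_add X X' Y
      map_smul' := fun f X ↦ K.dRc_smul f X Y }
  change L _ = ∑ i ∈ t, f i • L (X i)
  simp

theorem dRc_eq_zero [T2Space M] [CompactSpace M]
    (hsec : ∀ (x : M) (u v : TangentSpace 𝓘(ℝ, E) x),
      0 ≤ inner ℝ (triAt hs (kahlerAlgebra hJ hs).curv x u v v) u)
    (hscal : ∀ X, derivVF X (kahlerAlgebra hJ hs).scal = 0) (X Y : VF E M) :
    (kahlerAlgebra hJ hs).dRc X Y = 0 := by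
  set K := kahlerAlgebra hJ hs with hK
  have p := isFibrePoly_combVF s
  have hc (X : VF E M) : HasCov hs X (fun V ↦ innerVF (K.Rc V) V)
      fun V ↦ innerVF (K.dRc X V) V := by
    convert hasCov_quadratic hs K.Rc X using 4 with V
    exact K.dRc_apply X V
  have hpos (x : M) := integral_bochnerRic_nonneg hs hJ hsec hs x
  have hposJ (x : M) := integral_bochnerRic_nonneg hs hJ hsec (isParsevalFrame_complexVF hs hJ) x
  have pRc := (p.map K.Rc).map₂ p K.g
  have key (i : Fin n) (x : M) {η : Fin n → ℝ} (hη : ∑ i, η i ^ 2 < 1) :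
      innerVF (K.dRc (s i) (combVF s η)) (combVF s η) x = 0 := by
    -- With Z = ∑ ∇_{s_i} s_i, the expression ∑ ∇_{s_i}∇_{s_i} − ∇_Z is the rough Laplacian of
    -- `laplacian_ric`.
    refine eq_zero_of_bochner hJ (Z := ∑ i, K.nab (s i) (s i)) (fun i ↦ hc (s i))
      (fun i ↦ hasCov_quadratic hs (K.dRc (s i)) (s i)) (hc _) pRc
      (fun i ↦ (p.map (K.dRc (s i))).map₂ p K.g) (fun i ↦ ?_)
      ((p.map (K.dRc _)).map₂ p K.g) (fun x ↦ ?_) i x hη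
    · exact ((isFibrePoly_nabVF hs hJ (p.map (K.dRc (s i))) (s i)).sub
        ((isFibrePoly_nabVF hs hJ p (s i)).map (K.dRc (s i)))).map₂ p K.g
    · have hsum (V : VF E M) : ∑ i, innerVF (nabVF hs (s i) (K.dRc (s i) V) -
          K.dRc (s i) (nabVF hs (s i) V)) V - innerVF (K.dRc (∑ i, K.nab (s i) (s i)) V) V =
          K.bochnerRic V + K.bochnerRic (complexVF hJ V) := by
        have h1 := K.laplacian_ric hscal V
        have h2 := K.dRc_sum Finset.univ (fun _ ↦ 1) (fun i ↦ K.nab (s i) (s i)) V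
        simp only [one_smul] at h2
        rw [h2]
        refine Eq.trans ?_ h1
        simp only [map_sum, LinearMap.sum_apply]
        rw [← Finset.sum_sub_distrib]
        refine Finset.sum_congr rfl fun i _ ↦ ?_
        rw [← LinearMap.sub_apply, ← map_sub]
        change innerVF _ V = innerVF (nabVF hs (s i) (K.dRc (s i) V) -
          K.dRc (nabVF hs (s i) (s i)) V - K.dRc (s i) (nabVF hs (s i) V)) V
        rw [sub_right_comm]
        rfl
      -- F is J-invariant, so the inequality in the frame J s_i bounds ∫ F(V) Q(JV) for the same
      -- factor F(V).
      have hFJ (V : VF E M) : innerVF (K.Rc (complexVF hJ V)) (complexVF hJ V) =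
          innerVF (K.Rc V) V := by
        rw [show K.Rc (complexVF hJ V) = complexVF hJ (K.Rc V) from
          ricOf_J K.isCurvLike_curv V]
        exact K.J_iso _ _
      have h1 := add_nonneg (hpos x) (hposJ x)
      simp only [combVF_complexVF, ← hK, hFJ] at h1
      have pJ : IsFibrePoly (SF E M) fun η ↦ K.bochnerRic (complexVF hJ (combVF s η)) := by
        simpa only [combVF_complexVF] using
          isFibrePoly_bochnerRic hs hJ fun i ↦ complexVF hJ (s i)
      have i1 : Integrable fun η ↦ weight η *
          (innerVF (K.Rc (combVF s η)) (combVF s η) * K.bochnerRic (combVF s η)) x :=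
        integrable_weight_mul ((pRc.mul (isFibrePoly_bochnerRic hs hJ s)).continuous_apply x)
      have i2 : Integrable fun η ↦ weight η * (innerVF (K.Rc (combVF s η)) (combVF s η) *
          K.bochnerRic (complexVF hJ (combVF s η))) x :=
        integrable_weight_mul ((pRc.mul pJ).continuous_apply x)
      rw [← integral_add i1 i2] at h1
      refine h1.trans_eq (integral_congr_ae (.of_forall fun η ↦ ?_))
      simp only [hsum]
      rw [mul_add]
      exact (mul_add _ _ _).symm
  have hquad (i : Fin n) (x : M) (V : VF E M) : innerVF (K.dRc (s i) V) V x = 0 := by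
    refine eq_zero_of_homogeneous hs (P := fun V ↦ innerVF (K.dRc (s i) V) V) (k := 2)
      (fun U V h ↦ ?_) (fun c V ↦ ?_) (fun η hη ↦ key i x hη) V
    · change inner ℝ (K.dRc (s i) U x) (U x) = inner ℝ (K.dRc (s i) V x) (V x)
      rw [linearMap_apply_congr hs _ h, h]
    · simp only [map_smul, LinearMap.smul_apply, smul_eq_mul]
      change c * (c * _) = _
      ring
  have hbil (i : Fin n) (V W : VF E M) : innerVF (K.dRc (s i) V) W = 0 := by
    ext x
    have h1 := hquad i x (V + W)
    have h2 := hquad i x V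
    have h3 := hquad i x W
    have h4 := congrArg (fun f : SF E M ↦ f x) (K.dRc_symm (s i) V W)
    have h5 := congrArg (fun f : SF E M ↦ f x) (K.g_comm V (K.dRc (s i) W))
    simp only [map_add, LinearMap.add_apply] at h1
    change innerVF (K.dRc (s i) V) V x + innerVF (K.dRc (s i) W) V x +
      (innerVF (K.dRc (s i) V) W x + innerVF (K.dRc (s i) W) W x) = 0 at h1
    change innerVF (K.dRc (s i) V) W x = innerVF V (K.dRc (s i) W) x at h4
    change innerVF V (K.dRc (s i) W) x = innerVF (K.dRc (s i) W) V x at h5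
    change innerVF (K.dRc (s i) V) W x = 0
    linarith
  refine K.ext_g fun W ↦ ?_
  rw [← sum_innerVF_smul hs X, K.dRc_sum]
  change innerVF _ W = innerVF 0 W
  simp only [map_sum, map_smul, LinearMap.sum_apply, LinearMap.smul_apply, hbil, smul_zero,
    Finset.sum_const_zero, map_zero, LinearMap.zero_apply]

end RiemannianGeometry

/-! ### Parallel Ricci tensor implies parallel curvature -/

namespace RiemannianGeometry

open KahlerAlgebra

variable {E : Type*} [NormedAddCommGroup E] [NormedSpace ℝ E]
  {M : Type*} [TopologicalSpace M] [ChartedSpace E M] [IsManifold 𝓘(ℝ, E) ∞ M]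
  [RiemannianBundle (fun x : M ↦ TangentSpace 𝓘(ℝ, E) x)]
  [IsContMDiffRiemannianBundle 𝓘(ℝ, E) ∞ E (fun x : M ↦ TangentSpace 𝓘(ℝ, E) x)]
  [FiniteDimensional ℝ E] {n : ℕ} {s : Fin n → VF E M} (hs : IsParsevalFrame s)
  {J : Π x : M, TangentSpace 𝓘(ℝ, E) x →L[ℝ] TangentSpace 𝓘(ℝ, E) x} (hJ : IsKahler J)

theorem isFibrePoly_bochnerCurv (t : Fin n → VF E M) :
    IsFibrePoly (SF E M) fun η ↦ (kahlerAlgebra hJ hs).bochnerCurv (combVF t η) := by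
  set K := kahlerAlgebra hJ hs
  have p := isFibrePoly_combVF t
  have pJ := p.map K.J
  have tri {u v w : (Fin n → ℝ) → VF E M} (hu : IsFibrePoly (SF E M) u)
      (hv : IsFibrePoly (SF E M) v) (hw : IsFibrePoly (SF E M) w) :
      IsFibrePoly (SF E M) fun η ↦ K.curv (u η) (v η) (w η) :=
    (hu.map₂ hv K.curv).map₂ hw LinearMap.id
  have const (V : VF E M) : IsFibrePoly (SF E M) fun _ : Fin n → ℝ ↦ V := by
    simpa using IsFibrePoly.mono (A := SF E M) (fun _ : Fin n → ℝ ↦ 1) continuous_const V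
  have h (i : Fin n) := (((((tri (tri (const (K.s i)) p (const (K.s i))) pJ pJ).map₂ p K.g).add
    ((tri (tri (const (K.s i)) p p) (const (K.J (K.s i))) pJ).map₂ p K.g)).add
    ((tri (tri (const (K.s i)) p p) pJ (const (K.J (K.s i)))).map₂ p K.g))).add
    ((tri (tri (const (K.s i)) p p) pJ pJ).map₂ (const (K.s i)) K.g)
  exact (IsFibrePoly.sum Finset.univ h).map (-LinearMap.id)

theorem integral_bochnerCurv_nonneg
    (hsec : ∀ (x : M) (u v : TangentSpace 𝓘(ℝ, E) x),
      0 ≤ inner ℝ (triAt hs (kahlerAlgebra hJ hs).curv x u v v) u)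
    {t : Fin n → VF E M} (ht : IsParsevalFrame t) (x : M) :
    0 ≤ ∫ η, weight η * (innerVF ((kahlerAlgebra hJ hs).curv (combVF t η)
      (complexVF hJ (combVF t η)) (complexVF hJ (combVF t η))) (combVF t η) *
      (kahlerAlgebra hJ hs).bochnerCurv (combVF t η)) x := by
  set K := kahlerAlgebra hJ hs with hK
  have kc := K.isCurvLike_curv
  have h1 (u v w : TangentSpace 𝓘(ℝ, E) x) :
      triAt hs K.curv x u v w = -triAt hs K.curv x v u w :=
    congrArg (fun V : VF E M ↦ V x) (kc.skew (extVF s u) (extVF s v) (extVF s w))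
  have h2 (u v w z : TangentSpace 𝓘(ℝ, E) x) : inner ℝ (triAt hs K.curv x u v w) z =
      -inner ℝ (triAt hs K.curv x u v z) w := by
    have h := congrArg (fun f : SF E M ↦ f x)
      (kc.skew' (extVF s u) (extVF s v) (extVF s w) (extVF s z))
    change inner ℝ (triAt hs K.curv x u v w) (extVF s z x) =
      -inner ℝ (triAt hs K.curv x u v z) (extVF s w x) at h
    simpa only [extVF_apply_self hs] using h
  have h3 (u v w z : TangentSpace 𝓘(ℝ, E) x) : inner ℝ (triAt hs K.curv x u v w) z =
      inner ℝ (triAt hs K.curv x w z u) v := by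
    have h := congrArg (fun f : SF E M ↦ f x)
      (kc.pair (extVF s u) (extVF s v) (extVF s w) (extVF s z))
    change inner ℝ (triAt hs K.curv x u v w) (extVF s z x) =
      inner ℝ (triAt hs K.curv x w z u) (extVF s v x) at h
    simpa only [extVF_apply_self hs] using h
  have h4 (u v w : TangentSpace 𝓘(ℝ, E) x) :
      triAt hs K.curv x u v (J x w) = J x (triAt hs K.curv x u v w) := by
    have h := congrArg (fun V : VF E M ↦ V x)
      (kc.map_J (extVF s u) (extVF s v) (extVF s w))
    change K.curv (extVF s u) (extVF s v) (complexVF hJ (extVF s w)) x =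
      J x (K.curv (extVF s u) (extVF s v) (extVF s w) x) at h
    rw [← triAt_apply_self hs, ← triAt_apply_self hs, complexVF_apply] at h
    simpa only [extVF_apply_self hs] using h
  convert integral_curvature_nonneg (t := fun i ↦ t i x) (ht x) h1 h2 h3 h4 (hJ.inner_map x)
    (hJ.sq_eq_neg x) (hsec x) using 3 with η
  rw [← combVF_apply]
  set V := combVF t η
  set W := complexVF hJ V with hW
  have hB : K.bochnerCurv V = -∑ i, (K.g (K.curv (K.curv (t i) V (t i)) W W) V
    + K.g (K.curv (K.curv (t i) V V) (complexVF hJ (t i)) W) V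
    + K.g (K.curv (K.curv (t i) V V) W (complexVF hJ (t i))) V
    + K.g (K.curv (K.curv (t i) V V) W W) (t i)) := by
    have := K.trace_eq t (fun X Y ↦ by
      ext x; rw [sum_SF_apply]; exact inner_parseval (ht x) (X x) (Y x))
      (LinearMap.mk₂ _ (fun a b ↦ K.g (K.curv (K.curv a V b) W W) V
        + K.g (K.curv (K.curv a V V) (complexVF hJ b) W) V
        + K.g (K.curv (K.curv a V V) W (complexVF hJ b)) V
        + K.g (K.curv (K.curv a V V) W W) b)
        (by intros; simp; ring) (by intros; simp; ring) (by intros; simp; ring)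
        (by intros; simp; ring))
    simp only [LinearMap.mk₂_apply] at this
    rw [bochnerCurv, this]
    rfl
  rw [hB]
  congr 1
  change inner ℝ (K.curv V W W x) (V x) * -((∑ i, (K.g (K.curv (K.curv (t i) V (t i)) W W) V
    + K.g (K.curv (K.curv (t i) V V) (complexVF hJ (t i)) W) V
    + K.g (K.curv (K.curv (t i) V V) W (complexVF hJ (t i))) V
    + K.g (K.curv (K.curv (t i) V V) W W) (t i))) x) = _
  rw [sum_SF_apply]
  simp only [← complexVF_apply hJ, triAt_apply_self, ← hW]
  rfl

/-- The Bochner argument for F(V) = R(V,JV,JV,V) kills the holomorphic sectional curvature of each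
∇_{s_i} R, and `IsCurvLike.eq_zero` upgrades this to the whole tensor. -/
theorem dcurv_eq_zero [T2Space M] [CompactSpace M]
    (hsec : ∀ (x : M) (u v : TangentSpace 𝓘(ℝ, E) x),
      0 ≤ inner ℝ (triAt hs (kahlerAlgebra hJ hs).curv x u v v) u)
    (hric : ∀ X Y, (kahlerAlgebra hJ hs).dRc X Y = 0) (X Y Z W : VF E M) :
    (kahlerAlgebra hJ hs).dcurv X Y Z W = 0 := by
  set K := kahlerAlgebra hJ hs with hK
  have p := isFibrePoly_combVF s
  have pj := p.map K.J
  have tri (T : VF E M →ₗ[SF E M] VF E M →ₗ[SF E M] VF E M →ₗ[SF E M] VF E M)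
      {u v w : (Fin n → ℝ) → VF E M} (hu : IsFibrePoly (SF E M) u)
      (hv : IsFibrePoly (SF E M) v) (hw : IsFibrePoly (SF E M) w) :
      IsFibrePoly (SF E M) fun η ↦ T (u η) (v η) (w η) :=
    (hu.map₂ hv T).map₂ hw LinearMap.id
  have hc (X : VF E M) : HasCov hs X
      (fun V ↦ innerVF (K.curv V (complexVF hJ V) (complexVF hJ V)) V)
      fun V ↦ innerVF (K.dcurv X V (complexVF hJ V) (complexVF hJ V)) V :=
    hasCov_quartic hs K.curv hJ X
  have hpos (x : M) := integral_bochnerCurv_nonneg hs hJ hsec hs x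
  have hposJ (x : M) := integral_bochnerCurv_nonneg hs hJ hsec (isParsevalFrame_complexVF hs hJ) x
  have pF := (tri K.curv p pj pj).map₂ p K.g
  have key (i : Fin n) (x : M) {η : Fin n → ℝ} (hη : ∑ i, η i ^ 2 < 1) :
      innerVF (K.dcurv (s i) (combVF s η) (complexVF hJ (combVF s η)) (complexVF hJ (combVF s η)))
        (combVF s η) x = 0 := by
    refine eq_zero_of_bochner hJ (Z := ∑ i, K.nab (s i) (s i)) (fun i ↦ hc (s i))
      (fun i ↦ hasCov_quartic hs (K.dcurv (s i)) hJ (s i)) (hc _) pF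
      (fun i ↦ (tri (K.dcurv (s i)) p pj pj).map₂ p K.g) (fun i ↦ ?_)
      ((tri (K.dcurv _) p pj pj).map₂ p K.g) (fun x ↦ ?_) i x hη
    · have pn {u} (hu : IsFibrePoly (SF E M) u) := isFibrePoly_nabVF (ι := Fin n) hs hJ hu (s i)
      exact ((((pn (tri (K.dcurv (s i)) p pj pj)).sub (tri (K.dcurv (s i)) (pn p) pj pj)).sub
        (tri (K.dcurv (s i)) p (pn pj) pj)).sub (tri (K.dcurv (s i)) p pj (pn pj))).map₂ p K.g
    · have hsum (V : VF E M) : ∑ i, innerVF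
            (nabVF hs (s i) (K.dcurv (s i) V (complexVF hJ V) (complexVF hJ V))
            - K.dcurv (s i) (nabVF hs (s i) V) (complexVF hJ V) (complexVF hJ V)
            - K.dcurv (s i) V (nabVF hs (s i) (complexVF hJ V)) (complexVF hJ V)
            - K.dcurv (s i) V (complexVF hJ V) (nabVF hs (s i) (complexVF hJ V))) V
          - innerVF (K.dcurv (∑ i, K.nab (s i) (s i)) V (complexVF hJ V) (complexVF hJ V)) V =
          K.bochnerCurv V + K.bochnerCurv (complexVF hJ V) := by
        refine Eq.trans ?_ (K.laplacian_curv hric V)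
        simp only [map_sum, LinearMap.sum_apply]
        rw [← Finset.sum_sub_distrib]
        refine Finset.sum_congr rfl fun i _ ↦ ?_
        rw [← LinearMap.sub_apply, ← map_sub]
        change innerVF _ V = innerVF (nabVF hs (s i) (K.dcurv (s i) V (complexVF hJ V)
            (complexVF hJ V))
          - K.dcurv (nabVF hs (s i) (s i)) V (complexVF hJ V) (complexVF hJ V)
          - K.dcurv (s i) (nabVF hs (s i) V) (complexVF hJ V) (complexVF hJ V)
          - K.dcurv (s i) V (nabVF hs (s i) (complexVF hJ V)) (complexVF hJ V)
          - K.dcurv (s i) V (complexVF hJ V) (nabVF hs (s i) (complexVF hJ V))) V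
        congr 2
        change _ - K.dcurv (nabVF hs (s i) (s i)) V (complexVF hJ V) (complexVF hJ V) = _
        abel
      have hFJ (V : VF E M) : innerVF (K.curv (complexVF hJ V) (complexVF hJ (complexVF hJ V))
          (complexVF hJ (complexVF hJ V))) (complexVF hJ V) =
          innerVF (K.curv V (complexVF hJ V) (complexVF hJ V)) V := by
        have e1 : complexVF hJ (complexVF hJ V) = -V := K.J_sq V
        rw [e1, K.isCurvLike_curv.skew, K.isCurvLike_curv.neg]
        simp only [map_neg, LinearMap.neg_apply, neg_neg]
        exact (K.isCurvLike_curv.skew' _ _ _ _).symm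
      have h1 := add_nonneg (hpos x) (hposJ x)
      simp only [combVF_complexVF, ← hK, hFJ] at h1
      have pJ : IsFibrePoly (SF E M) fun η ↦ K.bochnerCurv (complexVF hJ (combVF s η)) := by
        simpa only [combVF_complexVF] using
          isFibrePoly_bochnerCurv hs hJ fun i ↦ complexVF hJ (s i)
      have i1 : Integrable fun η ↦ weight η *
          (innerVF (K.curv (combVF s η) (complexVF hJ (combVF s η)) (complexVF hJ (combVF s η)))
            (combVF s η) * K.bochnerCurv (combVF s η)) x :=
        integrable_weight_mul ((pF.mul (isFibrePoly_bochnerCurv hs hJ s)).continuous_apply x)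
      have i2 : Integrable fun η ↦ weight η *
          (innerVF (K.curv (combVF s η) (complexVF hJ (combVF s η)) (complexVF hJ (combVF s η)))
            (combVF s η) * K.bochnerCurv (complexVF hJ (combVF s η))) x :=
        integrable_weight_mul ((pF.mul pJ).continuous_apply x)
      rw [← integral_add i1 i2] at h1
      refine h1.trans_eq (integral_congr_ae (.of_forall fun η ↦ ?_))
      simp only [hsum]
      rw [mul_add]
      exact (mul_add _ _ _).symm
  have hquad (i : Fin n) (x : M) (V : VF E M) :
      innerVF (K.dcurv (s i) V (complexVF hJ V) (complexVF hJ V)) V x = 0 := by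
    refine eq_zero_of_homogeneous hs
      (P := fun V ↦ innerVF (K.dcurv (s i) V (complexVF hJ V) (complexVF hJ V)) V) (k := 4)
      (fun U V h ↦ ?_) (fun c V ↦ ?_) (fun η hη ↦ key i x hη) V
    · change inner ℝ (K.dcurv (s i) U (complexVF hJ U) (complexVF hJ U) x) (U x) =
        inner ℝ (K.dcurv (s i) V (complexVF hJ V) (complexVF hJ V) x) (V x)
      rw [← triAt_apply_self hs, ← triAt_apply_self hs]
      simp only [complexVF_apply, h]
    · simp only [map_smul, LinearMap.smul_apply, smul_eq_mul]
      change c * (c * (c * (c * _))) = _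
      ring
  have h4 (i : Fin n) (Y Z W : VF E M) : K.dcurv (s i) Y Z W = 0 := by
    refine K.ext_g fun V ↦ ?_
    rw [map_zero, LinearMap.zero_apply]
    ext x
    exact IsCurvLike.eq_zero (K.isCurvLike_dcurv (s i)) (evalSF x) (hquad i x) Y Z W V
  rw [← sum_innerVF_smul hs X]
  simp [h4]

end RiemannianGeometry

/-! ### Comparison with the curvature tensors of the statement -/

namespace RiemannianGeometry

variable {E : Type*} [NormedAddCommGroup E] [NormedSpace ℝ E]
  {M : Type*} [TopologicalSpace M] [ChartedSpace E M] [IsManifold 𝓘(ℝ, E) ∞ M]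
  [FiniteDimensional ℝ E]

theorem exists_VF_eventuallyEq_extend [T2Space M] {x : M} (u : TangentSpace 𝓘(ℝ, E) x) :
    ∃ X : VF E M, ∀ᶠ y in 𝓝 x, X y = FiberBundle.extend E u y := by
  obtain ⟨U, hU, hs⟩ := FiberBundle.exists_contMDiffOn_extend (k := ∞) 𝓘(ℝ, E) E u
  obtain ⟨V, hVU, hV, hx⟩ := mem_nhds_iff.1 hU
  obtain ⟨χ, -, hχ⟩ := ((SmoothBumpFunction.nhds_basis_tsupport (I := 𝓘(ℝ, E)) x).mem_iff).1
    (hV.mem_nhds hx)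
  refine ⟨⟨⇑χ • FiberBundle.extend E u, ContMDiffOn.smul_section_of_tsupport χ.contMDiff.contMDiffOn
    hV hχ (hs.mono hVU)⟩, ?_⟩
  filter_upwards [χ.eventuallyEq_one] with y hy
  change χ y • FiberBundle.extend E u y = _
  rw [hy]
  exact one_smul ℝ _

variable [RiemannianBundle (fun x : M ↦ TangentSpace 𝓘(ℝ, E) x)]
  [IsContMDiffRiemannianBundle 𝓘(ℝ, E) ∞ E (fun x : M ↦ TangentSpace 𝓘(ℝ, E) x)]
  {n : ℕ} {s : Fin n → VF E M} (hs : IsParsevalFrame s)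
  {J : Π x : M, TangentSpace 𝓘(ℝ, E) x →L[ℝ] TangentSpace 𝓘(ℝ, E) x} (hJ : IsKahler J)

theorem leviCivita_congr {X : VF E M} {σ : Π y : M, TangentSpace 𝓘(ℝ, E) y} {x : M}
    (h : ∀ᶠ y in 𝓝 x, X y = σ y) :
    ∀ᶠ y in 𝓝 x, leviCivita E M (⇑X) y = leviCivita E M σ y := by
  filter_upwards [eventually_eventually_nhds.2 h] with y hy
  have hX := X.mdifferentiableAt (x := y)
  refine (leviCivita E M).isCovariantDerivativeOnUniv.congr_of_eventuallyEq hX ?_ univ_mem hy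
  refine hX.congr_of_eventuallyEq ?_
  filter_upwards [hy] with z hz
  rw [hz]

/-- `curvature` uses extensions that are smooth only near x. Both ∇ and the bracket are local, so
cut-off global fields with the same germs give the same value. -/
theorem curvature_eq_triAt [T2Space M] (x : M) (u v w : TangentSpace 𝓘(ℝ, E) x) :
    curvature x u v w = triAt hs (kahlerAlgebra hJ hs).curv x u v w := by
  obtain ⟨X, hX⟩ := exists_VF_eventuallyEq_extend u
  obtain ⟨Y, hY⟩ := exists_VF_eventuallyEq_extend v
  obtain ⟨Z, hZ⟩ := exists_VF_eventuallyEq_extend w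
  have hXx : X x = u := by rw [hX.self_of_nhds, FiberBundle.extend_apply_self]
  have hYx : Y x = v := by rw [hY.self_of_nhds, FiberBundle.extend_apply_self]
  have hZx : Z x = w := by rw [hZ.self_of_nhds, FiberBundle.extend_apply_self]
  have h1 : ∀ᶠ y in 𝓝 x, nabVF hs Y Z y =
      leviCivita E M (FiberBundle.extend E w) y (FiberBundle.extend E v y) := by
    filter_upwards [leviCivita_congr hZ, hY] with y hy hy'
    rw [nabVF_apply, hy, hy']
  have h2 : ∀ᶠ y in 𝓝 x, nabVF hs X Z y =
      leviCivita E M (FiberBundle.extend E w) y (FiberBundle.extend E u y) := by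
    filter_upwards [leviCivita_congr hZ, hX] with y hy hy'
    rw [nabVF_apply, hy, hy']
  rw [curvature, ← (leviCivita_congr (σ := fun y ↦ leviCivita E M (FiberBundle.extend E w) y
      (FiberBundle.extend E v y)) h1).self_of_nhds,
    ← (leviCivita_congr (σ := fun y ↦ leviCivita E M (FiberBundle.extend E w) y
      (FiberBundle.extend E u y)) h2).self_of_nhds,
    ← (leviCivita_congr hZ).self_of_nhds, ← Filter.EventuallyEq.mlieBracket_vectorField_eq hX hY, ← hXx, ← hYx, ← hZx,
    triAt_apply_self]
  change _ = nabVF hs X (nabVF hs Y Z) x - nabVF hs Y (nabVF hs X Z) x -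
    nabVF hs (nabVF hs X Y - nabVF hs Y X) Z x
  rw [nabVF_sub_nabVF]
  rfl

variable [T2Space M]

theorem curvatureTensor_apply (x : M) (v : Fin 4 → TangentSpace 𝓘(ℝ, E) x) :
    curvatureTensor E M x v =
      inner ℝ (triAt hs (kahlerAlgebra hJ hs).curv x (v 0) (v 1) (v 2)) (v 3) := by
  rw [curvatureTensor, curvature_eq_triAt hs hJ]

theorem curvatureTensor_apply_self (x : M) (V : Fin 4 → VF E M) :
    curvatureTensor E M x (fun i ↦ V i x) =
      innerVF ((kahlerAlgebra hJ hs).curv (V 0) (V 1) (V 2)) (V 3) x := by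
  rw [curvatureTensor_apply hs hJ, triAt_apply_self]; rfl

-- An orthonormal basis is a Parseval frame, so the traces of the statement agree with those in the
-- frame `s`.
include hs in
theorem sum_stdOrthonormalBasis {x : M}
    (B : TangentSpace 𝓘(ℝ, E) x → TangentSpace 𝓘(ℝ, E) x → ℝ)
    (h1 : ∀ u u' v, B (u + u') v = B u v + B u' v) (h2 : ∀ (c : ℝ) u v, B (c • u) v = c • B u v)
    (h3 : ∀ u v v', B u (v + v') = B u v + B u v') (h4 : ∀ (c : ℝ) u v, B u (c • v) = c • B u v) :
    ∑ i, B (stdOrthonormalBasis ℝ (TangentSpace 𝓘(ℝ, E) x) i)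
      (stdOrthonormalBasis ℝ (TangentSpace 𝓘(ℝ, E) x) i) = ∑ i, B (s i x) (s i x) := by
  refine sum_eq_sum_of_parseval (fun v ↦ ?_) (hs x) (LinearMap.mk₂ ℝ B h1 h2 h3 h4)
  refine Eq.trans (Finset.sum_congr rfl fun i _ ↦ ?_) ((stdOrthonormalBasis ℝ _).sum_repr' v)
  rw [real_inner_comm]

theorem ricciTensor_apply (x : M) (v : Fin 2 → TangentSpace 𝓘(ℝ, E) x) :
    ricciTensor E M x v = inner ℝ (endAt hs (kahlerAlgebra hJ hs).Rc x (v 0)) (v 1) := by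
  set K := kahlerAlgebra hJ hs
  simp only [ricciTensor, curvatureTensor_apply hs hJ]
  have h := sum_stdOrthonormalBasis hs (x := x)
    (fun a b ↦ inner ℝ (triAt hs K.curv x a (v 0) (v 1)) b)
    (by simp [inner_add_left]) (by simp [real_inner_smul_left]) (by simp [inner_add_right])
    (by simp [real_inner_smul_right])
  refine h.trans ?_
  have h2 (i : Fin n) : inner ℝ (triAt hs K.curv x (s i x) (v 0) (v 1)) (s i x) =
      inner ℝ (K.curv (extVF s (v 0)) (s i) (s i) x) (v 1) := by
    have hk := K.isCurvLike_curv
    have e : K.g (K.curv (s i) (extVF s (v 0)) (extVF s (v 1))) (s i) =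
        K.g (K.curv (extVF s (v 0)) (s i) (s i)) (extVF s (v 1)) := by
      rw [hk.skew', hk.skew]; simp
    have := congrArg (fun f : SF E M ↦ f x) e
    change inner ℝ (K.curv (s i) (extVF s (v 0)) (extVF s (v 1)) x) (s i x) =
      inner ℝ (K.curv (extVF s (v 0)) (s i) (s i) x) (extVF s (v 1) x) at this
    rw [extVF_apply_self hs] at this
    rw [← this, ← triAt_apply_self hs, extVF_apply_self hs, extVF_apply_self hs]
  simp only [h2]
  rw [← sum_inner]
  congr 1
  rw [endAt_apply]
  exact (sum_VF_apply _ _ x).symm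

theorem ricciTensor_apply_self (x : M) (V : Fin 2 → VF E M) :
    ricciTensor E M x (fun i ↦ V i x) = innerVF ((kahlerAlgebra hJ hs).Rc (V 0)) (V 1) x := by
  rw [ricciTensor_apply hs hJ, endAt_apply_self]; rfl

theorem scalarCurvature_eq (x : M) : scalarCurvature E x = (kahlerAlgebra hJ hs).scal x := by
  set K := kahlerAlgebra hJ hs
  simp only [scalarCurvature, ricciTensor_apply hs hJ]
  have h := sum_stdOrthonormalBasis hs (x := x) (fun a b ↦ inner ℝ (endAt hs K.Rc x a) b)
    (by simp [inner_add_left]) (by simp [real_inner_smul_left]) (by simp [inner_add_right])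
    (by simp [real_inner_smul_right])
  refine h.trans ?_
  simp only [endAt_apply_self]
  exact (sum_SF_apply (E := E) Finset.univ (fun i ↦ K.g (K.Rc (s i)) (s i)) x).symm

include hs hJ in
theorem inner_triAt_nonneg (hsec : NonnegSectionalCurvature E M) (x : M)
    (u v : TangentSpace 𝓘(ℝ, E) x) :
    0 ≤ inner ℝ (triAt hs (kahlerAlgebra hJ hs).curv x u v v) u := by
  set K := kahlerAlgebra hJ hs with hK
  by_cases h : LinearIndependent ℝ ![u, v]
  · have h1 := hsec x u v h
    unfold sectionalCurvature at h1
    rw [curvatureTensor_apply hs hJ] at h1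
    -- Strict Cauchy–Schwarz for independent vectors clears the denominator of the sectional
    -- curvature. For a dependent pair the numerator is zero.
    have hpos : 0 < ‖u‖ ^ 2 * ‖v‖ ^ 2 - inner ℝ u v ^ 2 := by
      have hu : u ≠ 0 := h.ne_zero 0
      have h2 : |inner ℝ u v| < ‖u‖ * ‖v‖ := by
        refine lt_of_le_of_ne (abs_real_inner_le_norm u v) fun he ↦ ?_
        have hv : v ≠ 0 := h.ne_zero 1
        have h3 : |inner ℝ u v / (‖u‖ * ‖v‖)| = 1 := by
          rw [abs_div, he, abs_of_nonneg (by positivity), div_self (by positivity)]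
        obtain ⟨-, r, -, rfl⟩ := (abs_real_inner_div_norm_mul_norm_eq_one_iff u v).1 h3
        have := (LinearIndependent.pair_iff.1 h) r (-1) (by simp)
        simp at this
      have h4 : inner ℝ u v ^ 2 < (‖u‖ * ‖v‖) ^ 2 := sq_lt_sq' (by linarith [abs_lt.1 h2])
        (abs_lt.1 h2).2
      nlinarith
    have := mul_nonneg h1 hpos.le
    rw [div_mul_cancel₀ _ hpos.ne'] at this
    exact this
  · have hR (u v : TangentSpace 𝓘(ℝ, E) x) : triAt hs K.curv x u u v = 0 := by
      rw [triAt_apply, KahlerAlgebra.curv_apply]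
      simp
    have hR' (u v : TangentSpace 𝓘(ℝ, E) x) : inner ℝ (triAt hs K.curv x u v v) v = 0 := by
      have h := congrArg (fun f : SF E M ↦ f x)
        (K.curv_skew' (extVF s u) (extVF s v) (extVF s v) (extVF s v))
      change inner ℝ (triAt hs K.curv x u v v) (extVF s v x) =
        -inner ℝ (triAt hs K.curv x u v v) (extVF s v x) at h
      rw [extVF_apply_self hs] at h
      linarith
    refine le_of_eq ?_
    rw [LinearIndependent.pair_iff] at h
    push Not at h
    obtain ⟨a, b, hab, h0⟩ := h
    by_cases ha : a = 0
    · have hb := h0 ha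
      rw [ha, zero_smul, zero_add, smul_eq_zero] at hab
      rw [hab.resolve_left hb]
      simp
    · have hu : u = (-a⁻¹ * b) • v := by
        rw [neg_mul, neg_smul, mul_smul, ← sub_eq_zero, sub_neg_eq_add,
          ← smul_right_injective _ ha |>.eq_iff]
        simp [smul_smul, ha, hab]
      rw [hu]
      simp [hR]

end RiemannianGeometry

/-! ### Parallel tensors: reduction to global smooth fields -/

namespace RiemannianGeometry

variable {E : Type*} [NormedAddCommGroup E] [NormedSpace ℝ E]
  {M : Type*} [TopologicalSpace M] [ChartedSpace E M] [IsManifold 𝓘(ℝ, E) ∞ M]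
  [FiniteDimensional ℝ E]
  [RiemannianBundle (fun x : M ↦ TangentSpace 𝓘(ℝ, E) x)]
  [IsContMDiffRiemannianBundle 𝓘(ℝ, E) ∞ E (fun x : M ↦ TangentSpace 𝓘(ℝ, E) x)]
  {n : ℕ} {s : Fin n → VF E M} (hs : IsParsevalFrame s)
  {k : ℕ} {T : Π x : M, MultilinearMap ℝ (fun _ : Fin k ↦ TangentSpace 𝓘(ℝ, E) x) ℝ}

include hs in
/-- A tensor field which is differentiable on smooth vector fields is differentiable on
differentiable ones. -/
theorem mdifferentiableAt_tensor (hT : ∀ V : Fin k → VF E M, MDiff fun y ↦ T y fun i ↦ V i y)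
    {x : M} {Y : Fin k → Π y : M, TangentSpace 𝓘(ℝ, E) y} (hY : ∀ i, MDiffAt (T% (Y i)) x) :
    MDiffAt (fun y ↦ T y fun i ↦ Y i y) x := by
  have h (y : M) : (T y fun i ↦ Y i y) = ∑ r : Fin k → Fin n,
      (∏ i, inner ℝ (Y i y) (s (r i) y)) * T y fun i ↦ s (r i) y := by
    have h1 : (fun i ↦ Y i y) = fun i ↦ ∑ j, inner ℝ (Y i y) (s j y) • s j y :=
      funext fun i ↦ (hs y (Y i y)).symm
    conv_lhs => rw [h1]
    rw [MultilinearMap.map_sum]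
    exact Finset.sum_congr rfl fun r _ ↦ MultilinearMap.map_smul_univ _ _ _
  simp_rw [h]
  have h1 (r : Fin k → Fin n) : MDiffAt (fun y ↦ ∏ i, inner ℝ (Y i y) (s (r i) y)) x := by
    have := MDifferentiableAt.prod (t := Finset.univ) (f := fun i y ↦ inner ℝ (Y i y) (s (r i) y))
      fun i _ ↦ mdifferentiableAt_inner (hY i) ((s (r i)).mdifferentiableAt (x := x))
    simpa only [Finset.prod_fn] using this
  have := MDifferentiableAt.sum (t := Finset.univ)
    (f := fun (r : Fin k → Fin n) y ↦ (∏ i, inner ℝ (Y i y) (s (r i) y)) * T y fun i ↦ s (r i) y)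
    fun r _ ↦ (h1 r).mul (hT (fun i ↦ s (r i)) x)
  simpa only [Finset.sum_fn] using this

include hs in
/-- The covariant derivative of a tensor field is tensorial in each argument. -/
theorem tensorialAt_covDeriv (hT : ∀ V : Fin k → VF E M, MDiff fun y ↦ T y fun i ↦ V i y)
    {x : M} {Y : Fin k → Π y : M, TangentSpace 𝓘(ℝ, E) y} (hY : ∀ i, MDiffAt (T% (Y i)) x)
    (i₀ : Fin k) (v : TangentSpace 𝓘(ℝ, E) x) :
    TensorialAt 𝓘(ℝ, E) E
      (fun σ ↦ covDeriv (fun y ↦ T y) (Function.update Y i₀ σ) x v) x := by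
  have hval (σ : Π y : M, TangentSpace 𝓘(ℝ, E) y) (y : M) :
      (fun j ↦ Function.update Y i₀ σ j y) = Function.update (fun j ↦ Y j y) i₀ (σ y) := by
    ext j
    rcases eq_or_ne j i₀ with rfl | hj
    · simp
    · simp [hj]
  have hmd {σ : Π y : M, TangentSpace 𝓘(ℝ, E) y} (hσ : MDiffAt (T% σ) x) :
      MDiffAt (fun y ↦ T y (Function.update (fun j ↦ Y j y) i₀ (σ y))) x := by
    simp_rw [← hval]
    refine mdifferentiableAt_tensor hs hT fun i ↦ ?_
    rcases eq_or_ne i i₀ with rfl | hi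
    · simpa using hσ
    · simpa [hi] using hY i
  have hsum (σ : Π y : M, TangentSpace 𝓘(ℝ, E) y) :
      ∑ i, T x (Function.update (fun j ↦ Function.update Y i₀ σ j x) i
        (leviCivita E M (Function.update Y i₀ σ i) x v)) =
      T x (Function.update (fun j ↦ Y j x) i₀ (leviCivita E M σ x v)) +
      ∑ i ∈ Finset.univ.erase i₀, T x (Function.update (Function.update (fun j ↦ Y j x) i
        (leviCivita E M (Y i) x v)) i₀ (σ x)) := by
    rw [← Finset.add_sum_erase _ _ (Finset.mem_univ i₀)]
    congr 1
    · rw [hval]; simp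
    · refine Finset.sum_congr rfl fun i hi ↦ ?_
      have hi' := Finset.ne_of_mem_erase hi
      rw [hval, Function.update_of_ne hi', Function.update_comm hi'.symm]
  refine ⟨fun {f σ} hf hσ ↦ ?_, fun {σ σ'} hσ hσ' ↦ ?_⟩
  · have h1 := mvfderiv_fun_mul hf (hmd hσ)
    have h2 : leviCivita E M (f • σ) x v = d% f x v • σ x + f x • leviCivita E M σ x v := by
      rw [show leviCivita E M (f • σ) x = _ from
        (leviCivita E M).isCovariantDerivativeOnUniv.leibniz hσ hf trivial]
      simp [add_comm]
    simp only [covDeriv, hsum, h2]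
    simp only [hval, Pi.smul_apply', MultilinearMap.map_update_smul,
      MultilinearMap.map_update_add, smul_eq_mul, ← Finset.mul_sum]
    rw [h1]
    simp
    ring
  · have h1 := mvfderiv_fun_add (hmd hσ) (hmd hσ')
    have h2 : leviCivita E M (σ + σ') x v = leviCivita E M σ x v + leviCivita E M σ' x v := by
      rw [show leviCivita E M (σ + σ') x = _ from
        (leviCivita E M).isCovariantDerivativeOnUniv.add hσ hσ' trivial]
      simp
    simp only [covDeriv, hsum, h2]
    simp only [hval, Pi.add_apply, MultilinearMap.map_update_add, Finset.sum_add_distrib]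
    rw [h1]
    simp
    ring

include hs in
/-- It suffices to check on smooth vector fields that a tensor field is parallel. -/
theorem isParallel_of_smooth (hT : ∀ V : Fin k → VF E M, MDiff fun y ↦ T y fun i ↦ V i y)
    (h : ∀ (V : Fin k → VF E M) (x : M) (v : TangentSpace 𝓘(ℝ, E) x),
      covDeriv (fun y ↦ T y) (fun i ↦ V i) x v = 0) : IsParallel fun y ↦ T y := by
  intro x Y hY
  have hYd (i : Fin k) : MDiffAt (T% (Y i)) x := (hY i).mdifferentiableAt (by simp)
  refine ⟨mdifferentiableAt_tensor hs hT hYd, fun v ↦ ?_⟩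
  let V (i : Fin k) : VF E M := extVF s (Y i x)
  have hV (i : Fin k) : V i x = Y i x := extVF_apply_self hs _
  -- The arguments Y_i are exchanged one at a time for global smooth fields with the same value at
  -- x; each exchange is allowed by tensoriality in that slot.
  have key (S : Finset (Fin k)) : covDeriv (fun y ↦ T y) (fun i ↦ if i ∈ S then V i else Y i) x v =
      covDeriv (fun y ↦ T y) Y x v := by
    induction S using Finset.induction_on with
    | empty => simp
    | insert i₀ S hi ih =>
      rw [← ih]
      set Z : Fin k → Π y : M, TangentSpace 𝓘(ℝ, E) y := fun i ↦ if i ∈ S then V i else Y i with hZ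
      have hZd (i : Fin k) : MDiffAt (T% (Z i)) x := by
        by_cases hiS : i ∈ S
        · simpa only [hZ, hiS, if_true] using (V i).mdifferentiableAt
        · simpa only [hZ, hiS, if_false] using hYd i
      have e1 : (fun i ↦ if i ∈ insert i₀ S then ⇑(V i) else Y i) = Function.update Z i₀ (V i₀) := by
        funext i
        rcases eq_or_ne i i₀ with rfl | hii
        · simp
        · simp [hii, hZ]
      have e2 : Z = Function.update Z i₀ (Y i₀) := by
        funext i
        rcases eq_or_ne i i₀ with rfl | hii
        · simp [hZ, hi]
        · simp [hii]
      rw [e1]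
      conv_rhs => rw [e2]
      exact (tensorialAt_covDeriv hs hT hZd i₀ v).pointwise (V i₀).mdifferentiableAt (hYd i₀) (hV i₀)
  rw [← key Finset.univ]
  simpa using h V x v

end RiemannianGeometry

/-! ### Translation of the results into `IsParallel` -/

namespace RiemannianGeometry

variable {E : Type*} [NormedAddCommGroup E] [NormedSpace ℝ E]
  {M : Type*} [TopologicalSpace M] [ChartedSpace E M] [IsManifold 𝓘(ℝ, E) ∞ M]
  [FiniteDimensional ℝ E]
  [RiemannianBundle (fun x : M ↦ TangentSpace 𝓘(ℝ, E) x)]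
  [IsContMDiffRiemannianBundle 𝓘(ℝ, E) ∞ E (fun x : M ↦ TangentSpace 𝓘(ℝ, E) x)]
  {n : ℕ} {s : Fin n → VF E M} (hs : IsParsevalFrame s)
  {J : Π x : M, TangentSpace 𝓘(ℝ, E) x →L[ℝ] TangentSpace 𝓘(ℝ, E) x} (hJ : IsKahler J)
  [T2Space M]

/-- The Ricci tensor as a multilinear map. -/
def ricciMultilinear (x : M) :
    MultilinearMap ℝ (fun _ : Fin 2 ↦ TangentSpace 𝓘(ℝ, E) x) ℝ where
  toFun v := inner ℝ (endAt hs (kahlerAlgebra hJ hs).Rc x (v 0)) (v 1)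
  map_update_add' m i a b := by
    fin_cases i <;> simp [inner_add_left, inner_add_right]
  map_update_smul' m i c a := by
    fin_cases i <;> simp [real_inner_smul_left, real_inner_smul_right]

/-- The curvature tensor as a multilinear map. -/
def curvatureMultilinear (x : M) :
    MultilinearMap ℝ (fun _ : Fin 4 ↦ TangentSpace 𝓘(ℝ, E) x) ℝ where
  toFun v := inner ℝ (triAt hs (kahlerAlgebra hJ hs).curv x (v 0) (v 1) (v 2)) (v 3)
  map_update_add' := by
    intro inst m i a b
    -- The decidability instance is arbitrary in the field; with the canonical one the updates
    -- compute.
    obtain rfl : inst = instDecidableEqFin 4 := Subsingleton.elim _ _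
    fin_cases i <;> simp [inner_add_left, inner_add_right]
  map_update_smul' := by
    intro inst m i c a
    obtain rfl : inst = instDecidableEqFin 4 := Subsingleton.elim _ _
    fin_cases i <;> simp [real_inner_smul_left, real_inner_smul_right]

theorem ricciTensor_eq : ricciTensor E M = fun x ↦ ⇑(ricciMultilinear hs hJ x) :=
  funext fun x ↦ funext fun v ↦ ricciTensor_apply hs hJ x v

theorem curvatureTensor_eq : curvatureTensor E M = fun x ↦ ⇑(curvatureMultilinear hs hJ x) :=
  funext fun x ↦ funext fun v ↦ curvatureTensor_apply hs hJ x v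

theorem covDeriv_ricciTensor (V : Fin 2 → VF E M) (X : VF E M) (x : M) :
    covDeriv (ricciTensor E M) (fun i ↦ V i) x (X x) =
      innerVF ((kahlerAlgebra hJ hs).dRc X (V 0)) (V 1) x := by
  set K := kahlerAlgebra hJ hs with hK
  have h1 : (fun y ↦ ricciTensor E M y fun i ↦ V i y) = ⇑(innerVF (K.Rc (V 0)) (V 1)) :=
    funext fun y ↦ ricciTensor_apply_self hs hJ y V
  have h2 := congrArg (fun f : SF E M ↦ f x) (K.metric X (K.Rc (V 0)) (V 1))
  change d% (⇑(innerVF (K.Rc (V 0)) (V 1))) x (X x) = inner ℝ (nabVF hs X (K.Rc (V 0)) x) (V 1 x) +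
    inner ℝ (K.Rc (V 0) x) (nabVF hs X (V 1) x) at h2
  rw [covDeriv, h1, h2, Fin.sum_univ_two, ricciTensor_apply hs hJ, ricciTensor_apply hs hJ]
  simp only [← nabVF_apply hs, Function.update_self, ne_eq, Fin.isValue, zero_ne_one,
    one_ne_zero, not_false_eq_true, Function.update_of_ne, ← hK, endAt_apply_self]
  rw [K.dRc_apply]
  change _ = inner ℝ (nabVF hs X (K.Rc (V 0)) x - K.Rc (nabVF hs X (V 0)) x) (V 1 x)
  rw [inner_sub_left]
  ring

theorem covDeriv_curvatureTensor (V : Fin 4 → VF E M) (X : VF E M) (x : M) :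
    covDeriv (curvatureTensor E M) (fun i ↦ V i) x (X x) =
      innerVF ((kahlerAlgebra hJ hs).dcurv X (V 0) (V 1) (V 2)) (V 3) x := by
  set K := kahlerAlgebra hJ hs with hK
  have h1 : (fun y ↦ curvatureTensor E M y fun i ↦ V i y) =
      ⇑(innerVF (K.curv (V 0) (V 1) (V 2)) (V 3)) :=
    funext fun y ↦ curvatureTensor_apply_self hs hJ y V
  have h2 := congrArg (fun f : SF E M ↦ f x) (K.metric X (K.curv (V 0) (V 1) (V 2)) (V 3))
  change d% (⇑(innerVF (K.curv (V 0) (V 1) (V 2)) (V 3))) x (X x) =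
    inner ℝ (nabVF hs X (K.curv (V 0) (V 1) (V 2)) x) (V 3 x) +
    inner ℝ (K.curv (V 0) (V 1) (V 2) x) (nabVF hs X (V 3) x) at h2
  rw [covDeriv, h1, h2, Fin.sum_univ_four]
  simp only [curvatureTensor_apply hs hJ]
  simp [← nabVF_apply hs, Function.update_of_ne, ← hK, triAt_apply_self]
  rw [K.dcurv_apply]
  change _ = inner ℝ (nabVF hs X (K.curv (V 0) (V 1) (V 2)) x - K.curv (nabVF hs X (V 0)) (V 1) (V 2) x
    - K.curv (V 0) (nabVF hs X (V 1)) (V 2) x - K.curv (V 0) (V 1) (nabVF hs X (V 2)) x) (V 3 x)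
  simp only [inner_sub_left]
  ring

theorem isParallel_ricciTensor_iff :
    IsParallel (ricciTensor E M) ↔ ∀ X Y, (kahlerAlgebra hJ hs).dRc X Y = 0 := by
  constructor
  · intro h X Y
    refine (kahlerAlgebra hJ hs).ext_g fun Z ↦ ?_
    rw [map_zero, LinearMap.zero_apply]
    ext x
    have := (h x (fun i ↦ (![Y, Z] : Fin 2 → VF E M) i) fun i ↦ ContMDiffSection.contMDiff _ x).2 (X x)
    rw [covDeriv_ricciTensor hs hJ] at this
    exact this
  · intro h
    rw [ricciTensor_eq hs hJ]
    refine isParallel_of_smooth hs (fun V x ↦ ?_) fun V x v ↦ ?_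
    · have h1 : (fun y ↦ ricciMultilinear hs hJ y fun i ↦ V i y) =
          ⇑(innerVF ((kahlerAlgebra hJ hs).Rc (V 0)) (V 1)) :=
        funext fun y ↦ (ricciTensor_apply hs hJ y fun i ↦ V i y).symm.trans (ricciTensor_apply_self hs hJ y V)
      have h2 := (innerVF ((kahlerAlgebra hJ hs).Rc (V 0)) (V 1)).mdifferentiableAt (x := x)
      rwa [← h1] at h2
    · change covDeriv (fun y ↦ ⇑(ricciMultilinear hs hJ y)) (fun i ↦ V i) x v = 0
      rw [← ricciTensor_eq hs hJ, ← extVF_apply_self hs v, covDeriv_ricciTensor hs hJ, h]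
      simp

theorem isParallel_curvatureTensor
    (h : ∀ X Y Z W, (kahlerAlgebra hJ hs).dcurv X Y Z W = 0) :
    IsParallel (curvatureTensor E M) := by
  rw [curvatureTensor_eq hs hJ]
  refine isParallel_of_smooth hs (fun V x ↦ ?_) fun V x v ↦ ?_
  · have h1 : (fun y ↦ curvatureMultilinear hs hJ y fun i ↦ V i y) =
        ⇑(innerVF ((kahlerAlgebra hJ hs).curv (V 0) (V 1) (V 2)) (V 3)) :=
      funext fun y ↦ (curvatureTensor_apply hs hJ y fun i ↦ V i y).symm.trans
        (curvatureTensor_apply_self hs hJ y V)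
    have h2 := (innerVF ((kahlerAlgebra hJ hs).curv (V 0) (V 1) (V 2)) (V 3)).mdifferentiableAt
      (x := x)
    rwa [← h1] at h2
  · rw [← curvatureTensor_eq hs hJ, ← extVF_apply_self hs v, covDeriv_curvatureTensor hs hJ, h]
    simp

end RiemannianGeometry

end

theorem mainTheorem3
    {E : Type*} [NormedAddCommGroup E] [NormedSpace ℝ E] [FiniteDimensional ℝ E]
    {M : Type*} [TopologicalSpace M] [T2Space M] [CompactSpace M]
    [ChartedSpace E M] [IsManifold 𝓘(ℝ, E) ∞ M]
    [RiemannianBundle (fun x : M ↦ TangentSpace 𝓘(ℝ, E) x)]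
    [IsContMDiffRiemannianBundle 𝓘(ℝ, E) ∞ E (fun x : M ↦ TangentSpace 𝓘(ℝ, E) x)]
    (J : Π x : M, TangentSpace 𝓘(ℝ, E) x →L[ℝ] TangentSpace 𝓘(ℝ, E) x)
    (hJ : IsKahler J) (hsec : NonnegSectionalCurvature E M) :
    ((∃ c : ℝ, ∀ x : M, scalarCurvature E x = c) → IsParallel (ricciTensor E M)) ∧
    (IsParallel (ricciTensor E M) → IsParallel (curvatureTensor E M)) ∧
    ((∃ c : ℝ, ∀ x : M, scalarCurvature E x = c) → IsLocallySymmetric E M) := by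
  obtain ⟨n, s, hs : IsParsevalFrame s⟩ := exists_parseval_frame E M
  have h0 := inner_triAt_nonneg hs hJ hsec
  have h1 : (∃ c : ℝ, ∀ x : M, scalarCurvature E x = c) → IsParallel (ricciTensor E M) := by
    rintro ⟨c, hc⟩
    refine (isParallel_ricciTensor_iff hs hJ).2 (dRc_eq_zero hs hJ h0 fun X ↦ ?_)
    have : (kahlerAlgebra hJ hs).scal = algebraMap ℝ (SF E M) c := by
      ext x
      rw [← scalarCurvature_eq hs hJ, hc]
      rfl
    rw [this, derivVF_algebraMap]
  have h2 : IsParallel (ricciTensor E M) → IsParallel (curvatureTensor E M) := fun h ↦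
    isParallel_curvatureTensor hs hJ
      (dcurv_eq_zero hs hJ h0 ((isParallel_ricciTensor_iff hs hJ).1 h))
  exact ⟨h1, h2, fun h ↦ h2 (h1 h)⟩
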